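/- Let $m\ge 3$. The $m$-ary search tree of a sequence of distinct keys is the following tree, in which every node has $m$ ordered (possibly empty) subtrees: the empty sequence gives the empty tree; between $1$ and $m-1$ keys are all stored in a single root node; if there are at least $m$ keys, the first $m-1$ are sorted and stored in the root, and the remaining keys are directed, in their original order, to the $m$ subtrees according to the $m$ intervals formed by the keys in the root, each subtree being the $m$-ary search tree of the keys it receives. For a uniformly random permutation of $n$ keys let $S_n$ be the number of nodes of this tree and let $N_n$ be its node path length, that is, the sum over all nodes of the distance from the root to the node. Put $$H_m=\sum_{j=1}^m\frac1j,\qquad H_m^{(2)}=\sum_{j=1}^m\frac1{j^2},\qquad \phi=\frac1{2(H_m-1)},\qquad C_K=4\phi^2\left(\frac{(m+1)H_m^{(2)}-2}{m-1}-\frac{\pi^2}6\right).$$ **Theorem.** As $n\to\infty$, with $m$ fixed: 1. If $3\le m\le 13$, there is a constant $C_S>0$ (depending only on $m$) such that $\mathrm{Var}(S_n)\sim C_S\,n$ and $$\mathrm{Cov}(S_n,N_n)\sim 2\phi\, C_S\, n\log n .$$ 2. If $m\ge 14$, let $\lambda=\alpha+i\beta$ be the zero with $\beta>0$ of $\Lambda(z)=z(z+1)\cdots(z+m-2)-m!$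 that has the second largest real part among the zeros of $\Lambda$ (the largest zero being $2$); such a zero exists. Then $$\mathrm{Cov}(S_n,N_n)=\phi\,F_2(\beta\log n)\,n^{\alpha}+o(n^{\alpha}),$$ where $F_2$ is the $2\pi$-periodic function $$F_2(z)=4\phi\,\Re\left(\frac{(\lambda+m-1)A\,e^{iz}}{(m-1)\Gamma(\lambda)}\left(\frac1{2\phi}-\psi(\lambda+m)+\frac{\lambda\psi(\lambda+1)+(m-1)(1-\gamma)}{\lambda+m-1}\right)\right),\qquad A=\frac1{\lambda(\lambda-1)\sum_{j=0}^{m-2}\frac1{j+\lambda}},$$ $\psi$ is the digamma function and $\gamma$ is Euler's constant. 3. For every $m\ge3$, $\mathrm{Var}(N_n)\sim\phi^2C_K\,n^2$. -/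

import Mathlib

open Filter Asymptotics MeasureTheory ProbabilityTheory

namespace MarySearchTree

/-- An `m`-ary tree whose nodes carry lists of keys: it is either empty or consists of a root
together with an ordered `m`-tuple of `m`-ary trees. -/
inductive MTree (m : ℕ) (κ : Type) : Type
  | empty : MTree m κ
  | node (keys : List κ) (children : Fin m → MTree m κ) : MTree m κ

/-- The number of nodes of a tree. -/
def MTree.numNodes {m : ℕ} {κ : Type} : MTree m κ → ℕ
  | .empty => 0
  | .node _ c => 1 + ∑ i, (c i).numNodes

/-- The sum of the depths of all nodes of a tree whose root is regarded as having depth `d`. -/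
def MTree.depthSum {m : ℕ} {κ : Type} : MTree m κ → ℕ → ℕ
  | .empty, _ => 0
  | .node _ c, d => d + ∑ i, (c i).depthSum (d + 1)

/-- The node path length: the sum over all nodes of the distance from the root to the node. -/
def MTree.nodePathLength {m : ℕ} {κ : Type} (t : MTree m κ) : ℕ := t.depthSum 0

/-- The `m`-ary search tree (`2 ≤ m`) of a sequence of distinct keys. The empty sequence gives the
empty tree. If there are fewer than `m` keys, they are all stored in the root. Otherwise the first
`m - 1` keys are sorted and stored in the root, and each remaining key `x` is directed to the
subtree of its interval: the `i`-th subtree (`i = 0, …, m - 1`) receives, in their original order,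
those `x` that exceed exactly `i` of the root keys. (For the degenerate values `m < 2`, which are
never used, all keys are put in the root.) -/
def searchTree {κ : Type} [LinearOrder κ] (m : ℕ) (l : List κ) : MTree m κ :=
  if l = [] then .empty
  else if l.length < m ∨ m < 2 then .node (l.mergeSort (fun a b => decide (a ≤ b))) fun _ => .empty
  else
    .node ((l.take (m - 1)).mergeSort (fun a b => decide (a ≤ b))) fun i =>
      searchTree m ((l.drop (m - 1)).filter fun x =>
        decide ((l.take (m - 1)).countP (fun r => decide (r < x)) = (i : ℕ)))
termination_by l.length
decreasing_by
  rename_i h1 h2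
  have _h3 : 0 < l.length := List.length_pos_iff.mpr h1
  refine lt_of_le_of_lt (List.length_filter_le _ _) ?_
  rw [List.length_drop]
  omega

/-- The search tree of the sequence `σ 0, …, σ (n - 1)`. -/
def permTree (m n : ℕ) (σ : Equiv.Perm (Fin n)) : MTree m (Fin n) :=
  searchTree m (List.ofFn fun i => σ i)

instance permMeasurableSpace (n : ℕ) : MeasurableSpace (Equiv.Perm (Fin n)) := ⊤

/-- The uniform distribution on the `n!` permutations. -/
noncomputable def permLaw (n : ℕ) : Measure (Equiv.Perm (Fin n)) :=
  (PMF.uniformOfFintype (Equiv.Perm (Fin n))).toMeasure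

/-- Space requirement `S_n` of the random `m`-ary search tree. -/
def S (m n : ℕ) (σ : Equiv.Perm (Fin n)) : ℝ := ((permTree m n σ).numNodes : ℝ)

/-- Node path length `N_n` of the random `m`-ary search tree. -/
def N (m n : ℕ) (σ : Equiv.Perm (Fin n)) : ℝ := ((permTree m n σ).nodePathLength : ℝ)

/-- `H_m = ∑_{1 ≤ j ≤ m} 1 / j`. -/
noncomputable def H (m : ℕ) : ℝ := ∑ j ∈ Finset.Icc 1 m, 1 / (j : ℝ)

/-- `H_m^{(2)} = ∑_{1 ≤ j ≤ m} 1 / j ^ 2`. -/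
noncomputable def H2 (m : ℕ) : ℝ := ∑ j ∈ Finset.Icc 1 m, 1 / (j : ℝ) ^ 2

/-- The occupancy constant `φ`. -/
noncomputable def phi (m : ℕ) : ℝ := 1 / (2 * (H m - 1))

/-- The constant `C_K`. -/
noncomputable def CK (m : ℕ) : ℝ :=
  4 * phi m ^ 2 * ((((m : ℝ) + 1) * H2 m - 2) / ((m : ℝ) - 1) - Real.pi ^ 2 / 6)

/-- `Λ(z) = z (z + 1) ⋯ (z + m - 2) - m!`. -/
noncomputable def indicial (m : ℕ) (z : ℂ) : ℂ :=
  (∏ j ∈ Finset.range (m - 1), (z + (j : ℂ))) - (m.factorial : ℂ)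

/-- `lam = α + i β` is the second largest zero, in real parts, of `Λ`, with `β > 0`. The largest
zero is `2`. -/
structure IsSecondZero (m : ℕ) (lam : ℂ) : Prop where
  zero : indicial m lam = 0
  re_lt : lam.re < 2
  im_pos : 0 < lam.im
  le_re : ∀ w : ℂ, indicial m w = 0 → w ≠ 2 → w.re ≤ lam.re

/-- The coefficient `A = 1 / (λ (λ - 1) ∑_{0 ≤ j ≤ m - 2} 1 / (j + λ))`. -/
noncomputable def coeffA (m : ℕ) (lam : ℂ) : ℂ :=
  1 / (lam * (lam - 1) * ∑ j ∈ Finset.range (m - 1), 1 / ((j : ℂ) + lam))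

/-- The `2π`-periodic function `F_2`, with `ψ` the digamma function and `γ` Euler's constant. -/
noncomputable def F2 (m : ℕ) (lam : ℂ) (z : ℝ) : ℝ :=
  4 * phi m *
    ((lam + (m : ℂ) - 1) * coeffA m lam * Complex.exp (Complex.I * (z : ℂ)) /
        (((m : ℂ) - 1) * Complex.Gamma lam) *
      (1 / (2 * (phi m : ℂ)) - Complex.digamma (lam + (m : ℂ)) +
        (lam * Complex.digamma (lam + 1) +
            ((m : ℂ) - 1) * (1 - (Real.eulerMascheroniConstant : ℂ))) /
          (lam + (m : ℂ) - 1))).re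

end MarySearchTree

/-! Condition on the root. For `n ≥ m - 1`, the root keys of a uniform permutation cut the remaining
keys into `m` blocks whose sizes form a uniformly random composition of `n - (m - 1)`. Given the
sizes, the subtrees are independent search trees of uniform permutations (`avg_orderings_split`,
`avg_sizes`). Let `opT` be the expectation of a sum over the subtree sizes. The means, and by the
law of total covariance also the covariances, then solve equations `a = b + opT m a`. The toll `b`
of a covariance contains the mean product of the deviations of the two conditional means. It also
contains lower covariances, because every node of a subtree lies one level deeper in the whole tree
(`covSS_rec`, `covSN_rec`, `covNN_rec`).

On generating functions `opT` inverts a differential operator. With `theta` for `(1 - z) d/dz`, the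
rising factorial of `theta` of order `m - 1` sends `opT m a` to `m! a` (`aeval_ascPochhammer_opT`),
so `Λ(theta)` sends `opT m a` to `m! b`. The coefficients `ecoef s` of `(1 - z) ^ (-s)` are
eigenvectors of `theta` and have order `n ^ (s - 1)`. Splitting `Λ` into linear factors reduces
every growth estimate to first order recurrences. A toll that outgrows all modes is passed on with
the factor `1 / (1 - m / ecoef w (m - 1))` (`transfer_particular`). A toll below the mode `2` leaves
a multiple of `ecoef 2` (`transfer_expansion`). A toll of the order of that mode resonates and
creates a logarithm, carried by `lcoef 2` (`transfer_resonance`).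

The dichotomy at `m = 13` concerns the zeros of `Λ`: those other than `2` lie to the left of the
line `Re z = 1` exactly when `m ≤ 13`. This is read off from the modulus and the argument of the
product `z (z + 1) ⋯ (z + m - 2)` (`re_lt_one_of_root`, `exists_root_re_gt_one`).

If `m ≤ 13`, the mean of `S` is linear up to `o(1)`, the variance is `c n + O(1)`, and as a toll for
the covariance with `N` it resonates at `2`. If `m ≥ 14`, the deviation of `S` is led by the modes
of `λ` and its conjugate, that of `N` by `2 φ ^ 2` times the deviation of `lcoef 2`. Their mixed
moment is computed from exact product formulas and `hsum s n - log n → -ψ(s)`. For the variance of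
`N` the toll is the variance of a sum of `lcoef 2` over the subtrees; its logarithms cancel and
`pathConst` remains. -/

namespace MarySearchTree

open Finset Topology

/-! ### Coefficients of powers of `1 / (1 - z)`, the operator `theta`, and growth rates -/

section Coefficients

variable {K : Type*} [Field K]

/-- The coefficient of `z ^ n` in `(1 - z) ^ (-s)`. -/
noncomputable def ecoef (s : K) (n : ℕ) : K := ∏ k ∈ range n, (s + k) / (k + 1)

/-- The sum `1 / s + 1 / (s + 1) + ⋯ + 1 / (s + n - 1)`. -/
noncomputable def hsum (s : K) (n : ℕ) : K := ∑ k ∈ range n, 1 / (s + k)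

/-- The sum `1 / s ^ 2 + ⋯ + 1 / (s + n - 1) ^ 2`. -/
noncomputable def hsumSq (s : K) (n : ℕ) : K := ∑ k ∈ range n, 1 / (s + k) ^ 2

/-- The derivative of `ecoef` in the parameter. -/
noncomputable def lcoef (s : K) (n : ℕ) : K := ecoef s n * hsum s n

/-- The second derivative of `ecoef` in the parameter. -/
noncomputable def qcoef (s : K) (n : ℕ) : K := ecoef s n * (hsum s n ^ 2 - hsumSq s n)

@[simp] lemma ecoef_zero (s : K) : ecoef s 0 = 1 := by simp [ecoef]
@[simp] lemma hsum_zero (s : K) : hsum s 0 = 0 := by simp [hsum]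
@[simp] lemma hsumSq_zero (s : K) : hsumSq s 0 = 0 := by simp [hsumSq]
@[simp] lemma lcoef_zero (s : K) : lcoef s 0 = 0 := by simp [lcoef]
@[simp] lemma qcoef_zero (s : K) : qcoef s 0 = 0 := by simp [qcoef]

lemma ecoef_succ (s : K) (n : ℕ) : ecoef s (n + 1) = ecoef s n * ((s + n) / (n + 1)) := by
  rw [ecoef, prod_range_succ]; rfl

lemma hsum_succ (s : K) (n : ℕ) : hsum s (n + 1) = hsum s n + 1 / (s + n) := by
  rw [hsum, sum_range_succ]; rfl

lemma hsumSq_succ (s : K) (n : ℕ) : hsumSq s (n + 1) = hsumSq s n + 1 / (s + n) ^ 2 := by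
  rw [hsumSq, sum_range_succ]; rfl

lemma hsum_add (s : K) (a b : ℕ) : hsum s (a + b) = hsum s a + hsum (s + a) b := by
  simp only [hsum, sum_range_add]
  congr 1
  refine sum_congr rfl fun i _ => ?_
  push_cast; rw [add_assoc]

lemma hsumSq_add (s : K) (a b : ℕ) : hsumSq s (a + b) = hsumSq s a + hsumSq (s + a) b := by
  simp only [hsumSq, sum_range_add]
  congr 1
  refine sum_congr rfl fun i _ => ?_
  push_cast; rw [add_assoc]

variable [CharZero K]

lemma succ_mul_ecoef_succ (s : K) (n : ℕ) :
    ((n : K) + 1) * ecoef s (n + 1) = (n + s) * ecoef s n := by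
  have : (n : K) + 1 ≠ 0 := Nat.cast_add_one_ne_zero n
  rw [ecoef_succ]; field_simp; ring

lemma ecoef_one (n : ℕ) : ecoef (1 : K) n = 1 := by
  refine prod_eq_one fun k _ => ?_
  rw [add_comm, div_self (Nat.cast_add_one_ne_zero k)]

lemma ecoef_two (n : ℕ) : ecoef (2 : K) n = n + 1 := by
  induction n with
  | zero => simp
  | succ n ih =>
    have : (n : K) + 1 ≠ 0 := Nat.cast_add_one_ne_zero n
    rw [ecoef_succ, ih]; push_cast; field_simp; ring

lemma ecoef_three (n : ℕ) : ecoef (3 : K) n = (n + 1) * (n + 2) / 2 := by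
  induction n with
  | zero => simp
  | succ n ih =>
    have : (n : K) + 1 ≠ 0 := Nat.cast_add_one_ne_zero n
    rw [ecoef_succ, ih]; push_cast; field_simp; ring

lemma mul_ecoef_add_one (s : K) (n : ℕ) : s * ecoef (s + 1) n = (n + s) * ecoef s n := by
  induction n with
  | zero => simp
  | succ n ih =>
    have : (n : K) + 1 ≠ 0 := Nat.cast_add_one_ne_zero n
    rw [ecoef_succ, ← mul_assoc, ih, ecoef_succ]; push_cast; field_simp; ring

end Coefficients

lemma ecoef_ofReal (s : ℝ) (n : ℕ) : ecoef (s : ℂ) n = (ecoef s n : ℝ) := by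
  simp [ecoef]

lemma hsum_ofReal (s : ℝ) (n : ℕ) : hsum (s : ℂ) n = (hsum s n : ℝ) := by
  simp [hsum]

lemma lcoef_ofReal (s : ℝ) (n : ℕ) : lcoef (s : ℂ) n = (lcoef s n : ℝ) := by
  simp [lcoef, ecoef_ofReal, hsum_ofReal]

lemma ecoef_pos {s : ℝ} (hs : 0 < s) (n : ℕ) : 0 < ecoef s n :=
  prod_pos fun k _ => by positivity

lemma ecoef_mono {s : ℝ} (hs : 1 ≤ s) : Monotone (ecoef s) := by
  refine monotone_nat_of_le_succ fun n => ?_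
  rw [ecoef_succ]
  refine le_mul_of_one_le_right (ecoef_pos (by linarith) n).le ?_
  rw [one_le_div (by positivity)]; linarith

lemma ecoef_le_of_le {s t : ℝ} (hs : 0 < s) (h : s ≤ t) (n : ℕ) : ecoef s n ≤ ecoef t n :=
  prod_le_prod (fun k _ => by positivity) fun k _ => by gcongr

lemma conj_ecoef (s : ℂ) (n : ℕ) :
    (starRingEnd ℂ) (ecoef s n) = ecoef ((starRingEnd ℂ) s) n := by
  simp [ecoef, map_prod]

/-- The operator `(1 - z) d/dz` on coefficient sequences. -/
noncomputable def theta : Module.End ℂ (ℕ → ℂ) where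
  toFun a n := (n + 1) * a (n + 1) - n * a n
  map_add' a b := by ext n; simp; ring
  map_smul' c a := by ext n; simp; ring

lemma theta_apply (a : ℕ → ℂ) (n : ℕ) : theta a n = (n + 1) * a (n + 1) - n * a n := rfl

lemma theta_ecoef (s : ℂ) : theta (ecoef s) = s • ecoef s := by
  ext n
  rw [theta_apply, succ_mul_ecoef_succ]; simp; ring

/-- Differentiating the eigenvalue equation of `ecoef s` in `s` gives a Jordan chain `ecoef`,
`lcoef`, `qcoef`. -/
lemma theta_lcoef {s : ℂ} (hs : ∀ k : ℕ, s + k ≠ 0) :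
    theta (lcoef s) = s • lcoef s + ecoef s := by
  ext n
  have := hs n
  rw [theta_apply, lcoef, ← mul_assoc, succ_mul_ecoef_succ, hsum_succ]
  simp only [lcoef, Pi.add_apply, Pi.smul_apply, smul_eq_mul]
  field_simp; ring

lemma theta_qcoef {s : ℂ} (hs : ∀ k : ℕ, s + k ≠ 0) :
    theta (qcoef s) = s • qcoef s + (2 : ℂ) • lcoef s := by
  ext n
  have := hs n
  rw [theta_apply, qcoef, ← mul_assoc, succ_mul_ecoef_succ, hsum_succ, hsumSq_succ]
  simp only [lcoef, qcoef, Pi.add_apply, Pi.smul_apply, smul_eq_mul]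
  field_simp; ring

/-- A first order recurrence determines the sequence. -/
lemma theta_ext {s : ℂ} {a b : ℕ → ℂ} (h0 : a 0 = b 0)
    (h : theta a - s • a = theta b - s • b) : a = b := by
  ext n
  induction n with
  | zero => exact h0
  | succ n ih =>
    have := congrFun h n
    simp only [Pi.sub_apply, theta_apply, Pi.smul_apply, smul_eq_mul, ih] at this
    have hn : (n : ℂ) + 1 ≠ 0 := Nat.cast_add_one_ne_zero n
    exact mul_left_cancel₀ hn (by linear_combination this)

/-- The modulus of `n + lam` differs from `n + lam.re` by a term tending to zero, so any larger `ρ`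
wins. This replaces a complex multiplier by a real one. -/
lemma eventually_norm_add_le {lam : ℂ} {ρ : ℝ} (h : lam.re < ρ) :
    ∀ᶠ n : ℕ in atTop, ‖(n : ℂ) + lam‖ ≤ n + ρ := by
  have h1 : ∀ᶠ n : ℕ in atTop, lam.im ^ 2 / (ρ - lam.re) + |ρ + lam.re| + |ρ| ≤ n :=
    tendsto_natCast_atTop_atTop.eventually_ge_atTop _
  filter_upwards [h1] with n hn
  have hp : 0 < ρ - lam.re := by linarith
  have h2 : 0 ≤ lam.im ^ 2 / (ρ - lam.re) := by positivity
  have h3 := neg_abs_le (ρ + lam.re)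
  have h4 := neg_abs_le ρ
  have h5 := abs_nonneg (ρ + lam.re)
  have h6 := abs_nonneg ρ
  have h7 : lam.im ^ 2 ≤ (ρ - lam.re) * n := by
    rw [← div_le_iff₀' hp]; linarith
  rw [Complex.norm_def]
  refine Real.sqrt_le_iff.mpr ⟨by linarith, ?_⟩
  rw [Complex.normSq_apply]
  simp only [Complex.add_re, Complex.natCast_re, Complex.add_im, Complex.natCast_im, zero_add]
  nlinarith [mul_nonneg hp.le (show 0 ≤ (n : ℝ) + (ρ + lam.re) by linarith)]

/-- Comparison: the right side `v` solves `(n + 1) v (n + 1) = (n + ρ) v n + ε * ecoef σ n` exactly,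
since `n + σ = (n + ρ) + (σ - ρ)`. The constant `C` absorbs the initial value. -/
lemma first_order_bound {lam : ℂ} {ρ σ ε : ℝ} (hρ : 0 < ρ) (h1 : lam.re < ρ) (h2 : ρ < σ)
    {f g : ℕ → ℂ} (hfg : theta f - lam • f = g)
    (hg : ∀ᶠ n in atTop, ‖g n‖ ≤ ε * ecoef σ n) :
    ∃ C, 0 ≤ C ∧ ∀ᶠ n in atTop, ‖f n‖ ≤ ε / (σ - ρ) * ecoef σ n + C * ecoef ρ n := by
  obtain ⟨N, hN⟩ := eventually_atTop.mp (hg.and (eventually_norm_add_le h1))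
  have hε : 0 ≤ ε := nonneg_of_mul_nonneg_left ((norm_nonneg _).trans (hN N le_rfl).1)
    (ecoef_pos (hρ.trans h2) N)
  refine ⟨‖f N‖ / ecoef ρ N, div_nonneg (norm_nonneg _) (ecoef_pos hρ N).le,
    eventually_atTop.mpr ⟨N, fun n hn => ?_⟩⟩
  have hd : 0 < σ - ρ := by linarith
  set C := ‖f N‖ / ecoef ρ N
  set A := ε / (σ - ρ) with hA
  have hAe : A * (σ - ρ) = ε := div_mul_cancel₀ _ hd.ne'
  induction n, hn using Nat.le_induction with
  | base =>
    have : C * ecoef ρ N = ‖f N‖ := div_mul_cancel₀ _ (ecoef_pos hρ N).ne'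
    rw [this]
    have := mul_nonneg (div_nonneg hε hd.le) (ecoef_pos (hρ.trans h2) N).le
    linarith
  | succ n hn ih =>
    obtain ⟨hg1, hl⟩ := hN n hn
    have hrec : ((n : ℂ) + 1) * f (n + 1) = (n + lam) * f n + g n := by
      rw [← hfg]; simp [theta_apply]; ring
    have hnn : (0 : ℝ) < n + 1 := by positivity
    have h3 : ((n : ℝ) + 1) * ‖f (n + 1)‖ ≤ (n + ρ) * ‖f n‖ + ε * ecoef σ n := by
      have : ((n : ℝ) + 1) * ‖f (n + 1)‖ = ‖((n : ℂ) + 1) * f (n + 1)‖ := by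
        rw [norm_mul]; congr 1
        rw [show (n : ℂ) + 1 = ((n + 1 : ℕ) : ℂ) by push_cast; rfl, Complex.norm_natCast]
        push_cast; rfl
      rw [this, hrec]
      refine (norm_add_le _ _).trans (add_le_add ?_ hg1)
      rw [norm_mul]
      exact mul_le_mul_of_nonneg_right hl (norm_nonneg _)
    refine le_of_mul_le_mul_left (h3.trans ?_) hnn
    have e1 := succ_mul_ecoef_succ σ n
    have e2 := succ_mul_ecoef_succ ρ n
    have : ((n : ℝ) + 1) * (A * ecoef σ (n + 1) + C * ecoef ρ (n + 1))
        = A * ((n + σ) * ecoef σ n) + C * ((n + ρ) * ecoef ρ n) := by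
      rw [← e1, ← e2]; ring
    rw [this]
    have h5 : (n + ρ) * ‖f n‖ ≤ (n + ρ) * (A * ecoef σ n + C * ecoef ρ n) := by gcongr
    refine (add_le_add_left h5 _).trans (le_of_eq ?_)
    rw [← hAe]; ring

lemma ne_neg_nat_of_re_pos {s : ℂ} (hs : 0 < s.re) (k : ℕ) : s + k ≠ 0 := by
  intro h
  have := congrArg Complex.re h
  simp at this
  have hk : (0 : ℝ) ≤ k := k.cast_nonneg
  linarith

lemma natCast_cpow_sub_one {n : ℕ} (hn : n ≠ 0) (s : ℂ) :
    (n : ℂ) ^ (s - 1) = (n : ℂ) ^ s / n := by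
  rw [Complex.cpow_sub _ _ (Nat.cast_ne_zero.mpr hn), Complex.cpow_one]

/-- Gauss's product for the Gamma function is the reciprocal of this coefficient, apart from its one
extra factor `s + n`. -/
lemma ecoef_eq_GammaSeq {s : ℂ} (hs : ∀ k : ℕ, s + k ≠ 0) {n : ℕ} (hn : n ≠ 0) :
    ecoef s n / (n : ℂ) ^ (s - 1) = (n / (s + n)) * (Complex.GammaSeq s n)⁻¹ := by
  have h1 : ecoef s n = (∏ j ∈ range n, (s + j)) / (n.factorial : ℂ) := by
    rw [ecoef, prod_div_distrib]
    congr 1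
    rw [← prod_range_add_one_eq_factorial]; push_cast; rfl
  have hn' : (n : ℂ) ≠ 0 := Nat.cast_ne_zero.mpr hn
  have hc : (n : ℂ) ^ s ≠ 0 := by simp [Complex.cpow_eq_zero_iff, hn]
  have := hs n
  have hf : (n.factorial : ℂ) ≠ 0 := by exact_mod_cast n.factorial_ne_zero
  have hp : ∏ j ∈ range n, (s + (j : ℂ)) ≠ 0 := prod_ne_zero_iff.mpr fun k _ => hs k
  rw [h1, Complex.GammaSeq, prod_range_succ, natCast_cpow_sub_one hn]
  field_simp

/-- The coefficients of `(1 - z) ^ (-s)` are asymptotic to `n ^ (s - 1) / Γ(s)`. -/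
lemma tendsto_ecoef_div_cpow {s : ℂ} (hs : ∀ k : ℕ, s + k ≠ 0) :
    Tendsto (fun n : ℕ => ecoef s n / (n : ℂ) ^ (s - 1)) atTop (𝓝 (1 / Complex.Gamma s)) := by
  have hG : Complex.Gamma s ≠ 0 :=
    Complex.Gamma_ne_zero fun m h => hs m (by rw [h]; ring)
  have h1 : Tendsto (fun n : ℕ => (n : ℂ) / (s + n)) atTop (𝓝 1) := by
    simpa [add_comm] using tendsto_natCast_div_add_atTop s
  have h2 := h1.mul ((Complex.GammaSeq_tendsto_Gamma s).inv₀ hG)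
  rw [one_mul, ← one_div] at h2
  refine h2.congr' ?_
  filter_upwards [eventually_ne_atTop 0] with n hn
  rw [ecoef_eq_GammaSeq hs hn]

lemma tendsto_ecoef_div_rpow {s : ℝ} (hs : 0 < s) :
    Tendsto (fun n : ℕ => ecoef s n / (n : ℝ) ^ (s - 1)) atTop (𝓝 (1 / Real.Gamma s)) := by
  have h := tendsto_ecoef_div_cpow (s := (s : ℂ))
    (ne_neg_nat_of_re_pos (by simpa using hs))
  have h2 := (Complex.continuous_re.tendsto _).comp h
  rw [Complex.Gamma_ofReal, ← Complex.ofReal_one, ← Complex.ofReal_div, Complex.ofReal_re] at h2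
  refine h2.congr fun n => ?_
  simp only [Function.comp_apply]
  rw [ecoef_ofReal, ← Complex.ofReal_sub, ← Complex.ofReal_natCast,
    ← Complex.ofReal_cpow n.cast_nonneg, ← Complex.ofReal_div, Complex.ofReal_re]

lemma ecoef_isTheta_rpow {s : ℝ} (hs : 0 < s) :
    (ecoef s) =Θ[atTop] (fun n : ℕ => (n : ℝ) ^ (s - 1)) := by
  have hG := Real.Gamma_pos_of_pos hs
  refine ⟨?_, ?_⟩
  · refine isBigO_of_div_tendsto_nhds ?_ _ (tendsto_ecoef_div_rpow hs)
    filter_upwards [eventually_gt_atTop 0] with n hn h0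
    exact absurd h0 (Real.rpow_pos_of_pos (Nat.cast_pos.mpr hn) _).ne'
  · refine isBigO_of_div_tendsto_nhds ?_ (Real.Gamma s) ?_
    · exact Eventually.of_forall fun n h0 => absurd h0 (ecoef_pos hs n).ne'
    · have := (tendsto_ecoef_div_rpow hs).inv₀ (one_div_pos.mpr hG).ne'
      simpa [Pi.div_def] using this

lemma norm_ecoef_isTheta {s : ℂ} (hs : 0 < s.re) :
    (ecoef s) =Θ[atTop] (ecoef s.re) := by
  refine IsTheta.trans ?_ (ecoef_isTheta_rpow hs).symm
  have hk := ne_neg_nat_of_re_pos hs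
  have hG : Complex.Gamma s ≠ 0 := Complex.Gamma_ne_zero_of_re_pos hs
  have hev : ∀ᶠ n : ℕ in atTop, ‖(n : ℂ) ^ (s - 1)‖ = ‖(n : ℝ) ^ (s.re - 1)‖ := by
    filter_upwards [eventually_gt_atTop 0] with n hn
    rw [Complex.norm_natCast_cpow_of_pos hn, Real.norm_of_nonneg (by positivity)]
    simp
  refine IsTheta.trans (g := fun n : ℕ => (n : ℂ) ^ (s - 1)) ?_
    ⟨IsBigO.of_bound 1 (hev.mono fun n h => by rw [h, one_mul]),
      IsBigO.of_bound 1 (hev.mono fun n h => by rw [h, one_mul])⟩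
  refine ⟨?_, ?_⟩
  · refine isBigO_of_div_tendsto_nhds ?_ _ (tendsto_ecoef_div_cpow hk)
    filter_upwards [eventually_gt_atTop 0] with n hn h0
    simp [Complex.cpow_eq_zero_iff, hn.ne'] at h0
  · refine isBigO_of_div_tendsto_nhds ?_ (Complex.Gamma s) ?_
    · refine Eventually.of_forall fun n h0 => absurd h0 ?_
      exact prod_ne_zero_iff.mpr fun k _ => div_ne_zero (hk k) (Nat.cast_add_one_ne_zero k)
    · have := (tendsto_ecoef_div_cpow hk).inv₀ (one_div_ne_zero hG)
      simpa [Pi.div_def] using this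

lemma rpow_isLittleO_rpow {a b : ℝ} (h : a < b) :
    (fun n : ℕ => (n : ℝ) ^ a) =o[atTop] (fun n : ℕ => (n : ℝ) ^ b) := by
  have h1 : Tendsto (fun n : ℕ => (n : ℝ) ^ (-(b - a))) atTop (𝓝 0) :=
    (tendsto_rpow_neg_atTop (sub_pos.mpr h)).comp tendsto_natCast_atTop_atTop
  refine (isLittleO_iff_tendsto' ?_).mpr (h1.congr' ?_)
  · filter_upwards [eventually_gt_atTop 0] with n hn h0
    exact absurd h0 (Real.rpow_pos_of_pos (Nat.cast_pos.mpr hn) _).ne'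
  · filter_upwards [eventually_gt_atTop 0] with n hn
    rw [← Real.rpow_sub (Nat.cast_pos.mpr hn)]; congr 1; ring

lemma ecoef_isLittleO {s t : ℝ} (hs : 0 < s) (h : s < t) :
    (ecoef s) =o[atTop] (ecoef t) :=
  (ecoef_isTheta_rpow hs).trans_isLittleO <|
    (rpow_isLittleO_rpow (by linarith)).trans_isTheta (ecoef_isTheta_rpow (hs.trans h)).symm

lemma ecoef_isBigO_of_le {s t : ℝ} (hs : 0 < s) (h : s ≤ t) : (ecoef s) =O[atTop] (ecoef t) :=
  IsBigO.of_bound 1 <| Eventually.of_forall fun n => by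
    rw [one_mul, Real.norm_of_nonneg (ecoef_pos hs n).le,
      Real.norm_of_nonneg (ecoef_pos (hs.trans_le h) n).le]
    exact ecoef_le_of_le hs h n

lemma const_isLittleO_ecoef {s : ℝ} (hs : 1 < s) (c : ℂ) :
    (fun _ : ℕ => c) =o[atTop] (ecoef s) := by
  refine (isBigO_const_const c (one_ne_zero (α := ℝ)) _).trans_isLittleO ?_
  have := ecoef_isLittleO one_pos hs
  refine this.congr_left fun n => ecoef_one n

lemma ecoef_mul_isTheta {s t : ℝ} (hs : 0 < s) (ht : 0 < t) (hst : 1 < s + t) :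
    (fun n => ecoef s n * ecoef t n) =Θ[atTop] (ecoef (s + t - 1)) := by
  refine ((ecoef_isTheta_rpow hs).mul (ecoef_isTheta_rpow ht)).trans
    (IsTheta.trans ?_ (ecoef_isTheta_rpow (by linarith)).symm)
  refine EventuallyEq.isTheta ?_
  filter_upwards [eventually_gt_atTop 0] with n hn
  rw [← Real.rpow_add (Nat.cast_pos.mpr hn)]
  congr 1; ring

/-! ### Harmonic-type sums and the digamma function -/

section Digamma

/-- The Gauss sequence increases to its limit, because `(1 + 1 / k) ^ x ≥ 1 + x / (k + 1)`. This
supplies the dominating function for the contour integral used for the digamma limit. -/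
lemma real_GammaSeq_le_Gamma {x : ℝ} (hx : 0 < x) {n : ℕ} (hn : 0 < n) :
    Real.GammaSeq x n ≤ Real.Gamma x := by
  have hm : MonotoneOn (Real.GammaSeq x) (Set.Ici 1) := by
    refine monotoneOn_nat_Ici_of_le_succ fun k hk => ?_
    have hk' : (0 : ℝ) < k := by exact_mod_cast hk
    have hp : 0 < ∏ j ∈ range (k + 1), (x + (j : ℝ)) := prod_pos fun j _ => by positivity
    simp only [Real.GammaSeq]
    rw [prod_range_succ _ (k + 1), Nat.factorial_succ, div_le_div_iff₀ hp (by positivity)]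
    have h1 : (1 : ℝ) / (k + 1) ≤ Real.log ((k + 1) / k) := by
      have := Real.one_sub_inv_le_log_of_pos (x := ((k : ℝ) + 1) / k) (by positivity)
      refine le_trans (le_of_eq ?_) this
      field_simp; ring
    have h2 : (x + (k + 1)) / (k + 1) ≤ (((k : ℝ) + 1) / k) ^ x := by
      rw [Real.rpow_def_of_pos (by positivity)]
      have h3 := Real.add_one_le_exp (Real.log (((k : ℝ) + 1) / k) * x)
      refine le_trans ?_ h3
      have : (x + (k + 1)) / (k + 1) = 1 / ((k : ℝ) + 1) * x + 1 := by field_simp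
      rw [this]; gcongr
    rw [Real.div_rpow (by positivity) hk'.le, div_le_div_iff₀ (by positivity) (by positivity)] at h2
    push_cast
    have : 0 < (k.factorial : ℝ) * ∏ j ∈ range (k + 1), (x + (j : ℝ)) := by positivity
    nlinarith [mul_le_mul_of_nonneg_left h2 this.le]
  refine ge_of_tendsto (Real.GammaSeq_tendsto_Gamma x) ?_
  filter_upwards [eventually_ge_atTop n] with k hk
  exact hm (Set.mem_Ici.mpr hn) (Set.mem_Ici.mpr (hn.trans_le hk)) hk

lemma norm_GammaSeq_le {s : ℂ} (hs : 0 < s.re) {n : ℕ} (hn : 0 < n) :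
    ‖Complex.GammaSeq s n‖ ≤ Real.Gamma s.re := by
  refine le_trans ?_ (real_GammaSeq_le_Gamma hs hn)
  rw [Complex.GammaSeq, Real.GammaSeq, norm_div, norm_mul, Complex.norm_natCast_cpow_of_pos hn,
    Complex.norm_natCast, norm_prod]
  have : ∀ j : ℕ, 0 < s.re + j := fun j => by positivity
  refine div_le_div_of_nonneg_left (by positivity) (prod_pos fun j _ => this j) ?_
  refine prod_le_prod (fun j _ => (this j).le) fun j _ => ?_
  refine le_trans (le_of_eq ?_) (Complex.re_le_norm _)
  simp

lemma hasDerivAt_GammaSeq {s : ℂ} (hs : 0 < s.re) {n : ℕ} (hn : n ≠ 0) :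
    HasDerivAt (fun z => Complex.GammaSeq z n)
      (Complex.GammaSeq s n * (Complex.log n - hsum s (n + 1))) s := by
  have hk := ne_neg_nat_of_re_pos hs
  have hp : ∏ j ∈ range (n + 1), (s + (j : ℂ)) ≠ 0 := prod_ne_zero_iff.mpr fun k _ => hk k
  have h1 : HasDerivAt (fun z : ℂ => (n : ℂ) ^ z * (n.factorial : ℂ))
      ((n : ℂ) ^ s * Complex.log n * 1 * (n.factorial : ℂ)) s :=
    ((hasDerivAt_id s).const_cpow (Or.inl (Nat.cast_ne_zero.mpr hn))).mul_const _
  have h2 : HasDerivAt (fun z : ℂ => ∏ j ∈ range (n + 1), (z + (j : ℂ)))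
      ((∏ j ∈ range (n + 1), (s + (j : ℂ))) * hsum s (n + 1)) s := by
    have := HasDerivAt.fun_finsetProd (u := range (n + 1)) (f := fun j z => z + (j : ℂ))
      (f' := fun _ => 1) (x := s) fun j _ => (hasDerivAt_id s).add_const _
    refine this.congr_deriv ?_
    rw [hsum, mul_sum]
    refine sum_congr rfl fun j hj => ?_
    rw [← mul_prod_erase _ _ hj, smul_eq_mul]
    have := hk j
    field_simp
  refine (h1.div h2 hp).congr_deriv ?_
  rw [Complex.GammaSeq]
  field_simp

/-- The harmonic-type sums `∑ 1 / (s + k)` are asymptotic to `log n - ψ(s)`. -/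
lemma tendsto_hsum_sub_log {s : ℂ} (hs : 0 < s.re) :
    Tendsto (fun n : ℕ => hsum s n - Real.log n) atTop (𝓝 (-Complex.digamma s)) := by
  have hG : Complex.Gamma s ≠ 0 := Complex.Gamma_ne_zero_of_re_pos hs
  set U : Set ℂ := {z | 0 < z.re} with hU
  have hUo : IsOpen U := isOpen_lt continuous_const Complex.continuous_re
  set R := s.re / 2 with hR
  have hRp : 0 < R := by positivity
  have hsub : Metric.closedBall s R ⊆ U := by
    intro z hz
    have h1 := Complex.abs_re_le_norm (z - s)
    rw [Metric.mem_closedBall, dist_eq_norm] at hz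
    have := (abs_le.mp (h1.trans hz)).1
    simp only [Complex.sub_re] at this
    show 0 < z.re
    linarith
  have hsph : ∀ θ : ℝ, circleMap s R θ ∈ Metric.closedBall s R := fun θ =>
    Metric.sphere_subset_closedBall (circleMap_mem_sphere s hRp.le θ)
  have hdF : ∀ n : ℕ, n ≠ 0 → DifferentiableOn ℂ (fun z => Complex.GammaSeq z n) U :=
    fun n hn z hz => (hasDerivAt_GammaSeq hz hn).differentiableAt.differentiableWithinAt
  have hdG : DifferentiableOn ℂ Complex.Gamma U := fun z hz =>
    (Complex.differentiableAt_Gamma z fun m h => ne_neg_nat_of_re_pos hz m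
      (by rw [h]; ring)).differentiableWithinAt
  obtain ⟨B, hB⟩ : ∃ B, ∀ z ∈ Metric.closedBall s R, Real.Gamma z.re ≤ B := by
    have hc : ContinuousOn (fun z : ℂ => Real.Gamma z.re) (Metric.closedBall s R) := by
      intro z hz
      have : 0 < z.re := hsub hz
      have h1 : ContinuousAt Real.Gamma z.re :=
        (Real.differentiableAt_Gamma fun m h => by
          have : (0 : ℝ) ≤ m := m.cast_nonneg
          linarith).continuousAt
      exact (ContinuousAt.comp h1 Complex.continuous_re.continuousAt).continuousWithinAt
    obtain ⟨B, hB⟩ := (isCompact_closedBall s R).bddAbove_image hc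
    exact ⟨B, fun z hz => hB ⟨z, hz, rfl⟩⟩
  -- The logarithmic derivative of `GammaSeq` is `log n` minus a harmonic-type sum. Pointwise
  -- convergence of `GammaSeq` passes to derivatives by Cauchy's formula on a circle in the right
  -- half plane and dominated convergence.
  have key : Tendsto (fun n : ℕ => deriv (fun z => Complex.GammaSeq z n) s) atTop
      (𝓝 (deriv Complex.Gamma s)) := by
    have hrep : ∀ f : ℂ → ℂ, DifferentiableOn ℂ f U →
        deriv f s = (2 * (Real.pi : ℂ) * Complex.I)⁻¹ •
          ∮ z in C(s, R), ((z - s) ^ 2)⁻¹ • f z := fun f hf =>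
      (Complex.two_pi_I_inv_smul_circleIntegral_sub_sq_inv_smul_of_differentiable hUo hsub hf
        (Metric.mem_ball_self hRp)).symm
    rw [hrep _ hdG]
    have hev : ∀ᶠ n : ℕ in atTop, (2 * (Real.pi : ℂ) * Complex.I)⁻¹ •
        (∮ z in C(s, R), ((z - s) ^ 2)⁻¹ • Complex.GammaSeq z n)
          = deriv (fun z => Complex.GammaSeq z n) s := by
      filter_upwards [eventually_ne_atTop 0] with n hn
      rw [hrep _ (hdF n hn)]
    refine Tendsto.congr' hev (Tendsto.const_smul ?_ _)
    refine intervalIntegral.tendsto_integral_filter_of_dominated_convergence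
      (fun _ => R * ((R ^ 2)⁻¹ * B)) ?_ ?_ intervalIntegrable_const ?_
    · filter_upwards [eventually_ne_atTop 0] with n hn
      refine Continuous.aestronglyMeasurable ?_
      have hc : Continuous fun θ : ℝ => Complex.GammaSeq (circleMap s R θ) n :=
        (hdF n hn).continuousOn.comp_continuous (continuous_circleMap s R) fun θ => hsub (hsph θ)
      simp only [deriv_circleMap, circleMap_sub_center]
      have h0 : Continuous (circleMap 0 R) := continuous_circleMap 0 R
      refine Continuous.smul (h0.mul continuous_const)
        (Continuous.smul (Continuous.inv₀ (h0.pow 2) ?_) hc)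
      intro θ
      simp [circleMap, hRp.ne']
    · filter_upwards [eventually_gt_atTop 0] with n hn
      refine Eventually.of_forall fun θ _ => ?_
      rw [norm_smul, norm_smul, deriv_circleMap, norm_mul, Complex.norm_I, mul_one,
        norm_circleMap_zero, circleMap_sub_center, norm_inv, norm_pow, norm_circleMap_zero,
        abs_of_pos hRp]
      have := (norm_GammaSeq_le (hsub (hsph θ)) hn).trans (hB _ (hsph θ))
      gcongr
    · refine Eventually.of_forall fun θ _ => ?_
      exact ((Complex.GammaSeq_tendsto_Gamma _).const_smul _).const_smul _
  have h1 : Tendsto (fun n : ℕ => Complex.log n - hsum s (n + 1)) atTop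
      (𝓝 (Complex.digamma s)) := by
    have h2 := key.div (Complex.GammaSeq_tendsto_Gamma s) hG
    rw [Complex.digamma_def, logDeriv_apply]
    refine h2.congr' ?_
    filter_upwards [eventually_ne_atTop 0,
      (Complex.GammaSeq_tendsto_Gamma s).eventually_ne hG] with n hn hne
    rw [Pi.div_apply, (hasDerivAt_GammaSeq hs hn).deriv, mul_div_cancel_left₀ _ hne]
  -- `GammaSeq` has `n + 1` factors, so the last summand has to be removed.
  have h3 : Tendsto (fun n : ℕ => 1 / (s + n)) atTop (𝓝 0) := by
    simp only [one_div]
    refine tendsto_inv₀_cobounded.comp ?_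
    rw [← tendsto_norm_atTop_iff_cobounded]
    refine tendsto_atTop_mono (fun n => Complex.re_le_norm _) ?_
    simp only [Complex.add_re, Complex.natCast_re]
    exact tendsto_atTop_add_const_left _ _ tendsto_natCast_atTop_atTop
  have h4 := (h1.add h3).neg
  rw [add_zero] at h4
  refine h4.congr fun n => ?_
  rw [hsum_succ, ← Complex.natCast_log]; ring

end Digamma

/-! ### First order recurrences: growth bounds and expansions -/

section FirstOrder

variable {lam : ℂ} {σ : ℝ} {f g : ℕ → ℂ}

lemma exists_between_max {x σ : ℝ} (hσ : 0 < σ) (h : x < σ) : ∃ ρ, 0 < ρ ∧ x < ρ ∧ ρ < σ := by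
  obtain ⟨ρ, h1, h2⟩ := exists_between (max_lt hσ h)
  exact ⟨ρ, (le_max_left _ _).trans_lt h1, (le_max_right _ _).trans_lt h1, h2⟩

lemma first_order_isBigO (hσ : 0 < σ) (h : lam.re < σ)
    (hg : (theta f - lam • f) =O[atTop] (ecoef σ)) : f =O[atTop] (ecoef σ) := by
  obtain ⟨ρ, h1, h2, h3⟩ := exists_between_max hσ h
  obtain ⟨ε, hε⟩ := hg.bound
  obtain ⟨C, hC, hf⟩ := first_order_bound (σ := σ) (ε := ε) h1 h2 h3 rfl
    (hε.mono fun n hn => by rwa [Real.norm_of_nonneg (ecoef_pos hσ n).le] at hn)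
  refine IsBigO.of_bound (ε / (σ - ρ) + C) (hf.mono fun n hn => hn.trans ?_)
  rw [Real.norm_of_nonneg (ecoef_pos hσ n).le, add_mul]
  gcongr
  exact ecoef_le_of_le h1 h3.le n

/-- With `ρ` fixed strictly between `lam.re` and `σ`, the toll contributes an arbitrarily small
multiple of `ecoef σ`, and the initial value only a multiple of `ecoef ρ`. -/
lemma first_order_isLittleO (hσ : 0 < σ) (h : lam.re < σ)
    (hg : (theta f - lam • f) =o[atTop] (ecoef σ)) : f =o[atTop] (ecoef σ) := by
  obtain ⟨ρ, h1, h2, h3⟩ := exists_between_max hσ h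
  refine IsLittleO.of_bound fun c hc => ?_
  have hd : 0 < σ - ρ := by linarith
  obtain ⟨C, hC, hf⟩ := first_order_bound (σ := σ) (ε := c / 2 * (σ - ρ)) h1 h2 h3 (f := f) rfl
    ((hg.bound (c := c / 2 * (σ - ρ)) (by positivity)).mono fun n hn => by
      rwa [Real.norm_of_nonneg (ecoef_pos hσ n).le] at hn)
  have h4 := (ecoef_isLittleO h1 h3).bound (show 0 < c / (2 * (C + 1)) by positivity)
  filter_upwards [hf, h4] with n hn h4
  rw [Real.norm_of_nonneg (ecoef_pos h1 n).le, Real.norm_of_nonneg (ecoef_pos hσ n).le] at h4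
  rw [Real.norm_of_nonneg (ecoef_pos hσ n).le]
  rw [mul_div_cancel_right₀ _ hd.ne'] at hn
  have h5 : C * ecoef ρ n ≤ c / 2 * ecoef σ n := by
    calc C * ecoef ρ n ≤ (C + 1) * ecoef ρ n := by
          have := (ecoef_pos h1 n).le
          nlinarith
      _ ≤ (C + 1) * (c / (2 * (C + 1)) * ecoef σ n) := by gcongr
      _ = c / 2 * ecoef σ n := by field_simp
  linarith

/-- Variation of constants: the increments of `u = f / ecoef lam` are at most `D` times the
decrements of `r = ecoef σ / ‖ecoef lam‖`. These telescope and `r` tends to zero, so `u` converges;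
its limit is the coefficient, and the tail bound `D * r` is the error. -/
lemma first_order_expansion (hσ : 0 < σ) (h : σ < lam.re)
    (hg : (theta f - lam • f) =O[atTop] (ecoef σ)) :
    ∃ c : ℂ, (f - c • ecoef lam) =O[atTop] (ecoef σ) := by
  have hk := ne_neg_nat_of_re_pos (hσ.trans h)
  have hen : ∀ n, ecoef lam n ≠ 0 := fun n =>
    prod_ne_zero_iff.mpr fun k _ => div_ne_zero (hk k) (Nat.cast_add_one_ne_zero k)
  set g := theta f - lam • f with hgdef
  obtain ⟨B, hB0, hB⟩ := hg.exists_pos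
  obtain ⟨N, hN⟩ := eventually_atTop.mp hB.bound
  set u : ℕ → ℂ := fun n => f n / ecoef lam n with hu
  set r : ℕ → ℝ := fun n => ecoef σ n / ‖ecoef lam n‖ with hr
  have hr0 : ∀ n, 0 ≤ r n := fun n => div_nonneg (ecoef_pos hσ n).le (norm_nonneg _)
  set D := B / (lam.re - σ) with hD
  have hd : 0 < lam.re - σ := by linarith
  have hD0 : 0 ≤ D := by positivity
  have hstep : ∀ n, N ≤ n → ‖u (n + 1) - u n‖ ≤ D * (r n - r (n + 1)) := by
    intro n hn
    have hp : (0 : ℝ) < n + 1 := by positivity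
    have hpc : (n : ℂ) + 1 ≠ 0 := Nat.cast_add_one_ne_zero n
    have hnl : (n : ℂ) + lam ≠ 0 := by rw [add_comm]; exact hk n
    have e1 : ecoef lam (n + 1) = (n + lam) * ecoef lam n / (n + 1) := by
      rw [← succ_mul_ecoef_succ]; field_simp
    have e2 : ecoef σ (n + 1) = (n + σ) * ecoef σ n / (n + 1) := by
      rw [← succ_mul_ecoef_succ]; field_simp
    have hf : f (n + 1) = ((n + lam) * f n + g n) / (n + 1) := by
      rw [hgdef]
      simp only [Pi.sub_apply, theta_apply, Pi.smul_apply, smul_eq_mul]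
      field_simp; ring
    have hne := hen n
    have h1 : u (n + 1) - u n = g n / ((n + lam) * ecoef lam n) := by
      simp only [hu]
      rw [hf, e1]; field_simp; ring
    have hnorm : 0 < ‖(n : ℂ) + lam‖ := norm_pos_iff.mpr hnl
    have hnorm2 : 0 < ‖ecoef lam n‖ := norm_pos_iff.mpr hne
    have hcast : ‖(n : ℂ) + 1‖ = n + 1 := by
      rw [show (n : ℂ) + 1 = ((n + 1 : ℕ) : ℂ) by push_cast; rfl, Complex.norm_natCast]
      push_cast; rfl
    have h2 : r n - r (n + 1) = r n * ((‖(n : ℂ) + lam‖ - (n + σ)) / ‖(n : ℂ) + lam‖) := by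
      simp only [hr]
      rw [e1, e2, norm_div, norm_mul, hcast]; field_simp
    have h3 : lam.re - σ ≤ ‖(n : ℂ) + lam‖ - (n + σ) := by
      have := Complex.re_le_norm ((n : ℂ) + lam)
      simp at this
      linarith
    rw [h1, h2, norm_div, norm_mul]
    have h4 := hN n hn
    rw [Real.norm_of_nonneg (ecoef_pos hσ n).le] at h4
    calc ‖g n‖ / (‖(n : ℂ) + lam‖ * ‖ecoef lam n‖)
        ≤ B * ecoef σ n / (‖(n : ℂ) + lam‖ * ‖ecoef lam n‖) := by gcongr
      _ = D * (r n * ((lam.re - σ) / ‖(n : ℂ) + lam‖)) := by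
          simp only [hD, hr]; field_simp
      _ ≤ _ := by
          have := hr0 n
          gcongr
  have htele : ∀ n k, N ≤ n → ‖u (n + k) - u n‖ ≤ D * (r n - r (n + k)) := by
    intro n k hn
    induction k with
    | zero => simp
    | succ k ih =>
      have := hstep (n + k) (by omega)
      calc ‖u (n + (k + 1)) - u n‖ = ‖(u (n + k + 1) - u (n + k)) + (u (n + k) - u n)‖ := by
            rw [← add_assoc]; congr 1; ring
        _ ≤ _ := (norm_add_le _ _).trans (add_le_add this ih)
        _ = _ := by rw [← add_assoc]; ring
  have hrlim : Tendsto r atTop (𝓝 0) := by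
    have h1 : (ecoef σ) =o[atTop] (ecoef lam) :=
      (ecoef_isLittleO hσ h).trans_isTheta (norm_ecoef_isTheta (hσ.trans h)).symm
    exact h1.norm_right.tendsto_div_nhds_zero
  have hcauchy : CauchySeq u := by
    refine Metric.cauchySeq_iff'.mpr fun ε hε => ?_
    have h1 : ∀ᶠ n in atTop, D * r n < ε := by
      have := hrlim.const_mul D
      rw [mul_zero] at this
      exact this.eventually_lt_const hε
    obtain ⟨M, hM, hMN⟩ := (h1.and (eventually_ge_atTop N)).exists
    refine ⟨M, fun n hn => ?_⟩
    obtain ⟨k, rfl⟩ := Nat.exists_eq_add_of_le hn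
    rw [dist_eq_norm]
    have := htele M k hMN
    have h2 := mul_nonneg hD0 (hr0 (M + k))
    linarith
  obtain ⟨c, hc⟩ := cauchySeq_tendsto_of_complete hcauchy
  refine ⟨c, IsBigO.of_bound D ?_⟩
  filter_upwards [eventually_ge_atTop N] with n hn
  have h1 : ‖c - u n‖ ≤ D * r n := by
    refine le_of_tendsto ((hc.sub_const (u n)).norm) ?_
    filter_upwards [eventually_ge_atTop n] with k hk
    obtain ⟨j, rfl⟩ := Nat.exists_eq_add_of_le hk
    have h2 := mul_nonneg hD0 (hr0 (n + j))
    linarith [htele n j hn]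
  have h2 : (f - c • ecoef lam) n = -((c - u n) * ecoef lam n) := by
    simp only [hu, Pi.sub_apply, Pi.smul_apply, smul_eq_mul]
    have := hen n
    field_simp; ring
  have hnorm2 : 0 < ‖ecoef lam n‖ := norm_pos_iff.mpr (hen n)
  rw [h2, norm_neg, norm_mul, Real.norm_of_nonneg (ecoef_pos hσ n).le]
  calc ‖c - u n‖ * ‖ecoef lam n‖ ≤ D * r n * ‖ecoef lam n‖ := by gcongr
    _ = D * ecoef σ n := by simp only [hr]; field_simp

end FirstOrder

/-! ### Polynomials in `theta`: stability, annihilators, resonance -/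

section PolynomialOperators

open Polynomial

lemma aeval_X_sub_C_mul (w : ℂ) (Q : ℂ[X]) (f : ℕ → ℂ) :
    aeval theta ((X - C w) * Q) f = theta (aeval theta Q f) - w • aeval theta Q f := by
  simp [Module.algebraMap_end_apply]

lemma aeval_mul_X_sub_C (w : ℂ) (Q : ℂ[X]) (f : ℕ → ℂ) :
    aeval theta ((X - C w) * Q) f = aeval theta Q (theta f - w • f) := by
  rw [mul_comm]
  simp [Module.algebraMap_end_apply]

lemma aeval_theta_ecoef (P : ℂ[X]) (s : ℂ) : aeval theta P (ecoef s) = P.eval s • ecoef s := by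
  induction P using Polynomial.induction_on' with
  | add p q hp hq => simp [hp, hq, add_smul]
  | monomial n a =>
    have : ∀ n : ℕ, (theta ^ n) (ecoef s) = s ^ n • ecoef s := by
      intro n
      induction n with
      | zero => simp
      | succ n ih =>
        rw [pow_succ', Module.End.mul_apply, ih, map_smul, theta_ecoef, smul_smul, ← pow_succ]
    simp [aeval_monomial, this, Module.algebraMap_end_apply, smul_smul, mul_comm]

/-- Linear factors are peeled off one at a time, so a growth condition that survives solving one
first order equation survives inverting a whole polynomial in `theta`. -/
lemma aeval_induction {σ : ℝ} {good : (ℕ → ℂ) → Prop}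
    (hconst : ∀ (c : ℂ) f, c ≠ 0 → good (c • f) → good f)
    (hstep : ∀ (w : ℂ) f, w.re < σ → good (theta f - w • f) → good f)
    (P : ℂ[X]) (hP : P ≠ 0) (hroot : ∀ w, P.IsRoot w → w.re < σ) (f : ℕ → ℂ)
    (h : good (aeval theta P f)) : good f := by
  induction hn : P.natDegree generalizing P f with
  | zero =>
    rw [eq_C_of_natDegree_eq_zero hn] at h hP
    refine hconst (P.coeff 0) f (by simpa using hP) ?_
    simpa [Module.algebraMap_end_apply] using h
  | succ n ih =>
    have hdeg : P.degree ≠ 0 := fun h0 => by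
      have := natDegree_eq_zero_iff_degree_le_zero.mpr h0.le
      omega
    obtain ⟨w, hw⟩ := IsAlgClosed.exists_root P hdeg
    obtain ⟨Q, rfl⟩ := dvd_iff_isRoot.mpr hw
    have hQ : Q ≠ 0 := right_ne_zero_of_mul hP
    rw [natDegree_mul (X_sub_C_ne_zero w) hQ, natDegree_X_sub_C] at hn
    rw [aeval_X_sub_C_mul] at h
    exact ih Q hQ (fun z hz => hroot z (hz.dvd (dvd_mul_left _ _))) f
      (hstep w _ (hroot w hw) h) (by omega)

variable {σ : ℝ} {P Q : ℂ[X]} {f g : ℕ → ℂ}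

lemma aeval_isBigO (hσ : 0 < σ) (hP : P ≠ 0) (hroot : ∀ w, P.IsRoot w → w.re < σ)
    (h : (aeval theta P f) =O[atTop] (ecoef σ)) : f =O[atTop] (ecoef σ) :=
  aeval_induction (good := fun f => f =O[atTop] (ecoef σ))
    (fun _ _ hc h => (isBigO_const_smul_left hc).mp h)
    (fun _ _ hw h => first_order_isBigO hσ hw h) P hP hroot f h

lemma aeval_isLittleO (hσ : 0 < σ) (hP : P ≠ 0) (hroot : ∀ w, P.IsRoot w → w.re < σ)
    (h : (aeval theta P f) =o[atTop] (ecoef σ)) : f =o[atTop] (ecoef σ) :=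
  aeval_induction (good := fun f => f =o[atTop] (ecoef σ))
    (fun _ _ hc h => (isLittleO_const_smul_left hc).mp h)
    (fun _ _ hw h => first_order_isLittleO hσ hw h) P hP hroot f h

/-- The factors commute: `Q` is inverted first, and a first order equation at `w` remains. -/
lemma aeval_expansion {w : ℂ} (hσ : 0 < σ) (hw : σ < w.re) (hQ : Q ≠ 0)
    (hroot : ∀ z, Q.IsRoot z → z.re < σ)
    (h : (aeval theta ((X - C w) * Q) f) =O[atTop] (ecoef σ)) :
    ∃ c : ℂ, (f - c • ecoef w) =O[atTop] (ecoef σ) := by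
  rw [aeval_mul_X_sub_C] at h
  exact first_order_expansion hσ hw (aeval_isBigO hσ hQ hroot h)

/-- A sequence killed by polynomials in `theta` without common zeros of real part at least `σ`. -/
lemma isBigO_of_annihilated (hσ : 0 < σ) (hP : P ≠ 0) (hPf : aeval theta P f = 0)
    (h : ∀ w, P.IsRoot w → σ ≤ w.re → ∃ R : ℂ[X], R.eval w ≠ 0 ∧ aeval theta R f = 0) :
    f =O[atTop] (ecoef σ) := by
  -- The annihilator of `f` is a principal ideal. A zero of its generator with real part at least
  -- `σ` would be a common zero of all annihilating polynomials, which `h` excludes.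
  let I : Ideal ℂ[X] :=
    { carrier := {R | aeval theta R f = 0}
      add_mem' := fun {a b} ha hb => by
        have ha' : aeval theta a f = 0 := ha
        have hb' : aeval theta b f = 0 := hb
        simp [ha', hb']
      zero_mem' := by simp
      smul_mem' := fun c {a} ha => by
        have ha' : aeval theta a f = 0 := ha
        simp [ha'] }
  obtain ⟨G, hG⟩ := (IsPrincipalIdealRing.principal I).principal
  have hmem : ∀ R : ℂ[X], aeval theta R f = 0 ↔ G ∣ R := fun R => by
    rw [← Ideal.mem_span_singleton, Ideal.span, ← hG]; rfl
  have hGP : G ∣ P := (hmem P).mp hPf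
  have hG0 : G ≠ 0 := ne_zero_of_dvd_ne_zero hP hGP
  refine aeval_isBigO hσ hG0 (fun w hw => ?_)
    (by rw [(hmem G).mpr dvd_rfl]; exact isBigO_zero _ _)
  by_contra hcon
  obtain ⟨R, hR, hRf⟩ := h w (hw.dvd hGP) (not_lt.mp hcon)
  exact hR (hw.dvd ((hmem R).mp hRf))

lemma sum_inv_succ_isBigO_log :
    (fun n : ℕ => ∑ k ∈ range n, 1 / ((k : ℝ) + 1)) =O[atTop] (fun n : ℕ => Real.log n) := by
  have h1 : Tendsto (fun n : ℕ => Real.log n) atTop atTop :=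
    Real.tendsto_log_atTop.comp tendsto_natCast_atTop_atTop
  have h2 : (fun n : ℕ => (∑ k ∈ range n, 1 / ((k : ℝ) + 1)) - Real.log n) =O[atTop]
      (fun _ : ℕ => (1 : ℝ)) := by
    refine Tendsto.isBigO_one ℝ (c := Real.eulerMascheroniConstant)
      (Real.tendsto_harmonic_sub_log.congr fun n => ?_)
    simp [harmonic]
  have h3 : (fun _ : ℕ => (1 : ℝ)) =O[atTop] (fun n : ℕ => Real.log n) :=
    (isLittleO_const_left.mpr (Or.inr (tendsto_norm_atTop_atTop.comp h1))).isBigO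
  simpa using (h2.trans h3).add (isBigO_refl (fun n : ℕ => Real.log n) atTop)

/-- The equation is solved explicitly by `f n = (n + 1) (f 0 + ∑ g k / ((k + 1) (k + 2)))`. As `g k
= o(k)`, the summands are `o(1 / k)` and the sum is `o(log n)`. -/
lemma first_order_resonance (hg : (theta f - (2 : ℂ) • f) =o[atTop] (ecoef (2 : ℝ))) :
    f =o[atTop] (fun n : ℕ => (n : ℝ) * Real.log n) := by
  set g := theta f - (2 : ℂ) • f with hgdef
  have hlog : Tendsto (fun n : ℕ => Real.log n) atTop atTop :=
    Real.tendsto_log_atTop.comp tendsto_natCast_atTop_atTop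
  have h1 : (fun n : ℕ => g n / (((n : ℂ) + 1) * (n + 2))) =o[atTop]
      (fun n : ℕ => 1 / ((n : ℝ) + 1)) := by
    have h2 : (fun n : ℕ => 1 / (((n : ℂ) + 1) * (n + 2))) =O[atTop]
        (fun n : ℕ => 1 / (((n : ℝ) + 1) * (n + 1))) := by
      refine IsBigO.of_bound 1 (Eventually.of_forall fun n => ?_)
      have e : (1 : ℂ) / (((n : ℂ) + 1) * (n + 2))
          = ((1 / (((n : ℝ) + 1) * (n + 2)) : ℝ) : ℂ) := by push_cast; rfl
      rw [e, Complex.norm_real, one_mul, Real.norm_of_nonneg (by positivity),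
        Real.norm_of_nonneg (by positivity)]
      gcongr; norm_num
    refine ((hg.mul_isBigO h2).congr (fun n => ?_) fun n => ?_)
    · rw [mul_one_div]
    · rw [ecoef_two]; field_simp
  have h3 := h1.sum_range (fun n => by positivity) (by
    refine tendsto_atTop_mono (f := fun n : ℕ => Real.log (n + 1 : ℕ)) (fun n => ?_)
      (hlog.comp (tendsto_add_atTop_nat 1))
    have := log_add_one_le_harmonic n
    simpa [harmonic] using this)
  have h4 := h3.trans_isBigO sum_inv_succ_isBigO_log
  have h5 : ∀ n : ℕ, f n = (n + 1) * (f 0 + ∑ k ∈ range n, g k / (((k : ℂ) + 1) * (k + 2))) := by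
    intro n
    induction n with
    | zero => simp
    | succ n ih =>
      have hn : (n : ℂ) + 1 ≠ 0 := Nat.cast_add_one_ne_zero n
      have hn2 : (n : ℂ) + 2 ≠ 0 := by
        have := Nat.cast_add_one_ne_zero (R := ℂ) (n + 1)
        push_cast at this
        rwa [add_assoc, one_add_one_eq_two] at this
      have hf : f (n + 1) = ((n + 2) * f n + g n) / (n + 1) := by
        rw [hgdef]
        simp only [Pi.sub_apply, theta_apply, Pi.smul_apply, smul_eq_mul]
        field_simp; ring
      rw [hf, ih, sum_range_succ]; push_cast; field_simp; ring
  have h6 : (fun n : ℕ => f 0 + ∑ k ∈ range n, g k / (((k : ℂ) + 1) * (k + 2))) =o[atTop]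
      (fun n : ℕ => Real.log n) :=
    (isLittleO_const_left.mpr (Or.inr (tendsto_norm_atTop_atTop.comp hlog))).add h4
  have h7 : (fun n : ℕ => (n : ℂ) + 1) =O[atTop] (fun n : ℕ => (n : ℝ)) := by
    refine IsBigO.of_bound 2 ?_
    filter_upwards [eventually_ge_atTop 1] with n hn
    have : (1 : ℝ) ≤ n := by exact_mod_cast hn
    rw [show (n : ℂ) + 1 = ((n + 1 : ℕ) : ℂ) by push_cast; rfl, Complex.norm_natCast,
      Real.norm_of_nonneg (by positivity)]
    push_cast; linarith
  exact (h7.mul_isLittleO h6).congr_left fun n => (h5 n).symm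

/-- The generalised eigenvector `lcoef 2` absorbs the resonant part of the toll. The denominator
appears because `Q` in `theta` acts on `ecoef 2` as the scalar `Q.eval 2`. -/
lemma aeval_resonance {K : ℂ} (hroot : ∀ z, Q.IsRoot z → z.re < 2)
    (h : (aeval theta ((X - C 2) * Q) f - K • ecoef 2) =o[atTop] (ecoef (2 : ℝ))) :
    (f - (K / Q.eval 2) • lcoef 2) =o[atTop] (fun n : ℕ => (n : ℝ) * Real.log n) := by
  have hQ2 : Q.eval 2 ≠ 0 := fun h0 => by simpa using hroot 2 h0
  have hQ : Q ≠ 0 := by rintro rfl; simp at hQ2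
  refine first_order_resonance ?_
  refine aeval_isLittleO two_pos hQ hroot ?_
  have h2 : ∀ k : ℕ, (2 : ℂ) + k ≠ 0 := ne_neg_nat_of_re_pos (by simp)
  refine h.congr_left fun n => congrFun ?_ n
  rw [map_sub theta, map_smul theta, theta_lcoef h2]
  have e : theta f - (K / Q.eval 2) • ((2 : ℂ) • lcoef 2 + ecoef 2)
      - (2 : ℂ) • (f - (K / Q.eval 2) • lcoef 2)
      = (theta f - (2 : ℂ) • f) - (K / Q.eval 2) • ecoef 2 := by
    simp only [smul_sub, smul_add, smul_comm (2 : ℂ)]; abel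
  rw [e, aeval_mul_X_sub_C, map_sub _ (theta f - _), map_smul _ _ (ecoef 2), aeval_theta_ecoef,
    smul_smul, div_mul_cancel₀ _ hQ2]

end PolynomialOperators

/-! ### Averages over compositions via products of power series -/

section Compositions

variable {K : Type*} [Field K]

/-- The average of `F` over the compositions of `n - (m - 1)` into `m` nonnegative parts. -/
noncomputable def expI (m n : ℕ) (F : (Fin m → ℕ) → K) : K :=
  (∑ I ∈ piAntidiag univ (n + 1 - m), F I) / (n.choose (m - 1) : K)

variable {m n : ℕ} {F G : (Fin m → ℕ) → K}

lemma expI_add : expI m n (fun I => F I + G I) = expI m n F + expI m n G := by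
  simp [expI, sum_add_distrib, add_div]

lemma expI_sub : expI m n (fun I => F I - G I) = expI m n F - expI m n G := by
  simp [expI, sum_sub_distrib, sub_div]

lemma expI_const_mul (c : K) : expI m n (fun I => c * F I) = c * expI m n F := by
  simp [expI, ← mul_sum, mul_div_assoc]

lemma expI_mul_const (c : K) : expI m n (fun I => F I * c) = expI m n F * c := by
  simp only [mul_comm _ c, expI_const_mul]

/-- The binomial denominator is zero here and division by zero gives zero. This convention lets the
recurrences hold for every `n`. -/
lemma expI_of_lt (h : n < m - 1) : expI m n F = 0 := by
  simp [expI, Nat.choose_eq_zero_of_lt h]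

lemma expI_congr (h : ∀ I : Fin m → ℕ, ∑ i, I i = n + 1 - m → F I = G I) :
    expI m n F = expI m n G := by
  rw [expI, expI, sum_congr rfl fun I hI => h I (by simpa using hI)]

lemma expI_ofReal (F : (Fin m → ℕ) → ℝ) :
    ((expI m n F : ℝ) : ℂ) = expI m n (fun I => (F I : ℂ)) := by
  simp [expI]

lemma expI_mono {F G : (Fin m → ℕ) → ℝ} (h : ∀ I : Fin m → ℕ, ∑ i, I i = n + 1 - m → F I ≤ G I) :
    expI m n F ≤ expI m n G := by
  refine div_le_div_of_nonneg_right (sum_le_sum fun I hI => h I (by simpa using hI)) (by positivity)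

lemma norm_expI_le (F : (Fin m → ℕ) → ℂ) : ‖expI m n F‖ ≤ expI m n (fun I => ‖F I‖) := by
  rw [expI, expI, norm_div, Complex.norm_natCast]
  gcongr
  exact norm_sum_le _ _

lemma sum_piAntidiag_prod (k : ℕ) (f : Fin m → ℕ → K) :
    ∑ I ∈ piAntidiag univ k, ∏ i, f i (I i)
      = PowerSeries.coeff k (∏ i, PowerSeries.mk (f i)) := by
  rw [PowerSeries.coeff_prod]
  simp only [PowerSeries.coeff_mk]
  symm
  refine sum_nbij' (fun l => ⇑l) (fun I => Finsupp.equivFunOnFinite.symm I) ?_ ?_ ?_ ?_ ?_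
  · intro l hl; simpa using hl
  · intro I hI; simpa using hI
  · intro l _; ext; simp
  · intro I _; ext; simp
  · intro l _; rfl

lemma mk_ecoef_one [CharZero K] : PowerSeries.mk (ecoef (1 : K)) = PowerSeries.mk 1 := by
  ext n; simp [ecoef_one]

/-- The parts that do not enter carry the constant sequence `1`, written as `ecoef 1` so that
together they form a power of `1 / (1 - z)`. -/
lemma sum_piAntidiag_single [CharZero K] (k : ℕ) (f : ℕ → K) (i : Fin m) :
    ∑ I ∈ piAntidiag univ k, f (I i)
      = PowerSeries.coeff k (PowerSeries.mk f * PowerSeries.mk (ecoef (1 : K)) ^ (m - 1)) := by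
  have h := sum_piAntidiag_prod k (fun j : Fin m => if j = i then f else ecoef (1 : K))
  have e : ∀ I : Fin m → ℕ, ∏ j, (if j = i then f else ecoef (1 : K)) (I j) = f (I i) := by
    intro I
    rw [prod_eq_single i (fun j _ hj => by simp [hj, ecoef_one]) (by simp)]
    simp
  simp only [e] at h
  rw [h]
  congr 1
  rw [← mul_prod_erase _ _ (mem_univ i), if_pos rfl]
  congr 1
  rw [prod_congr rfl fun j hj => by rw [if_neg (ne_of_mem_erase hj)], prod_const,
    card_erase_of_mem (mem_univ i), card_univ, Fintype.card_fin]

lemma sum_piAntidiag_pair [CharZero K] (k : ℕ) (f g : ℕ → K) {i j : Fin m} (hij : i ≠ j) :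
    ∑ I ∈ piAntidiag univ k, f (I i) * g (I j)
      = PowerSeries.coeff k (PowerSeries.mk f * PowerSeries.mk g *
          PowerSeries.mk (ecoef (1 : K)) ^ (m - 2)) := by
  have h := sum_piAntidiag_prod k
    (fun r : Fin m => if r = i then f else if r = j then g else ecoef (1 : K))
  have hj : j ∈ univ.erase i := mem_erase.mpr ⟨hij.symm, mem_univ _⟩
  have e : ∀ I : Fin m → ℕ, ∏ r, (if r = i then f else if r = j then g else ecoef (1 : K)) (I r)
      = f (I i) * g (I j) := by
    intro I
    rw [← mul_prod_erase _ _ (mem_univ i), ← mul_prod_erase _ _ hj, if_pos rfl,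
      if_neg hij.symm, if_pos rfl, prod_eq_one, mul_one]
    intro r hr
    rw [mem_erase, mem_erase] at hr
    rw [if_neg hr.2.1, if_neg hr.1, ecoef_one]
  simp only [e] at h
  rw [h]
  congr 1
  rw [← mul_prod_erase _ _ (mem_univ i), ← mul_prod_erase _ _ hj, if_pos rfl,
      if_neg hij.symm, if_pos rfl, mul_assoc]
  congr 2
  have h2 : ∀ r ∈ (univ.erase i).erase j,
      PowerSeries.mk (if r = i then f else if r = j then g else ecoef (1 : K))
        = PowerSeries.mk (ecoef (1 : K)) := fun r hr => by
    rw [mem_erase, mem_erase] at hr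
    rw [if_neg hr.2.1, if_neg hr.1]
  rw [prod_congr rfl h2, prod_const, card_erase_of_mem hj, card_erase_of_mem (mem_univ i),
    card_univ, Fintype.card_fin]
  rfl

/-- The splitting of `ecoef s (k + j)` at index `j`. -/
lemma ecoef_add [CharZero K] (s : K) (k j : ℕ) :
    ecoef s (k + j) * ((k + j).choose j : K) = ecoef s j * ecoef (s + j) k := by
  induction k with
  | zero => simp
  | succ k ih =>
    have h1 : ((k : K) + 1) ≠ 0 := Nat.cast_add_one_ne_zero k
    have h2 : ((k : K) + j + 1) ≠ 0 := by exact_mod_cast Nat.cast_add_one_ne_zero (R := K) (k + j)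
    have h3 : ((k + 1 + j).choose j : K) * (k + 1) = (k + j).choose j * (k + j + 1) := by
      have := Nat.choose_mul_succ_eq (k + j) j
      have e : k + j + 1 - j = k + 1 := by omega
      rw [e] at this
      rw [show k + 1 + j = k + j + 1 by ring]
      exact_mod_cast this.symm
    refine mul_right_cancel₀ h1 ?_
    rw [mul_assoc, h3, show k + 1 + j = k + j + 1 by ring, ecoef_succ, ecoef_succ]
    push_cast
    field_simp
    linear_combination (s + (k + j)) * ih

lemma card_compositions [CharZero K] (hm : 1 ≤ m) (hn : m - 1 ≤ n) :
    expI m n (fun _ => (1 : K)) = 1 := by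
  have h : ((piAntidiag (univ : Finset (Fin m)) (n + 1 - m)).card : K) = n.choose (m - 1) := by
    obtain ⟨k, rfl⟩ : ∃ k, n = k + (m - 1) := ⟨n - (m - 1), by omega⟩
    have e : k + (m - 1) + 1 - m = k := by omega
    rw [e]
    have h1 := sum_piAntidiag_prod (K := K) k (fun _ : Fin m => ecoef (1 : K))
    simp only [ecoef_one, prod_const_one, sum_const, nsmul_eq_mul, mul_one, prod_const,
      card_univ, Fintype.card_fin] at h1
    have h2 : ∀ j : ℕ, PowerSeries.coeff k (PowerSeries.mk (ecoef (1 : K)) ^ (j + 1))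
        = (k + j).choose j := by
      intro j
      rw [mk_ecoef_one, PowerSeries.mk_one_pow_eq_mk_choose_add]
      simp [add_comm]
    have h3 := h2 (m - 1)
    rw [show m - 1 + 1 = m by omega] at h3
    rw [← h3, h1]
  have h0 : (n.choose (m - 1) : K) ≠ 0 := by
    exact_mod_cast (Nat.choose_pos hn).ne'
  rw [expI, sum_const, nsmul_eq_mul, mul_one, h, div_self h0]

end Compositions

/-! ### Product formulas for `ecoef`, `lcoef` and `qcoef` -/

section Products

open PowerSeries

lemma mk_theta (a : ℕ → ℂ) : PowerSeries.mk (theta a) = (1 - X) * d⁄dX ℂ (PowerSeries.mk a) := by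
  ext n
  rw [sub_mul, one_mul, map_sub, coeff_derivative, coeff_mk, theta_apply, coeff_mk]
  cases n with
  | zero => simp [mul_comm]
  | succ n => rw [coeff_succ_X_mul, coeff_derivative, coeff_mk]; push_cast; ring

/-- The operator `(1 - z) d/dz` is a derivation, so the product satisfies a first order equation. A
candidate with the same equation and the same constant term equals it by `theta_ext`. -/
lemma mk_mul_mk_eq_of_theta {a b c : ℕ → ℂ} {s : ℂ} {g : ℕ → ℂ}
    (hc : theta c = s • c + g) (h0 : c 0 = a 0 * b 0)
    (h : PowerSeries.mk (theta a) * PowerSeries.mk b + PowerSeries.mk a * PowerSeries.mk (theta b)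
      = s • (PowerSeries.mk a * PowerSeries.mk b) + PowerSeries.mk g) :
    PowerSeries.mk a * PowerSeries.mk b = PowerSeries.mk c := by
  set p : ℕ → ℂ := fun n => coeff n (PowerSeries.mk a * PowerSeries.mk b) with hp
  have hpm : PowerSeries.mk p = PowerSeries.mk a * PowerSeries.mk b := by ext n; simp [hp]
  have h1 : theta p = s • p + g := by
    have h2 : PowerSeries.mk (theta p) = PowerSeries.mk (s • p + g) := by
      rw [mk_theta, hpm, Derivation.leibniz]
      rw [mk_theta, mk_theta] at h
      have h3 : PowerSeries.mk (s • p + g) = s • PowerSeries.mk p + PowerSeries.mk g := by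
        ext n; simp
      rw [h3, hpm, ← h]
      simp only [smul_eq_mul]; ring
    funext n
    simpa using congrArg (coeff n) h2
  have h2 : p = c := by
    refine theta_ext (s := s) ?_ (by rw [h1, hc]; simp)
    rw [h0]; simp [hp]
  rw [← hpm, h2]

lemma mk_add_smul (s : ℂ) (a g : ℕ → ℂ) :
    PowerSeries.mk (s • a + g) = s • PowerSeries.mk a + PowerSeries.mk g := by
  ext n; simp

lemma mk_smul (s : ℂ) (a : ℕ → ℂ) : PowerSeries.mk (s • a) = s • PowerSeries.mk a := by
  ext n; simp

lemma mk_ecoef_mul (s t : ℂ) :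
    PowerSeries.mk (ecoef s) * PowerSeries.mk (ecoef t) = PowerSeries.mk (ecoef (s + t)) := by
  refine mk_mul_mk_eq_of_theta (s := s + t) (g := 0) (by rw [theta_ecoef, add_zero]) (by simp) ?_
  rw [theta_ecoef, theta_ecoef, mk_smul, mk_smul, smul_mul_assoc, mul_smul_comm, ← add_smul]
  ext n; simp

lemma mk_ecoef_one_pow (j : ℕ) :
    PowerSeries.mk (ecoef (1 : ℂ)) ^ j = PowerSeries.mk (ecoef (j : ℂ)) := by
  induction j with
  | zero =>
    ext n
    cases n with
    | zero => simp
    | succ n => simp [ecoef, prod_range_succ', coeff_one]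
  | succ j ih => rw [pow_succ, ih, mk_ecoef_mul]; push_cast; rfl

lemma mk_lcoef_mul {s t : ℂ} (hs : ∀ k : ℕ, s + k ≠ 0) (hst : ∀ k : ℕ, s + t + k ≠ 0) :
    PowerSeries.mk (lcoef s) * PowerSeries.mk (ecoef t) = PowerSeries.mk (lcoef (s + t)) := by
  refine mk_mul_mk_eq_of_theta (theta_lcoef hst) (by simp) ?_
  rw [theta_lcoef hs, theta_ecoef, mk_smul, mk_add_smul, ← mk_ecoef_mul]
  simp only [add_mul, smul_mul_assoc, mul_smul_comm, add_smul]; abel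

lemma mk_lcoef_mul_lcoef {s t : ℂ} (hs : ∀ k : ℕ, s + k ≠ 0) (ht : ∀ k : ℕ, t + k ≠ 0)
    (hst : ∀ k : ℕ, s + t + k ≠ 0) :
    PowerSeries.mk (lcoef s) * PowerSeries.mk (lcoef t) = PowerSeries.mk (qcoef (s + t)) := by
  refine mk_mul_mk_eq_of_theta (theta_qcoef hst) (by simp) ?_
  have h1 := mk_lcoef_mul hs hst
  have h2 := mk_lcoef_mul ht (t := s) (by rwa [add_comm t])
  rw [theta_lcoef hs, theta_lcoef ht, mk_add_smul, mk_add_smul, mk_smul]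
  simp only [add_mul, mul_add, smul_mul_assoc, mul_smul_comm, add_smul]
  rw [h1, mul_comm (PowerSeries.mk (ecoef s)), h2, add_comm t, two_smul]; abel

lemma mk_qcoef_mul {s t : ℂ} (hs : ∀ k : ℕ, s + k ≠ 0) (hst : ∀ k : ℕ, s + t + k ≠ 0) :
    PowerSeries.mk (qcoef s) * PowerSeries.mk (ecoef t) = PowerSeries.mk (qcoef (s + t)) := by
  refine mk_mul_mk_eq_of_theta (theta_qcoef hst) (by simp) ?_
  rw [theta_qcoef hs, theta_ecoef, mk_smul, mk_add_smul, mk_smul, mk_smul, ← mk_lcoef_mul hs hst]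
  simp only [add_mul, smul_mul_assoc, mul_smul_comm, add_smul]; abel

end Products

/-! ### The splitting operator `opT` and its inversion by `theta` -/

section SplittingOperator

open PowerSeries

variable {m : ℕ}

/-- The expectation of the sum of `a` over the sizes of the subtrees. -/
noncomputable def opT (m : ℕ) : Module.End ℂ (ℕ → ℂ) where
  toFun a n := expI m n fun I => ∑ i, a (I i)
  map_add' a b := by ext n; simp [sum_add_distrib, expI_add]
  map_smul' c a := by ext n; simp [← mul_sum, expI_const_mul]

lemma opT_apply (a : ℕ → ℂ) (n : ℕ) : opT m a n = expI m n fun I => ∑ i, a (I i) := rfl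

lemma opT_of_lt (a : ℕ → ℂ) {n : ℕ} (h : n < m - 1) : opT m a n = 0 := expI_of_lt h

lemma opT_add_eq (hm : 1 ≤ m) (a : ℕ → ℂ) (k : ℕ) :
    opT m a (k + (m - 1)) = m *
      coeff k (PowerSeries.mk a * PowerSeries.mk (ecoef ((m - 1 : ℕ) : ℂ))) /
        ((k + (m - 1)).choose (m - 1) : ℂ) := by
  rw [opT_apply, expI, show k + (m - 1) + 1 - m = k by omega, sum_comm]
  congr 1
  rw [sum_congr rfl fun i _ => sum_piAntidiag_single k a i, mk_ecoef_one_pow]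
  simp

/-- Equal indices give `opT` of the product; each of the `m (m - 1)` ordered pairs of distinct
indices gives a convolution with `m - 2` free parts. -/
lemma expI_pair_eq (hm : 2 ≤ m) (a b : ℕ → ℂ) (k : ℕ) :
    expI m (k + (m - 1)) (fun I => (∑ i, a (I i)) * ∑ i, b (I i))
      = opT m (fun n => a n * b n) (k + (m - 1)) + m * (m - 1) *
        coeff k (PowerSeries.mk a * PowerSeries.mk b * PowerSeries.mk (ecoef ((m : ℂ) - 2))) /
        ((k + (m - 1)).choose (m - 1) : ℂ) := by
  have e : ∀ I : Fin m → ℕ, (∑ i, a (I i)) * ∑ i, b (I i)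
      = (∑ i, a (I i) * b (I i)) + ∑ i, ∑ j ∈ univ.erase i, a (I i) * b (I j) := by
    intro I
    rw [sum_mul, ← sum_add_distrib]
    refine sum_congr rfl fun i _ => ?_
    rw [mul_sum, ← add_sum_erase _ _ (mem_univ i)]
  simp only [e]
  rw [expI_add, opT_apply]
  congr 1
  rw [expI, show k + (m - 1) + 1 - m = k by omega]
  congr 1
  rw [sum_comm]
  have h1 : ∀ i : Fin m, ∑ I ∈ piAntidiag univ k, ∑ j ∈ univ.erase i, a (I i) * b (I j)
      = ((m : ℂ) - 1) *
        coeff k (PowerSeries.mk a * PowerSeries.mk b * PowerSeries.mk (ecoef ((m : ℂ) - 2))) := by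
    intro i
    rw [sum_comm, sum_congr rfl fun j hj => sum_piAntidiag_pair k a b (ne_of_mem_erase hj).symm,
      mk_ecoef_one_pow, sum_const, card_erase_of_mem (mem_univ i), card_univ, Fintype.card_fin,
      nsmul_eq_mul, Nat.cast_sub (by omega : 1 ≤ m), Nat.cast_sub hm]
    push_cast; rfl
  rw [sum_congr rfl fun i _ => h1 i]
  simp [mul_assoc]

lemma one_sub_X_pow_mul (j : ℕ) : (1 - X) ^ j * PowerSeries.mk (ecoef (j : ℂ)) = 1 := by
  rw [← mk_ecoef_one_pow, ← mul_pow, mk_ecoef_one, mul_comm, mk_one_mul_one_sub_eq_one, one_pow]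

/-- Differentiating `(1 - z) ^ j` produces `-j` times itself after multiplication by `1 - z`; adding
`j` to `theta` cancels this, so the order of the derivative rises by one. -/
lemma mk_aeval_ascPochhammer (j : ℕ) (u : ℕ → ℂ) :
    PowerSeries.mk (Polynomial.aeval theta (ascPochhammer ℂ j) u)
      = (1 - X) ^ j * (d⁄dX ℂ)^[j] (PowerSeries.mk u) := by
  induction j with
  | zero => simp
  | succ j ih =>
    rw [ascPochhammer_succ_right, mul_comm, map_mul, Module.End.mul_apply, map_add,
      Polynomial.aeval_X, LinearMap.add_apply, map_natCast, Module.End.natCast_apply]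
    set v := Polynomial.aeval theta (ascPochhammer ℂ j) u
    have h1 : PowerSeries.mk (theta v + j • v)
        = PowerSeries.mk (theta v) + (j : ℂ⟦X⟧) * PowerSeries.mk v := by
      rw [← map_natCast (C (R := ℂ)) j]
      ext n
      rw [map_add, coeff_C_mul]
      simp
    rw [h1, mk_theta, ih, Derivation.leibniz, Derivation.leibniz_pow, Function.iterate_succ_apply']
    simp only [map_sub, Derivation.map_one_eq_zero, derivative_X, smul_eq_mul, nsmul_eq_mul]
    cases j with
    | zero => simp
    | succ j => simp only [Nat.add_sub_cancel]; ring

/-- The rising factorial of `theta` inverts the splitting operator. -/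
lemma aeval_ascPochhammer_opT (hm : 1 ≤ m) (a : ℕ → ℂ) :
    Polynomial.aeval theta (ascPochhammer ℂ (m - 1)) (opT m a) = (m.factorial : ℂ) • a := by
  -- The factors produced by `m - 1` derivatives are `(m - 1)!` times the binomial coefficient in
  -- the denominator of `opT`.
  have h1 : (d⁄dX ℂ)^[m - 1] (PowerSeries.mk (opT m a))
      = (m.factorial : ℂ) •
        (PowerSeries.mk a * PowerSeries.mk (ecoef ((m - 1 : ℕ) : ℂ))) := by
    ext k
    rw [coeff_iterate_derivative, coeff_mk, opT_add_eq hm, map_smul, smul_eq_mul]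
    have h2 : ((k + (m - 1)).choose (m - 1) : ℂ) ≠ 0 := by
      exact_mod_cast (Nat.choose_pos (by omega)).ne'
    have h3 : m.factorial = m * (m - 1).factorial := by
      rw [← Nat.mul_factorial_pred (by omega)]
    rw [h3, Nat.ascFactorial_eq_factorial_mul_choose]
    push_cast
    field_simp
  have h2 := mk_aeval_ascPochhammer (m - 1) (opT m a)
  rw [h1, mul_smul_comm, mul_comm (PowerSeries.mk a), ← mul_assoc, one_sub_X_pow_mul, one_mul]
    at h2
  funext n
  simpa using congrArg (coeff n) h2

lemma ecoef_ne_zero {s : ℂ} (hs : ∀ k : ℕ, s + k ≠ 0) (n : ℕ) : ecoef s n ≠ 0 :=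
  prod_ne_zero_iff.mpr fun k _ => div_ne_zero (hs k) (Nat.cast_add_one_ne_zero k)

/-- This is why `opT` acts on `ecoef s` as a scalar for `n ≥ m - 1`: the free parts shift the
parameter up, and the binomial denominator shifts it back. -/
lemma ecoef_shift_div {s : ℂ} (hs : ∀ k : ℕ, s + k ≠ 0) (k j : ℕ) :
    ecoef (s + j) k / ((k + j).choose j : ℂ) = ecoef s (k + j) / ecoef s j := by
  have h2 : ((k + j).choose j : ℂ) ≠ 0 := by
    exact_mod_cast (Nat.choose_pos (by omega)).ne'
  rw [div_eq_div_iff h2 (ecoef_ne_zero hs j), ecoef_add]; ring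

lemma hsum_shift (s : ℂ) (k j : ℕ) : hsum (s + j) k = hsum s (k + j) - hsum s j := by
  rw [add_comm k, hsum_add]; ring

lemma hsumSq_shift (s : ℂ) (k j : ℕ) : hsumSq (s + j) k = hsumSq s (k + j) - hsumSq s j := by
  rw [add_comm k, hsumSq_add]; ring

variable {s : ℂ} {n : ℕ}

lemma add_natCast_ne_zero (hs : ∀ k : ℕ, s + k ≠ 0) (j : ℕ) : ∀ k : ℕ, s + j + k ≠ 0 := by
  intro k
  have := hs (j + k)
  push_cast at this
  rwa [add_assoc]

lemma opT_ecoef (hm : 1 ≤ m) (hs : ∀ k : ℕ, s + k ≠ 0) (hn : m - 1 ≤ n) :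
    opT m (ecoef s) n = m / ecoef s (m - 1) * ecoef s n := by
  obtain ⟨k, rfl⟩ : ∃ k, n = k + (m - 1) := ⟨n - (m - 1), by omega⟩
  rw [opT_add_eq hm, mk_ecoef_mul, coeff_mk, mul_div_assoc, ecoef_shift_div hs]; ring

lemma opT_lcoef (hm : 1 ≤ m) (hs : ∀ k : ℕ, s + k ≠ 0) (hn : m - 1 ≤ n) :
    opT m (lcoef s) n = m / ecoef s (m - 1) * (ecoef s n * (hsum s n - hsum s (m - 1))) := by
  obtain ⟨k, rfl⟩ : ∃ k, n = k + (m - 1) := ⟨n - (m - 1), by omega⟩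
  rw [opT_add_eq hm, mk_lcoef_mul hs (add_natCast_ne_zero hs _), coeff_mk, mul_div_assoc, lcoef,
    mul_div_right_comm, ecoef_shift_div hs, hsum_shift]; ring

lemma opT_qcoef (hm : 1 ≤ m) (hs : ∀ k : ℕ, s + k ≠ 0) (hn : m - 1 ≤ n) :
    opT m (qcoef s) n = m / ecoef s (m - 1) * (ecoef s n *
      ((hsum s n - hsum s (m - 1)) ^ 2 - (hsumSq s n - hsumSq s (m - 1)))) := by
  obtain ⟨k, rfl⟩ : ∃ k, n = k + (m - 1) := ⟨n - (m - 1), by omega⟩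
  rw [opT_add_eq hm, mk_qcoef_mul hs (add_natCast_ne_zero hs _), coeff_mk, mul_div_assoc, qcoef,
    mul_div_right_comm, ecoef_shift_div hs, hsum_shift, hsumSq_shift]; ring

/-- Distinct indices contribute the parameter `s + 2 + (m - 2)`. Read as `(s + 1) + (m - 1)`, it
shows that dividing by the binomial leaves the parameter `s + 1`. -/
lemma expI_ecoef_mul_lcoef (hm : 2 ≤ m) (hs : ∀ k : ℕ, s + k ≠ 0) (hn : m - 1 ≤ n) :
    expI m n (fun I => (∑ i, ecoef s (I i)) * ∑ i, lcoef 2 (I i))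
      = opT m (fun n => ecoef s n * lcoef 2 n) n +
        m * (m - 1) / ecoef (s + 1) (m - 1) *
          (ecoef (s + 1) n * (hsum (s + 1) n - hsum (s + 1) (m - 1))) := by
  obtain ⟨k, rfl⟩ : ∃ k, n = k + (m - 1) := ⟨n - (m - 1), by omega⟩
  have hs1 : ∀ k : ℕ, s + 1 + k ≠ 0 := by simpa using add_natCast_ne_zero hs 1
  have h2 : ∀ k : ℕ, (2 : ℂ) + k ≠ 0 := ne_neg_nat_of_re_pos (by simp)
  rw [expI_pair_eq hm, mul_right_comm (PowerSeries.mk _), mk_ecoef_mul,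
    mul_comm (PowerSeries.mk _) (PowerSeries.mk (lcoef 2)),
    show s + ((m : ℂ) - 2) = s + (m - 2 : ℕ) by push_cast [Nat.cast_sub hm]; rfl,
    mk_lcoef_mul h2]
  · rw [show (2 : ℂ) + (s + (m - 2 : ℕ)) = s + 1 + (m - 1 : ℕ) by
      push_cast [Nat.cast_sub hm, Nat.cast_sub (show 1 ≤ m by omega)]; ring, coeff_mk,
      mul_div_assoc, lcoef, mul_div_right_comm, ecoef_shift_div hs1, hsum_shift]
    ring
  · intro k
    have := hs (2 + (m - 2) + k)
    push_cast at this ⊢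
    convert this using 1; ring

lemma expI_lcoef_mul_lcoef (hm : 2 ≤ m) (hn : m - 1 ≤ n) :
    expI m n (fun I => (∑ i, lcoef 2 (I i)) * ∑ i, lcoef 2 (I i))
      = opT m (fun n => lcoef 2 n * lcoef 2 n) n +
        m * (m - 1) / ecoef 3 (m - 1) *
          (ecoef 3 n * ((hsum 3 n - hsum 3 (m - 1)) ^ 2 - (hsumSq 3 n - hsumSq 3 (m - 1)))) := by
  obtain ⟨k, rfl⟩ : ∃ k, n = k + (m - 1) := ⟨n - (m - 1), by omega⟩
  have h2 : ∀ k : ℕ, (2 : ℂ) + k ≠ 0 := ne_neg_nat_of_re_pos (by simp)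
  have h3 : ∀ k : ℕ, (3 : ℂ) + k ≠ 0 := ne_neg_nat_of_re_pos (by simp)
  have h4 : ∀ k : ℕ, (2 : ℂ) + 2 + k ≠ 0 := ne_neg_nat_of_re_pos (by norm_num)
  rw [expI_pair_eq hm, mk_lcoef_mul_lcoef h2 h2 h4,
    show ((m : ℂ) - 2) = (m - 2 : ℕ) by push_cast [Nat.cast_sub hm]; rfl,
    mk_qcoef_mul h4 (add_natCast_ne_zero h4 _)]
  rw [show (2 : ℂ) + 2 + (m - 2 : ℕ) = 3 + (m - 1 : ℕ) by
      push_cast [Nat.cast_sub hm, Nat.cast_sub (show 1 ≤ m by omega)]; ring, coeff_mk,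
      mul_div_assoc, qcoef, mul_div_right_comm, ecoef_shift_div h3, hsum_shift, hsumSq_shift]
  ring

lemma norm_expI_le_of_le (hm : 1 ≤ m) {F : (Fin m → ℕ) → ℂ} {c : ℝ} (hc : 0 ≤ c)
    (h : ∀ I : Fin m → ℕ, ∑ i, I i = n + 1 - m → ‖F I‖ ≤ c) : ‖expI m n F‖ ≤ c := by
  by_cases hn : n < m - 1
  · rw [expI_of_lt hn]; simpa using hc
  · refine (norm_expI_le F).trans ((expI_mono h).trans ?_)
    have := expI_const_mul (m := m) (n := n) (F := fun _ => (1 : ℝ)) c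
    rw [card_compositions hm (by omega)] at this
    simp only [mul_one] at this
    exact this.le

end SplittingOperator

/-! ### Finite averages, equal fibres and independence -/

section Averages

variable {α β : Type*}

/-- The average of `f` over a finite set. -/
noncomputable def avg (s : Finset α) (f : α → ℝ) : ℝ := (∑ x ∈ s, f x) / #s

lemma avg_add (s : Finset α) (f g : α → ℝ) : avg s (fun x => f x + g x) = avg s f + avg s g := by
  simp [avg, sum_add_distrib, add_div]

lemma avg_const_mul (s : Finset α) (c : ℝ) (f : α → ℝ) :
    avg s (fun x => c * f x) = c * avg s f := by
  simp [avg, ← mul_sum, mul_div_assoc]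

lemma avg_sum {ι : Type*} (s : Finset α) (t : Finset ι) (f : ι → α → ℝ) :
    avg s (fun x => ∑ i ∈ t, f i x) = ∑ i ∈ t, avg s (f i) := by
  simp only [avg]
  rw [sum_comm, sum_div]

lemma avg_const {s : Finset α} (hs : s.Nonempty) (c : ℝ) : avg s (fun _ => c) = c := by
  have : (#s : ℝ) ≠ 0 := by exact_mod_cast hs.card_pos.ne'
  rw [avg, sum_const, nsmul_eq_mul]; field_simp

lemma avg_congr {s : Finset α} {f g : α → ℝ} (h : ∀ x ∈ s, f x = g x) : avg s f = avg s g := by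
  rw [avg, avg, sum_congr rfl h]

/-- Averaging in two steps along a map all of whose fibres have the same size. -/
lemma avg_fiberwise [DecidableEq β] {s : Finset α} {t : Finset β} (hs : s.Nonempty) (D : α → β)
    (hD : ∀ x ∈ s, D x ∈ t)
    (hfib : ∀ b ∈ t, ∀ b' ∈ t, ∃ e : α → α, Function.Injective e ∧
      ∀ x ∈ s, D x = b → e x ∈ s ∧ D (e x) = b') (f : α → ℝ) :
    avg s f = avg t (fun b => avg {x ∈ s | D x = b} f) ∧ ∀ b ∈ t, {x ∈ s | D x = b}.Nonempty := by
  -- Injections between any two fibres, in both directions, make all fibres equally large.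
  have hle : ∀ b ∈ t, ∀ b' ∈ t, #{x ∈ s | D x = b} ≤ #{x ∈ s | D x = b'} := by
    intro b hb b' hb'
    obtain ⟨e, he, h⟩ := hfib b hb b' hb'
    refine card_le_card_of_injOn e (fun x hx => ?_) he.injOn
    simp only [coe_filter, Set.mem_ofPred_eq] at hx ⊢
    exact h x hx.1 hx.2
  obtain ⟨x₀, hx₀⟩ := hs
  set c := #{x ∈ s | D x = D x₀} with hc
  have hcard : ∀ b ∈ t, #{x ∈ s | D x = b} = c := fun b hb =>
    le_antisymm (hle b hb _ (hD _ hx₀)) (hle _ (hD _ hx₀) b hb)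
  have hcpos : 0 < c := card_pos.mpr ⟨x₀, by simp [hx₀]⟩
  have hc0 : (c : ℝ) ≠ 0 := by exact_mod_cast hcpos.ne'
  refine ⟨?_, fun b hb => card_pos.mp (by rw [hcard b hb]; exact hcpos)⟩
  have h1 : (#s : ℝ) = c * #t := by
    rw [card_eq_sum_card_fiberwise (f := D) (t := t) (fun x hx => hD x hx), sum_congr rfl hcard]
    simp [mul_comm]
  rw [avg, avg, h1, ← sum_fiberwise_of_maps_to hD, sum_congr rfl fun b hb => by
    rw [show ∑ x ∈ s with D x = b, f x = c * avg {x ∈ s | D x = b} f by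
      rw [avg, hcard b hb]; field_simp], ← mul_sum, mul_div_mul_left _ _ hc0]

lemma avg_comp [DecidableEq β] {s : Finset α} {t : Finset β} (hs : s.Nonempty) (D : α → β)
    (hD : ∀ x ∈ s, D x ∈ t)
    (hfib : ∀ b ∈ t, ∀ b' ∈ t, ∃ e : α → α, Function.Injective e ∧
      ∀ x ∈ s, D x = b → e x ∈ s ∧ D (e x) = b') (F : β → ℝ) :
    avg s (fun x => F (D x)) = avg t F := by
  obtain ⟨h1, h2⟩ := avg_fiberwise hs D hD hfib (fun x => F (D x))
  rw [h1]
  refine avg_congr fun b hb => ?_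
  rw [← avg_const (h2 b hb) (F b)]
  refine avg_congr fun x hx => ?_
  rw [(mem_filter.mp hx).2]

variable {ι : Type*} [Fintype ι] [DecidableEq ι]

lemma avg_piFinset_prod (s : ι → Finset α) (φ : ι → α → ℝ) :
    avg (Fintype.piFinset s) (fun t => ∏ i, φ i (t i)) = ∏ i, avg (s i) (φ i) := by
  simp only [avg]
  rw [prod_div_distrib, ← prod_univ_sum, Fintype.card_piFinset]
  push_cast; rfl

lemma avg_piFinset_single {s : ι → Finset α} (hs : ∀ i, (s i).Nonempty) (i : ι) (f : α → ℝ) :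
    avg (Fintype.piFinset s) (fun t => f (t i)) = avg (s i) f := by
  have h := avg_piFinset_prod s (fun j x => if j = i then f x else 1)
  simp only [prod_ite_eq', mem_univ, if_true] at h
  rw [h, prod_eq_single i]
  · simp
  · intro j _ hj; simp [hj, avg_const (hs j)]
  · simp

lemma avg_piFinset_pair {s : ι → Finset α} (hs : ∀ i, (s i).Nonempty) {i j : ι} (hij : i ≠ j)
    (f g : α → ℝ) :
    avg (Fintype.piFinset s) (fun t => f (t i) * g (t j)) = avg (s i) f * avg (s j) g := by
  have hj : j ∈ univ.erase i := mem_erase.mpr ⟨hij.symm, mem_univ _⟩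
  have h := avg_piFinset_prod s (fun r x => if r = i then f x else if r = j then g x else 1)
  have e : ∀ t : ι → α, (∏ r, if r = i then f (t r) else if r = j then g (t r) else 1)
      = f (t i) * g (t j) := by
    intro t
    rw [← mul_prod_erase _ _ (mem_univ i), ← mul_prod_erase _ _ hj, if_pos rfl, if_neg hij.symm,
      if_pos rfl, prod_eq_one, mul_one]
    intro r hr
    rw [mem_erase, mem_erase] at hr
    rw [if_neg hr.2.1, if_neg hr.1]
  simp only [e] at h
  rw [h, ← mul_prod_erase _ _ (mem_univ i), ← mul_prod_erase _ _ hj, prod_eq_one, mul_one]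
  · simp [hij.symm]
  · intro r hr
    rw [mem_erase, mem_erase] at hr
    simp [hr.1, hr.2.1, avg_const (hs r)]

/-- On a product set distinct coordinates are independent, so only the diagonal terms deviate from
the product of the means. -/
lemma avg_piFinset_bilinear {s : ι → Finset α} (hs : ∀ i, (s i).Nonempty) (a b : ℝ)
    (f g : α → ℝ) :
    avg (Fintype.piFinset s) (fun t => (a + ∑ i, f (t i)) * (b + ∑ i, g (t i)))
      = (a + ∑ i, avg (s i) f) * (b + ∑ i, avg (s i) g)
        + ∑ i, (avg (s i) (fun x => f x * g x) - avg (s i) f * avg (s i) g) := by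
  have hne : (Fintype.piFinset s).Nonempty := Fintype.piFinset_nonempty.mpr hs
  have e : ∀ t : ι → α, (a + ∑ i, f (t i)) * (b + ∑ i, g (t i))
      = a * b + (a * ∑ i, g (t i) + (b * ∑ i, f (t i) + ((∑ i, f (t i) * g (t i)) +
        ∑ i, ∑ j ∈ univ.erase i, f (t i) * g (t j)))) := by
    intro t
    have : (∑ i, f (t i)) * (∑ i, g (t i)) = (∑ i, f (t i) * g (t i)) +
        ∑ i, ∑ j ∈ univ.erase i, f (t i) * g (t j) := by
      rw [sum_mul, ← sum_add_distrib]
      refine sum_congr rfl fun i _ => ?_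
      rw [mul_sum, ← add_sum_erase _ _ (mem_univ i)]
    rw [← this]; ring
  have e2 : (∑ i, avg (s i) f) * (∑ i, avg (s i) g) = (∑ i, avg (s i) f * avg (s i) g) +
        ∑ i, ∑ j ∈ univ.erase i, avg (s i) f * avg (s j) g := by
    rw [sum_mul, ← sum_add_distrib]
    refine sum_congr rfl fun i _ => ?_
    rw [mul_sum, ← add_sum_erase _ _ (mem_univ i)]
  simp only [e]
  rw [avg_add, avg_add, avg_add, avg_add, avg_const hne, avg_const_mul, avg_const_mul, avg_sum,
    avg_sum, avg_sum, avg_sum]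
  simp only [avg_sum]
  rw [sum_congr rfl fun i _ => avg_piFinset_single hs i g,
    sum_congr rfl fun i _ => avg_piFinset_single hs i f,
    sum_congr rfl fun i _ => avg_piFinset_single hs i fun x => f x * g x,
    sum_congr rfl fun i _ => sum_congr rfl fun j hj =>
      avg_piFinset_pair hs (ne_of_mem_erase hj).symm f g, sum_sub_distrib]
  linear_combination -e2

lemma avg_piFinset_linear {s : ι → Finset α} (hs : ∀ i, (s i).Nonempty) (a : ℝ) (f : α → ℝ) :
    avg (Fintype.piFinset s) (fun t => a + ∑ i, f (t i)) = a + ∑ i, avg (s i) f := by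
  rw [avg_add, avg_const (Fintype.piFinset_nonempty.mpr hs), avg_sum,
    sum_congr rfl fun i _ => avg_piFinset_single hs i f]

end Averages

/-! ### Orderings of a finite set -/

section Orderings

variable {κ : Type}

/-- The orderings of a finite set. -/
def orderings (T : Finset κ) : Finset (List κ) := ⟨T.val.lists, Multiset.lists_nodup_finset T⟩

lemma mem_orderings {T : Finset κ} {l : List κ} :
    l ∈ orderings T ↔ l.Nodup ∧ ∀ x, x ∈ l ↔ x ∈ T := by
  rw [orderings, Finset.mem_mk, Multiset.mem_lists_iff]
  constructor
  · intro h
    have h' : T.val = (l : Multiset κ) := h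
    refine ⟨Multiset.coe_nodup.mp (h' ▸ T.nodup), fun x => ?_⟩
    rw [← Finset.mem_val, h', Multiset.mem_coe]
  · rintro ⟨h1, h2⟩
    exact (Multiset.Nodup.ext T.nodup (Multiset.coe_nodup.mpr h1)).mpr fun x => by
      rw [Finset.mem_val, Multiset.mem_coe, h2]

lemma length_of_mem_orderings {T : Finset κ} {l : List κ} (h : l ∈ orderings T) :
    l.length = #T := by
  rw [orderings, Finset.mem_mk, Multiset.mem_lists_iff] at h
  have h' : T.val = (l : Multiset κ) := h
  rw [Finset.card, h', Multiset.coe_card]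

lemma orderings_nonempty (T : Finset κ) : (orderings T).Nonempty :=
  ⟨T.toList, mem_orderings.mpr ⟨T.nodup_toList, fun _ => Finset.mem_toList⟩⟩

lemma card_orderings (T : Finset κ) : #(orderings T) = (#T).factorial := by
  have : T.val = (T.toList : Multiset κ) := T.coe_toList.symm
  show Multiset.card (Multiset.lists T.val) = _
  rw [this, Multiset.lists_coe, Multiset.coe_card, List.length_permutations, Finset.length_toList]

/-- A permutation for the tails is corrected by the swap of `e a` and `b`. Neither lies in the tail
`t'`, since both lists have no repetitions, so the tail is untouched. -/
lemma exists_perm_map_eq [DecidableEq κ] :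
    ∀ {l l' : List κ}, l.Nodup → l'.Nodup → l.length = l'.length →
      ∃ e : Equiv.Perm κ, l.map e = l'
  | [], [], _, _, _ => ⟨1, rfl⟩
  | a :: t, b :: t', h1, h2, h3 => by
    obtain ⟨e, he⟩ := exists_perm_map_eq (List.nodup_cons.mp h1).2 (List.nodup_cons.mp h2).2
      (by simpa using h3)
    refine ⟨e.trans (Equiv.swap (e a) b), ?_⟩
    rw [List.map_cons]
    congr 1
    · simp
    · refine Eq.trans (List.map_congr_left fun x hx => ?_) he
      have hex : e x ∈ t' := he ▸ List.mem_map_of_mem hx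
      rw [Equiv.trans_apply, Equiv.swap_apply_of_ne_of_ne]
      · intro h
        exact (List.nodup_cons.mp h1).1 (e.injective h ▸ hx)
      · rintro rfl
        exact (List.nodup_cons.mp h2).1 hex

lemma map_mem_orderings [Fintype κ] {l : List κ} (e : Equiv.Perm κ)
    (h : l ∈ orderings (univ : Finset κ)) : l.map e ∈ orderings (univ : Finset κ) := by
  rw [mem_orderings] at h ⊢
  refine ⟨h.1.map e.injective, fun x => ?_⟩
  simp only [mem_univ, iff_true, List.mem_map]
  exact ⟨e.symm x, (h.2 _).mpr (mem_univ _), by simp⟩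

end Orderings

/-! ### Recursive structure and order invariance of search trees -/

section Trees

/-- Lowering a tree by one level costs one per node. This is why each subtree contributes `N + S`,
not `N`, to the path length. -/
lemma depthSum_succ {m : ℕ} {κ : Type} :
    ∀ (t : MTree m κ) (d : ℕ), t.depthSum (d + 1) = t.depthSum d + t.numNodes
  | .empty, d => by simp [MTree.depthSum, MTree.numNodes]
  | .node _ c, d => by
    simp only [MTree.depthSum, MTree.numNodes]
    rw [sum_congr rfl fun i _ => depthSum_succ (c i) (d + 1), sum_add_distrib]
    ring

variable {κ : Type} [LinearOrder κ] {m : ℕ}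

/-- The keys directed to the `i`-th subtree. -/
def subKeys (m : ℕ) (l : List κ) (i : Fin m) : List κ :=
  (l.drop (m - 1)).filter fun x =>
    decide ((l.take (m - 1)).countP (fun r => decide (r < x)) = (i : ℕ))

lemma searchTree_nil : searchTree m ([] : List κ) = .empty := by
  rw [searchTree]; simp

lemma subKeys_of_length {l : List κ} (h : l.length = m - 1) (i : Fin m) : subKeys m l i = [] := by
  rw [subKeys, List.drop_of_length_le h.le]; rfl

lemma searchTree_leaf {l : List κ} (h0 : l ≠ []) (h : l.length < m) :
    searchTree m l = .node (l.mergeSort (fun a b => decide (a ≤ b))) fun _ => .empty := by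
  rw [searchTree]; simp [h0, h]

/-- The threshold is `m - 1` rather than `m`: an exactly full root has `m` empty subtrees and fits
the same decomposition. -/
lemma searchTree_node (hm : 2 ≤ m) {l : List κ} (h : m - 1 ≤ l.length) :
    ∃ keys, searchTree m l = .node keys fun i => searchTree m (subKeys m l i) := by
  have h0 : l ≠ [] := by rintro rfl; simp at h; omega
  by_cases hl : l.length < m
  · have h1 : (fun i => searchTree m (subKeys m l i)) = fun _ => .empty := by
      funext i
      rw [subKeys_of_length (by omega), searchTree_nil]
    rw [h1]
    exact ⟨_, searchTree_leaf h0 hl⟩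
  · rw [searchTree, if_neg h0, if_neg (by omega)]
    exact ⟨_, rfl⟩

/-- The number of nodes of the search tree of a list, as a real number. -/
def listS (m : ℕ) (l : List κ) : ℝ := (searchTree m l).numNodes

/-- The node path length of the search tree of a list, as a real number. -/
def listN (m : ℕ) (l : List κ) : ℝ := (searchTree m l).nodePathLength

lemma listS_node (hm : 2 ≤ m) {l : List κ} (h : m - 1 ≤ l.length) :
    listS m l = 1 + ∑ i, listS m (subKeys m l i) := by
  obtain ⟨keys, hk⟩ := searchTree_node hm h
  simp [listS, hk, MTree.numNodes]

lemma listN_node (hm : 2 ≤ m) {l : List κ} (h : m - 1 ≤ l.length) :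
    listN m l = ∑ i, (listN m (subKeys m l i) + listS m (subKeys m l i)) := by
  obtain ⟨keys, hk⟩ := searchTree_node hm h
  simp [listS, listN, hk, MTree.nodePathLength, MTree.depthSum, depthSum_succ]

lemma listS_leaf {l : List κ} (h0 : l ≠ []) (h : l.length < m) : listS m l = 1 := by
  simp [listS, searchTree_leaf h0 h, MTree.numNodes]

lemma listN_leaf {l : List κ} (h0 : l ≠ []) (h : l.length < m) : listN m l = 0 := by
  simp [listN, searchTree_leaf h0 h, MTree.nodePathLength, MTree.depthSum]

lemma listS_nil : listS m ([] : List κ) = 0 := by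
  simp [listS, searchTree_nil, MTree.numNodes]

lemma listN_nil : listN m ([] : List κ) = 0 := by
  simp [listN, searchTree_nil, MTree.nodePathLength, MTree.depthSum]

lemma length_subKeys_lt (hm : 2 ≤ m) {l : List κ} (h : m - 1 ≤ l.length) (i : Fin m) :
    (subKeys m l i).length < l.length := by
  refine (List.length_filter_le _ _).trans_lt ?_
  rw [List.length_drop]; omega

lemma subKeys_map {κ' : Type} [LinearOrder κ'] {g : κ → κ'} (hg : StrictMono g) (l : List κ)
    (i : Fin m) : subKeys m (l.map g) i = (subKeys m l i).map g := by
  rw [subKeys, subKeys, ← List.map_drop, ← List.map_take, List.filter_map]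
  congr 1
  refine List.filter_congr fun x _ => ?_
  simp only [Function.comp_apply, List.countP_map]
  congr 3
  funext r
  simp [hg.lt_iff_lt]

/-- The statistics of a search tree only depend on the relative order of the keys. -/
lemma list_stats_map (hm : 2 ≤ m) {κ' : Type} [LinearOrder κ'] {g : κ → κ'} (hg : StrictMono g) :
    ∀ l : List κ, listS m (l.map g) = listS m l ∧ listN m (l.map g) = listN m l := by
  intro l
  induction hlen : l.length using Nat.strong_induction_on generalizing l with
  | _ k ih =>
    by_cases h : m - 1 ≤ l.length
    · have hi : ∀ i, listS m (subKeys m (l.map g) i) = listS m (subKeys m l i) ∧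
          listN m (subKeys m (l.map g) i) = listN m (subKeys m l i) := by
        intro i
        rw [subKeys_map hg]
        exact ih _ (hlen ▸ length_subKeys_lt hm h i) _ rfl
      rw [listS_node hm h, listN_node hm h, listS_node hm (by simpa using h),
        listN_node hm (by simpa using h)]
      simp only [hi, and_self]
    · by_cases h0 : l = []
      · subst h0; simp [listS_nil, listN_nil]
      · rw [listS_leaf h0 (by omega), listN_leaf h0 (by omega),
          listS_leaf (by simpa using h0) (by simp; omega),
          listN_leaf (by simpa using h0) (by simp; omega)]
        exact ⟨rfl, rfl⟩

lemma orderings_eq_map {n : ℕ} (T : Finset (Fin n)) :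
    orderings T = (orderings (univ : Finset (Fin #T))).map
      ⟨List.map (T.orderEmbOfFin rfl),
        List.map_injective_iff.mpr (T.orderEmbOfFin rfl).injective⟩ := by
  symm
  refine eq_of_subset_of_card_le ?_ ?_
  · intro l hl
    obtain ⟨l', hl', rfl⟩ := Finset.mem_map.mp hl
    rw [mem_orderings] at hl' ⊢
    refine ⟨hl'.1.map (T.orderEmbOfFin rfl).injective, fun x => ?_⟩
    simp only [Function.Embedding.coeFn_mk, List.mem_map, hl'.2, mem_univ, true_and]
    rw [← Finset.mem_coe, ← T.range_orderEmbOfFin rfl, Set.mem_range]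
  · rw [card_map, card_orderings, card_orderings, card_univ, Fintype.card_fin]

lemma avg_orderings {n : ℕ} {f : List (Fin n) → ℝ} (T : Finset (Fin n))
    {f' : List (Fin #T) → ℝ}
    (h : ∀ g : Fin #T → Fin n, StrictMono g → ∀ l, f (l.map g) = f' l) :
    avg (orderings T) f = avg (orderings (univ : Finset (Fin #T))) f' := by
  rw [orderings_eq_map, avg, avg, sum_map, card_map]
  simp only [Function.Embedding.coeFn_mk]
  rw [sum_congr rfl fun l _ => h _ (T.orderEmbOfFin rfl).strictMono l]

end Trees

/-! ### Independence of the subtrees given the root keys -/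

section Splitting

variable {m n : ℕ}

/-- The number of elements of `R` below `x`. -/
def rankIn (R : Finset (Fin n)) (x : Fin n) : ℕ := #{r ∈ R | r < x}

/-- The elements outside `R` lying in its `i`-th interval. -/
def interval (R : Finset (Fin n)) (i : ℕ) : Finset (Fin n) := {x | x ∉ R ∧ rankIn R x = i}

lemma mem_interval {R : Finset (Fin n)} {i : ℕ} {x : Fin n} :
    x ∈ interval R i ↔ x ∉ R ∧ rankIn R x = i := by simp [interval]

lemma rankIn_le (R : Finset (Fin n)) (x : Fin n) : rankIn R x ≤ #R := card_filter_le _ _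

lemma rankIn_lt {R : Finset (Fin n)} {x : Fin n} (hx : x ∈ R) : rankIn R x < #R :=
  card_lt_card (filter_ssubset.mpr ⟨x, hx, lt_irrefl x⟩)

lemma rankIn_le_rankIn {R : Finset (Fin n)} {x y : Fin n} (h : x ≤ y) : rankIn R x ≤ rankIn R y :=
  card_le_card fun r hr => by
    rw [mem_filter] at hr ⊢
    exact ⟨hr.1, hr.2.trans_le h⟩

lemma rankIn_lt_rankIn {R : Finset (Fin n)} {x y : Fin n} (hx : x ∈ R) (h : x < y) :
    rankIn R x < rankIn R y := by
  refine card_lt_card ((ssubset_iff_of_subset fun r hr => ?_).mpr ⟨x, ?_, ?_⟩)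
  · rw [mem_filter] at hr ⊢
    exact ⟨hr.1, hr.2.trans h⟩
  · exact mem_filter.mpr ⟨hx, h⟩
  · simp

lemma countP_take_eq {l : List (Fin n)} (hl : l.Nodup) (j : ℕ) (x : Fin n) :
    (l.take j).countP (fun r => decide (r < x)) = rankIn (l.take j).toFinset x := by
  rw [List.countP_eq_length_filter, rankIn, ← List.toFinset_card_of_nodup
    ((hl.sublist (List.take_sublist j l)).filter _), List.toFinset_filter]
  simp

lemma subKeys_eq {l : List (Fin n)} (hl : l.Nodup) (i : Fin m) :
    subKeys m l i = (l.drop (m - 1)).filter fun x =>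
      decide (rankIn (l.take (m - 1)).toFinset x = (i : ℕ)) := by
  rw [subKeys]
  simp only [countP_take_eq hl]

lemma mem_drop_iff {l : List (Fin n)} (hl : l ∈ orderings univ) (j : ℕ) (x : Fin n) :
    x ∈ l.drop j ↔ x ∉ (l.take j).toFinset := by
  rw [mem_orderings] at hl
  have h1 : x ∈ l := (hl.2 x).mpr (mem_univ x)
  have h2 := hl.1
  rw [← List.take_append_drop j l] at h1 h2
  rw [List.mem_append] at h1
  rw [List.nodup_append] at h2
  rw [List.mem_toFinset]
  exact ⟨fun h h' => h2.2.2 x h' x h rfl, fun h => h1.resolve_left h⟩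

lemma subKeys_mem {l : List (Fin n)} (hl : l ∈ orderings univ) (i : Fin m) :
    subKeys m l i ∈ orderings (interval (l.take (m - 1)).toFinset i) := by
  have hn := (mem_orderings.mp hl).1
  rw [mem_orderings, subKeys_eq hn]
  refine ⟨(hn.sublist (List.drop_sublist _ l)).filter _, fun x => ?_⟩
  rw [List.mem_filter, mem_drop_iff hl, mem_interval]
  simp

lemma card_take {l : List (Fin n)} (hl : l ∈ orderings univ) (hn : m - 1 ≤ n) :
    #(l.take (m - 1)).toFinset = m - 1 := by
  rw [List.toFinset_card_of_nodup ((mem_orderings.mp hl).1.sublist (List.take_sublist _ l)),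
    List.length_take, length_of_mem_orderings hl, card_univ, Fintype.card_fin]
  omega

lemma take_map_toFinset (l : List (Fin n)) (e : Equiv.Perm (Fin n)) (j : ℕ) :
    ((l.map e).take j).toFinset = (l.take j).toFinset.image e := by
  ext x
  rw [← List.map_take, List.mem_toFinset, List.mem_map, Finset.mem_image]
  simp only [List.mem_toFinset]

lemma exists_perm_image_eq {R R' : Finset (Fin n)} (h : #R = #R') :
    ∃ e : Equiv.Perm (Fin n), R.image e = R' := by
  obtain ⟨e, he⟩ := exists_perm_map_eq R.nodup_toList R'.nodup_toList (by simpa using h)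
  refine ⟨e, ?_⟩
  have := congrArg List.toFinset he
  rw [toList_toFinset] at this
  rw [← this]
  ext x; simp

/-- Any two families of orderings of the intervals of `R` are related by a permutation of the keys
that preserves `R`. -/
lemma exists_perm_intervals {R : Finset (Fin n)} (hR : #R = m - 1) (hm : 1 ≤ m)
    {t t' : Fin m → List (Fin n)} (ht : ∀ i : Fin m, t i ∈ orderings (interval R i))
    (ht' : ∀ i : Fin m, t' i ∈ orderings (interval R i)) :
    ∃ e : Equiv.Perm (Fin n), R.image e = R ∧ ∀ i, (t i).map e = t' i := by
  have hnd : ∀ t : Fin m → List (Fin n), (∀ i : Fin m, t i ∈ orderings (interval R i)) →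
      (List.ofFn t).flatten.Nodup ∧ ∀ x, x ∈ (List.ofFn t).flatten ↔ x ∉ R := by
    intro t ht
    refine ⟨?_, fun x => ?_⟩
    · rw [List.nodup_flatten]
      refine ⟨fun l hl => ?_, ?_⟩
      · obtain ⟨i, rfl⟩ := List.mem_ofFn.mp hl
        exact (mem_orderings.mp (ht i)).1
      · rw [List.pairwise_ofFn]
        intro i j hij x hx hy
        have h1 := mem_interval.mp (((mem_orderings.mp (ht i)).2 x).mp hx)
        have h2 := mem_interval.mp (((mem_orderings.mp (ht j)).2 x).mp hy)
        have : (i : ℕ) = j := h1.2.symm.trans h2.2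
        exact hij.ne (Fin.ext this)
    · rw [List.mem_flatten]
      constructor
      · rintro ⟨l, hl, hx⟩
        obtain ⟨i, rfl⟩ := List.mem_ofFn.mp hl
        exact (mem_interval.mp (((mem_orderings.mp (ht i)).2 x).mp hx)).1
      · intro hx
        have hlt : rankIn R x < m := by
          have := rankIn_le R x
          omega
        refine ⟨t ⟨rankIn R x, hlt⟩, List.mem_ofFn.mpr ⟨_, rfl⟩, ?_⟩
        rw [(mem_orderings.mp (ht _)).2, mem_interval]
        exact ⟨hx, rfl⟩
  have hlen : ∀ i, (t i).length = (t' i).length := fun i => by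
    rw [length_of_mem_orderings (ht i), length_of_mem_orderings (ht' i)]
  have hmaplen : (List.ofFn t).map List.length = (List.ofFn t').map List.length := by
    rw [List.map_ofFn, List.map_ofFn]
    congr 1
    funext i
    exact hlen i
  obtain ⟨e, he⟩ := exists_perm_map_eq (hnd t ht).1 (hnd t' ht').1 (by
    rw [List.length_flatten, List.length_flatten, hmaplen])
  refine ⟨e, ?_, ?_⟩
  · refine eq_of_subset_of_card_le (fun y hy => ?_) (by
      rw [card_image_of_injective _ e.injective])
    obtain ⟨x, hx, rfl⟩ := Finset.mem_image.mp hy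
    by_contra hcon
    have h1 := ((hnd t' ht').2 _).mpr hcon
    rw [← he, List.mem_map] at h1
    obtain ⟨z, hz, hzx⟩ := h1
    rw [e.injective hzx] at hz
    exact ((hnd t ht).2 x).mp hz hx
  · have h2 : (List.ofFn t).map (List.map e) = List.ofFn t' := by
      rw [List.eq_iff_flatten_eq]
      refine ⟨by rw [← he, List.map_flatten], ?_⟩
      rw [List.map_map, ← hmaplen]
      refine List.map_congr_left fun l _ => ?_
      simp
    rw [List.map_ofFn] at h2
    intro i
    exact congrFun (List.ofFn_injective h2) i

/-- A relabelling that preserves the set of root keys and each interval commutes with the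
distribution of keys, although it need not be monotone. -/
lemma subKeys_map_perm {l : List (Fin n)} (hl : l ∈ orderings univ) (e : Equiv.Perm (Fin n))
    (he : (l.take (m - 1)).toFinset.image e = (l.take (m - 1)).toFinset)
    (hint : ∀ i : Fin m, (subKeys m l i).map e ∈ orderings (interval (l.take (m - 1)).toFinset i))
    (hm : 1 ≤ m) (hn : m - 1 ≤ n) (i : Fin m) :
    subKeys m (l.map e) i = (subKeys m l i).map e := by
  have hnd := (mem_orderings.mp hl).1
  rw [subKeys_eq (hnd.map e.injective), subKeys_eq hnd, take_map_toFinset, he, ← List.map_drop,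
    List.filter_map]
  congr 1
  refine List.filter_congr fun x hx => ?_
  have h1 : x ∉ (l.take (m - 1)).toFinset := (mem_drop_iff hl _ x).mp hx
  have hlt : rankIn (l.take (m - 1)).toFinset x < m := by
    have := rankIn_le (l.take (m - 1)).toFinset x
    rw [card_take hl hn] at this
    omega
  have h2 : x ∈ subKeys m l ⟨_, hlt⟩ :=
    ((mem_orderings.mp (subKeys_mem hl _)).2 x).mpr (mem_interval.mpr ⟨h1, rfl⟩)
  have h3 := ((mem_orderings.mp (hint ⟨_, hlt⟩)).2 (e x)).mp (List.mem_map_of_mem h2)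
  rw [mem_interval] at h3
  simp only [Function.comp_apply, h3.2]

/-- Splitting a uniformly random ordering: first the set of the root keys is chosen uniformly, then
the subtrees receive independent uniformly random orderings of the intervals. -/
lemma avg_orderings_split (hm : 1 ≤ m) (hn : m - 1 ≤ n) (F : (Fin m → List (Fin n)) → ℝ) :
    avg (orderings univ) (fun l => F (subKeys m l)) =
      avg (powersetCard (m - 1) univ) (fun R =>
        avg (Fintype.piFinset fun i : Fin m => orderings (interval R i)) F) := by
  obtain ⟨h1, h2⟩ := avg_fiberwise (orderings_nonempty (univ : Finset (Fin n)))
    (t := powersetCard (m - 1) univ)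
    (fun l => (l.take (m - 1)).toFinset)
    (fun l hl => mem_powersetCard.mpr ⟨subset_univ _, card_take hl hn⟩)
    (fun R hR R' hR' => by
      obtain ⟨e, he⟩ := exists_perm_image_eq
        ((mem_powersetCard.mp hR).2.trans (mem_powersetCard.mp hR').2.symm)
      refine ⟨List.map e, List.map_injective_iff.mpr e.injective, fun l hl hlR => ?_⟩
      exact ⟨map_mem_orderings e hl, by rw [take_map_toFinset, hlR, he]⟩)
    (fun l => F (subKeys m l))
  rw [h1]
  refine avg_congr fun R hR => ?_
  have hRc := (mem_powersetCard.mp hR).2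
  -- Inside a fibre, relabellings that preserve `R` carry any family of subtree orderings to any
  -- other, so all families are equally likely.
  refine avg_comp (h2 R hR) (subKeys m) (fun l hl => ?_) (fun t ht t' ht' => ?_) F
  · obtain ⟨hl1, rfl⟩ := mem_filter.mp hl
    exact Fintype.mem_piFinset.mpr fun i => subKeys_mem hl1 i
  · rw [Fintype.mem_piFinset] at ht ht'
    obtain ⟨e, he1, he2⟩ := exists_perm_intervals hRc hm ht ht'
    refine ⟨List.map e, List.map_injective_iff.mpr e.injective, fun l hl hlt => ?_⟩
    obtain ⟨hl1, rfl⟩ := mem_filter.mp hl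
    refine ⟨mem_filter.mpr ⟨map_mem_orderings e hl1, by rw [take_map_toFinset, he1]⟩, ?_⟩
    funext i
    rw [subKeys_map_perm hl1 e he1 (fun j => by rw [hlt, he2]; exact ht' j) hm hn, hlt, he2]

end Splitting

/-! ### Subtree sizes form a uniform composition -/

section Sizes

variable {m n : ℕ}

lemma card_piAntidiag_eq (hm : 1 ≤ m) (hn : m - 1 ≤ n) :
    #(piAntidiag (univ : Finset (Fin m)) (n + 1 - m)) = n.choose (m - 1) := by
  have h := card_compositions (K := ℝ) hm hn
  have h0 : (n.choose (m - 1) : ℝ) ≠ 0 := by exact_mod_cast (Nat.choose_pos hn).ne'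
  rw [expI, sum_const, nsmul_eq_mul, mul_one, div_eq_one_iff_eq h0] at h
  exact_mod_cast h

/-- The sizes of the intervals of `R`. -/
def sizes (m : ℕ) (R : Finset (Fin n)) (i : Fin m) : ℕ := #(interval R i)

lemma sum_card_interval (R : Finset (Fin n)) (k : ℕ) :
    ∑ i ∈ range k, #(interval R i) = #{y | y ∉ R ∧ rankIn R y < k} := by
  rw [card_eq_sum_card_fiberwise (f := rankIn R) (t := range k)]
  · refine sum_congr rfl fun i hi => ?_
    congr 1
    ext y
    simp only [mem_interval, mem_filter, mem_univ, true_and]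
    rw [mem_range] at hi
    constructor
    · rintro ⟨h1, rfl⟩; exact ⟨⟨h1, hi⟩, rfl⟩
    · rintro ⟨⟨h1, _⟩, h2⟩; exact ⟨h1, h2⟩
  · intro y hy
    simpa using (mem_filter.mp hy).2.2

/-- Below a root key lie the smaller root keys and the whole intervals up to its own rank. Hence the
interval sizes determine `R`, which makes `sizes` injective; counting then makes it bijective. -/
lemma val_eq_of_mem {R : Finset (Fin n)} {x : Fin n} (hx : x ∈ R) :
    (x : ℕ) = rankIn R x + ∑ i ∈ range (rankIn R x + 1), #(interval R i) := by
  have h1 : (x : ℕ) = #{y : Fin n | y < x} := by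
    rw [show ({y : Fin n | y < x} : Finset (Fin n)) = Finset.Iio x by ext; simp, Fin.card_Iio]
  rw [sum_card_interval, rankIn, ← card_union_of_disjoint]
  · conv_lhs => rw [h1]
    congr 1
    ext y
    simp only [mem_filter, mem_univ, true_and, mem_union]
    constructor
    · intro hy
      by_cases hyR : y ∈ R
      · exact Or.inl ⟨hyR, hy⟩
      · refine Or.inr ⟨hyR, ?_⟩
        have := rankIn_le_rankIn (R := R) hy.le
        exact Nat.lt_succ_of_le this
    · rintro (⟨_, h⟩ | ⟨h, h2⟩)
      · exact h
      · by_contra hcon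
        have hne : x ≠ y := by rintro rfl; exact h hx
        have h3 := rankIn_lt_rankIn hx (lt_of_le_of_ne (not_lt.mp hcon) hne)
        have h4 : rankIn R y < rankIn R x + 1 := h2
        omega
  · rw [disjoint_left]
    intro y hy hy'
    exact (mem_filter.mp hy').2.1 (mem_filter.mp hy).1

lemma image_val_eq {R : Finset (Fin n)} (hR : #R = m - 1) :
    R.image Fin.val = (range (m - 1)).image
      (fun k => k + ∑ i ∈ range (k + 1), if h : i < m then sizes m R ⟨i, h⟩ else 0) := by
  refine eq_of_subset_of_card_le ?_ ?_
  · intro v hv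
    obtain ⟨x, hx, rfl⟩ := Finset.mem_image.mp hv
    have hlt := rankIn_lt hx
    rw [hR] at hlt
    refine Finset.mem_image.mpr ⟨rankIn R x, mem_range.mpr hlt, ?_⟩
    rw [val_eq_of_mem hx]
    congr 1
    refine sum_congr rfl fun i hi => ?_
    rw [mem_range] at hi
    rw [dif_pos (by omega)]
    rfl
  · rw [card_image_of_injective _ Fin.val_injective, hR]
    exact card_image_le.trans (card_range _).le

lemma sizes_injOn : Set.InjOn (sizes m)
    (powersetCard (m - 1) (univ : Finset (Fin n)) : Set (Finset (Fin n))) := by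
  intro R hR R' hR' h
  have h1 := image_val_eq (mem_powersetCard.mp (mem_coe.mp hR)).2
  have h2 := image_val_eq (mem_powersetCard.mp (mem_coe.mp hR')).2
  rw [h, ← h2] at h1
  exact image_injective Fin.val_injective h1

lemma sizes_mem (hm : 1 ≤ m) {R : Finset (Fin n)} (hR : #R = m - 1) (hn : m - 1 ≤ n) :
    sizes m R ∈ piAntidiag (univ : Finset (Fin m)) (n + 1 - m) := by
  rw [mem_piAntidiag]
  refine ⟨?_, fun i _ => mem_univ i⟩
  have h1 : ∑ i : Fin m, sizes m R i = ∑ i ∈ range m, #(interval R i) := by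
    rw [← Fin.sum_univ_eq_sum_range]; rfl
  have h2 : ({y | y ∉ R ∧ rankIn R y < m} : Finset (Fin n)) = Rᶜ := by
    ext y
    simp only [mem_filter, mem_univ, true_and, mem_compl, and_iff_left_iff_imp]
    intro _
    have := rankIn_le R y
    omega
  rw [h1, sum_card_interval, h2, card_compl, Fintype.card_fin, hR]
  omega

/-- The sizes of the intervals of a uniformly random set of root keys form a uniformly random
composition. -/
lemma avg_sizes (hm : 1 ≤ m) (hn : m - 1 ≤ n) (G : (Fin m → ℕ) → ℝ) :
    avg (powersetCard (m - 1) (univ : Finset (Fin n))) (fun R => G (sizes m R)) = expI m n G := by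
  rw [avg, expI, card_powersetCard, card_univ, Fintype.card_fin]
  congr 1
  refine sum_nbij (sizes m) (fun R hR => sizes_mem hm (mem_powersetCard.mp hR).2 hn) sizes_injOn
    ?_ fun R _ => rfl
  refine surjOn_of_injOn_of_card_le _
    (fun R hR => sizes_mem hm (mem_powersetCard.mp (mem_coe.mp hR)).2 hn) sizes_injOn ?_
  rw [card_piAntidiag_eq hm hn, card_powersetCard, card_univ, Fintype.card_fin]

end Sizes

/-! ### Law of total covariance at the root -/

section Recurrences

variable {m n : ℕ}

lemma avg_linear (hm : 1 ≤ m) (hn : m - 1 ≤ n) (a : ℝ) {f : List (Fin n) → ℝ} {Mf : ℕ → ℝ}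
    (hf : ∀ T : Finset (Fin n), avg (orderings T) f = Mf #T) :
    avg (orderings univ) (fun l => a + ∑ i, f (subKeys m l i))
      = expI m n fun I => a + ∑ i, Mf (I i) := by
  rw [avg_orderings_split hm hn (fun t => a + ∑ i, f (t i)), ← avg_sizes hm hn]
  refine avg_congr fun R _ => ?_
  rw [avg_piFinset_linear fun i => orderings_nonempty _]
  simp only [hf]; rfl

lemma avg_bilinear (hm : 1 ≤ m) (hn : m - 1 ≤ n) (a b : ℝ) {f g : List (Fin n) → ℝ}
    {Mf Mg Mfg : ℕ → ℝ}
    (hf : ∀ T : Finset (Fin n), avg (orderings T) f = Mf #T)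
    (hg : ∀ T : Finset (Fin n), avg (orderings T) g = Mg #T)
    (hfg : ∀ T : Finset (Fin n), avg (orderings T) (fun l => f l * g l) = Mfg #T) :
    avg (orderings univ)
      (fun l => (a + ∑ i, f (subKeys m l i)) * (b + ∑ i, g (subKeys m l i)))
      = expI m n fun I => (a + ∑ i, Mf (I i)) * (b + ∑ i, Mg (I i))
          + ∑ i, (Mfg (I i) - Mf (I i) * Mg (I i)) := by
  rw [avg_orderings_split hm hn (fun t => (a + ∑ i, f (t i)) * (b + ∑ i, g (t i))),
    ← avg_sizes hm hn]
  refine avg_congr fun R _ => ?_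
  rw [avg_piFinset_bilinear fun i => orderings_nonempty _]
  simp only [hf, hg, hfg]; rfl

/-- Decomposition of a covariance over the root of the tree. -/
lemma covariance_split (hm : 1 ≤ m) (hn : m - 1 ≤ n) (a b : ℝ) {f g : List (Fin n) → ℝ}
    {Mf Mg Mfg : ℕ → ℝ}
    (hf : ∀ T : Finset (Fin n), avg (orderings T) f = Mf #T)
    (hg : ∀ T : Finset (Fin n), avg (orderings T) g = Mg #T)
    (hfg : ∀ T : Finset (Fin n), avg (orderings T) (fun l => f l * g l) = Mfg #T)
    {X Y : List (Fin n) → ℝ}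
    (hX : ∀ l ∈ orderings univ, X l = a + ∑ i, f (subKeys m l i))
    (hY : ∀ l ∈ orderings univ, Y l = b + ∑ i, g (subKeys m l i)) :
    avg (orderings univ) (fun l => X l * Y l) - avg (orderings univ) X * avg (orderings univ) Y
      = (expI m n fun I => ∑ i, (Mfg (I i) - Mf (I i) * Mg (I i))) +
        expI m n fun I => (a + ∑ i, Mf (I i) - avg (orderings univ) X) *
          (b + ∑ i, Mg (I i) - avg (orderings univ) Y) := by
  set x := avg (orderings univ) X with hx
  set y := avg (orderings univ) Y with hy
  have hx' : x = expI m n fun I => a + ∑ i, Mf (I i) := by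
    rw [hx, avg_congr hX, avg_linear hm hn a hf]
  have hy' : y = expI m n fun I => b + ∑ i, Mg (I i) := by
    rw [hy, avg_congr hY, avg_linear hm hn b hg]
  have h1 : avg (orderings univ) (fun l => X l * Y l)
      = expI m n fun I => (a + ∑ i, Mf (I i)) * (b + ∑ i, Mg (I i))
          + ∑ i, (Mfg (I i) - Mf (I i) * Mg (I i)) := by
    rw [← avg_bilinear hm hn a b hf hg hfg]
    exact avg_congr fun l hl => by rw [hX l hl, hY l hl]
  -- Here `x` and `y` are the averages of the two conditional means, so this is the covariance of
  -- the conditional means.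
  have h2 : (expI m n fun I => (a + ∑ i, Mf (I i) - x) * (b + ∑ i, Mg (I i) - y))
      = (expI m n fun I => (a + ∑ i, Mf (I i)) * (b + ∑ i, Mg (I i))) - x * y := by
    have e : ∀ I : Fin m → ℕ, (a + ∑ i, Mf (I i) - x) * (b + ∑ i, Mg (I i) - y)
        = ((a + ∑ i, Mf (I i)) * (b + ∑ i, Mg (I i)) + x * y * 1)
          - (y * (a + ∑ i, Mf (I i)) + x * (b + ∑ i, Mg (I i))) := fun I => by ring
    simp only [e]
    rw [expI_sub, expI_add, expI_add, expI_const_mul, expI_const_mul, expI_const_mul, ← hx', ← hy',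
      card_compositions hm hn]
    ring
  rw [h1, h2, expI_add]; ring

end Recurrences

/-! ### Recurrences for means and covariances under the uniform law -/

section Law

variable {m n : ℕ}

lemma integral_permLaw (f : List (Fin n) → ℝ) :
    ∫ σ, f (List.ofFn fun i => σ i) ∂(permLaw n) = avg (orderings univ) f := by
  rw [permLaw, PMF.integral_eq_sum]
  simp only [PMF.uniformOfFintype_apply, smul_eq_mul]
  rw [← mul_sum, avg, card_orderings, card_univ, Fintype.card_fin, Fintype.card_perm,
    Fintype.card_fin, ENNReal.toReal_inv, ENNReal.toReal_natCast, inv_mul_eq_div]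
  congr 1
  have hinj : Function.Injective fun σ : Equiv.Perm (Fin n) => List.ofFn fun i => σ i := by
    intro σ τ h
    exact Equiv.ext fun i => congrFun (List.ofFn_injective h) i
  have hmem : ∀ σ : Equiv.Perm (Fin n),
      (List.ofFn fun i => σ i) ∈ orderings (univ : Finset (Fin n)) := by
    intro σ
    rw [mem_orderings]
    refine ⟨List.nodup_ofFn.mpr σ.injective, fun x => ?_⟩
    simp only [List.mem_ofFn, mem_univ, iff_true]
    exact ⟨σ.symm x, by simp⟩
  refine sum_nbij (fun σ : Equiv.Perm (Fin n) => List.ofFn fun i => σ i) (fun σ _ => hmem σ)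
    hinj.injOn ?_ fun σ _ => rfl
  refine surjOn_of_injOn_of_card_le _ (fun σ _ => hmem σ) hinj.injOn ?_
  rw [card_orderings, card_univ, card_univ, Fintype.card_perm]

instance (n : ℕ) : IsProbabilityMeasure (permLaw n) := by
  rw [permLaw]; infer_instance

lemma covariance_permLaw (f g : List (Fin n) → ℝ) :
    cov[fun σ : Equiv.Perm (Fin n) => f (List.ofFn fun i => σ i),
      fun σ => g (List.ofFn fun i => σ i); permLaw n]
      = avg (orderings univ) (fun l => f l * g l)
        - avg (orderings univ) f * avg (orderings univ) g := by
  rw [covariance_eq_sub (MemLp.of_discrete) (MemLp.of_discrete)]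
  simp only [Pi.mul_apply]
  rw [← integral_permLaw, ← integral_permLaw, ← integral_permLaw]

/-- The expected number of nodes. -/
noncomputable def meanS (m n : ℕ) : ℝ := avg (orderings (univ : Finset (Fin n))) (listS m)

/-- The expected node path length. -/
noncomputable def meanN (m n : ℕ) : ℝ := avg (orderings (univ : Finset (Fin n))) (listN m)

/-- The variance of the number of nodes. -/
noncomputable def covSS (m n : ℕ) : ℝ := cov[S m n, S m n; permLaw n]

/-- The covariance of the number of nodes and the node path length. -/
noncomputable def covSN (m n : ℕ) : ℝ := cov[S m n, N m n; permLaw n]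

/-- The variance of the node path length. -/
noncomputable def covNN (m n : ℕ) : ℝ := cov[N m n, N m n; permLaw n]

lemma covSS_eq (m n : ℕ) : covSS m n = avg (orderings (univ : Finset (Fin n)))
    (fun l => listS m l * listS m l) - meanS m n * meanS m n :=
  covariance_permLaw (listS m) (listS m)

lemma covSN_eq (m n : ℕ) : covSN m n = avg (orderings (univ : Finset (Fin n)))
    (fun l => listS m l * listN m l) - meanS m n * meanN m n :=
  covariance_permLaw (listS m) (listN m)

lemma covNN_eq (m n : ℕ) : covNN m n = avg (orderings (univ : Finset (Fin n)))
    (fun l => listN m l * listN m l) - meanN m n * meanN m n :=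
  covariance_permLaw (listN m) (listN m)

lemma listS_of_small {l : List (Fin n)} (hl : l ∈ orderings univ) (h : n < m) :
    listS m l = if n = 0 then 0 else 1 := by
  have hlen := length_of_mem_orderings hl
  rw [card_univ, Fintype.card_fin] at hlen
  split_ifs with h0
  · have : l = [] := List.length_eq_zero_iff.mp (by omega)
    subst this; exact listS_nil
  · exact listS_leaf (by rintro rfl; simp at hlen; omega) (by omega)

lemma listN_of_small {l : List (Fin n)} (hl : l ∈ orderings univ) (h : n < m) :
    listN m l = 0 := by
  have hlen := length_of_mem_orderings hl
  rw [card_univ, Fintype.card_fin] at hlen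
  by_cases h0 : l = []
  · subst h0; exact listN_nil
  · exact listN_leaf h0 (by omega)

lemma meanS_of_small (h : n < m) : meanS m n = if n = 0 then 0 else 1 := by
  rw [meanS, avg_congr fun l hl => listS_of_small hl h, avg_const (orderings_nonempty _)]

lemma meanN_of_small (h : n < m) : meanN m n = 0 := by
  rw [meanN, avg_congr fun l hl => listN_of_small hl h, avg_const (orderings_nonempty _)]

lemma covSS_of_small (h : n < m) : covSS m n = 0 := by
  rw [covSS_eq, meanS_of_small h, avg_congr fun l hl => by rw [listS_of_small hl h],
    avg_const (orderings_nonempty _)]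
  ring

lemma covSN_of_small (h : n < m) : covSN m n = 0 := by
  rw [covSN_eq, meanN_of_small h,
    avg_congr (g := fun _ => 0) fun l hl => by rw [listN_of_small hl h, mul_zero],
    avg_const (orderings_nonempty _)]
  ring

lemma covNN_of_small (h : n < m) : covNN m n = 0 := by
  rw [covNN_eq, meanN_of_small h,
    avg_congr (g := fun _ => 0) fun l hl => by rw [listN_of_small hl h, mul_zero],
    avg_const (orderings_nonempty _)]
  ring

lemma avg_orderings_S (hm : 2 ≤ m) (T : Finset (Fin n)) :
    avg (orderings T) (listS m) = meanS m #T :=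
  avg_orderings T fun _ hg l => (list_stats_map hm hg l).1

lemma avg_orderings_N (hm : 2 ≤ m) (T : Finset (Fin n)) :
    avg (orderings T) (listN m) = meanN m #T :=
  avg_orderings T fun _ hg l => (list_stats_map hm hg l).2

lemma avg_orderings_NS (hm : 2 ≤ m) (T : Finset (Fin n)) :
    avg (orderings T) (fun l => listN m l + listS m l) = meanN m #T + meanS m #T := by
  rw [avg_add, avg_orderings_N hm, avg_orderings_S hm]

lemma avg_orderings_mul (hm : 2 ≤ m) (T : Finset (Fin n)) :
    avg (orderings T) (fun l => listS m l * listS m l)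
        = covSS m #T + meanS m #T * meanS m #T ∧
    avg (orderings T) (fun l => listS m l * listN m l)
        = covSN m #T + meanS m #T * meanN m #T ∧
    avg (orderings T) (fun l => listN m l * listN m l)
        = covNN m #T + meanN m #T * meanN m #T := by
  refine ⟨?_, ?_, ?_⟩
  · rw [avg_orderings T (f' := fun l => listS m l * listS m l)
      fun _ hg l => by rw [(list_stats_map hm hg l).1], covSS_eq]; ring
  · rw [avg_orderings T (f' := fun l => listS m l * listN m l)
      fun _ hg l => by rw [(list_stats_map hm hg l).1, (list_stats_map hm hg l).2], covSN_eq]; ring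
  · rw [avg_orderings T (f' := fun l => listN m l * listN m l)
      fun _ hg l => by rw [(list_stats_map hm hg l).2], covNN_eq]; ring

lemma listS_node_of_mem (hm : 2 ≤ m) (hn : m - 1 ≤ n) {l : List (Fin n)}
    (hl : l ∈ orderings univ) : listS m l = 1 + ∑ i, listS m (subKeys m l i) :=
  listS_node hm (by rw [length_of_mem_orderings hl, card_univ, Fintype.card_fin]; exact hn)

lemma listN_node_of_mem (hm : 2 ≤ m) (hn : m - 1 ≤ n) {l : List (Fin n)}
    (hl : l ∈ orderings univ) :
    listN m l = 0 + ∑ i, (listN m (subKeys m l i) + listS m (subKeys m l i)) := by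
  rw [zero_add]
  exact listN_node hm (by rw [length_of_mem_orderings hl, card_univ, Fintype.card_fin]; exact hn)

/-- The deviation of the conditional mean of `S` given the subtree sizes. -/
noncomputable def devS (m n : ℕ) (I : Fin m → ℕ) : ℝ := 1 + ∑ i, meanS m (I i) - meanS m n

/-- The deviation of the conditional mean of `N` given the subtree sizes. -/
noncomputable def devN (m n : ℕ) (I : Fin m → ℕ) : ℝ :=
  ∑ i, (meanN m (I i) + meanS m (I i)) - meanN m n

/-- For `0 < n < m - 1` the tree is a single node and `expI` vanishes, so the toll `1` of the root
is correct for all nonempty trees. -/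
lemma meanS_rec (hm : 2 ≤ m) (n : ℕ) :
    meanS m n = (if n = 0 then 0 else 1) + expI m n fun I => ∑ i, meanS m (I i) := by
  by_cases hn : m - 1 ≤ n
  · rw [meanS, avg_congr fun l hl => listS_node_of_mem hm hn hl,
      avg_linear (by omega) hn 1 (avg_orderings_S hm), expI_add, card_compositions (by omega) hn,
      if_neg (by omega)]
  · rw [expI_of_lt (by omega), meanS_of_small (by omega), add_zero]

lemma meanN_rec (hm : 2 ≤ m) (n : ℕ) :
    meanN m n = expI m n fun I => ∑ i, (meanN m (I i) + meanS m (I i)) := by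
  by_cases hn : m - 1 ≤ n
  · rw [meanN, avg_congr fun l hl => listN_node_of_mem hm hn hl,
      avg_linear (Mf := fun k => meanN m k + meanS m k) (by omega) hn 0 (avg_orderings_NS hm)]
    simp only [zero_add]
  · rw [expI_of_lt (by omega), meanN_of_small (by omega)]

/-- The total covariance is the mean of the conditional covariance, a sum over independent subtrees,
plus the covariance of the conditional means. The two versions involving `N` have additional terms
because a subtree enters `N` through `N + S`. -/
lemma covSS_rec (hm : 2 ≤ m) (n : ℕ) :
    covSS m n = (expI m n fun I => ∑ i, covSS m (I i)) + expI m n fun I => devS m n I ^ 2 := by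
  by_cases hn : m - 1 ≤ n
  · have h := covariance_split (by omega) hn 1 1 (avg_orderings_S hm) (avg_orderings_S hm)
      (Mfg := fun k => covSS m k + meanS m k * meanS m k) (fun T => (avg_orderings_mul hm T).1)
      (fun l hl => listS_node_of_mem hm hn hl) (fun l hl => listS_node_of_mem hm hn hl)
    rw [covSS_eq]
    refine h.trans ?_
    simp only [add_sub_cancel_right, devS, sq]; rfl
  · rw [expI_of_lt (by omega), expI_of_lt (by omega), covSS_of_small (by omega), add_zero]

lemma covSN_rec (hm : 2 ≤ m) (n : ℕ) :
    covSN m n = (expI m n fun I => ∑ i, (covSN m (I i) + covSS m (I i)))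
      + expI m n fun I => devS m n I * devN m n I := by
  by_cases hn : m - 1 ≤ n
  · have h := covariance_split (by omega) hn 1 0 (avg_orderings_S hm) (avg_orderings_NS hm)
      (Mg := fun k => meanN m k + meanS m k)
      (Mfg := fun k => covSN m k + covSS m k + meanS m k * (meanN m k + meanS m k))
      (fun T => by
        simp only [mul_add]
        rw [avg_add, (avg_orderings_mul hm T).1, (avg_orderings_mul hm T).2.1]; ring)
      (fun l hl => listS_node_of_mem hm hn hl) (fun l hl => listN_node_of_mem hm hn hl)
    rw [covSN_eq]
    refine h.trans ?_
    simp only [add_sub_cancel_right, devS, devN, zero_add]; rfl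
  · rw [expI_of_lt (by omega), expI_of_lt (by omega), covSN_of_small (by omega), add_zero]

lemma covNN_rec (hm : 2 ≤ m) (n : ℕ) :
    covNN m n = (expI m n fun I => ∑ i, (covNN m (I i) + 2 * covSN m (I i) + covSS m (I i)))
      + expI m n fun I => devN m n I ^ 2 := by
  by_cases hn : m - 1 ≤ n
  · have h := covariance_split (by omega) hn 0 0 (avg_orderings_NS hm) (avg_orderings_NS hm)
      (Mf := fun k => meanN m k + meanS m k) (Mg := fun k => meanN m k + meanS m k)
      (Mfg := fun k => covNN m k + 2 * covSN m k + covSS m k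
        + (meanN m k + meanS m k) * (meanN m k + meanS m k))
      (fun T => by
        have e : ∀ l : List (Fin n), (listN m l + listS m l) * (listN m l + listS m l)
            = listN m l * listN m l + (2 * (listS m l * listN m l) + listS m l * listS m l) :=
          fun l => by ring
        simp only [e]
        rw [avg_add, avg_add, avg_const_mul, (avg_orderings_mul hm T).1,
          (avg_orderings_mul hm T).2.1, (avg_orderings_mul hm T).2.2]; ring)
      (fun l hl => listN_node_of_mem hm hn hl) (fun l hl => listN_node_of_mem hm hn hl)
    rw [covNN_eq]
    refine h.trans ?_
    simp only [add_sub_cancel_right, devN, zero_add, sq]; rfl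
  · rw [expI_of_lt (by omega), expI_of_lt (by omega), covNN_of_small (by omega), add_zero]

end Law

/-! ### Location of the zeros of the indicial polynomial -/

section Zeros

variable {m : ℕ}

lemma factorial_eq_prod (hm : 1 ≤ m) : (m.factorial : ℝ) = ∏ j ∈ range (m - 1), ((2 : ℝ) + j) := by
  obtain ⟨k, rfl⟩ : ∃ k, m = k + 1 := ⟨m - 1, by omega⟩
  rw [Nat.add_sub_cancel]
  induction k with
  | zero => simp
  | succ k ih => rw [prod_range_succ, ← ih (by omega), Nat.factorial_succ]; push_cast; ring

lemma indicial_eq_zero_iff {z : ℂ} :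
    indicial m z = 0 ↔ ∏ j ∈ range (m - 1), (z + (j : ℂ)) = m.factorial := by
  rw [indicial, sub_eq_zero]

lemma norm_prod_of_root {z : ℂ} (hz : indicial m z = 0) :
    ∏ j ∈ range (m - 1), ‖z + (j : ℂ)‖ = m.factorial := by
  rw [← norm_prod, indicial_eq_zero_iff.mp hz, Complex.norm_natCast]

lemma norm_add_natCast_sq (z : ℂ) (j : ℕ) : ‖z + (j : ℂ)‖ ^ 2 = (z.re + j) ^ 2 + z.im ^ 2 := by
  rw [Complex.sq_norm, Complex.normSq_apply]
  simp only [Complex.add_re, Complex.add_im, Complex.natCast_re, Complex.natCast_im, add_zero]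
  ring

lemma indicial_conj {z : ℂ} (hz : indicial m z = 0) : indicial m ((starRingEnd ℂ) z) = 0 := by
  rw [indicial_eq_zero_iff] at hz ⊢
  have := congrArg (starRingEnd ℂ) hz
  simpa [map_prod] using this

lemma indicial_two (hm : 1 ≤ m) : indicial m 2 = 0 := by
  rw [indicial_eq_zero_iff]
  have := factorial_eq_prod hm
  have h2 := congrArg Complex.ofReal this
  push_cast at h2
  exact h2.symm

/-- For real part at least `2` each factor has modulus at least `2 + j`, and the product of these
numbers is `m!`; for `z ≠ 2` the factor `j = 0` is strictly larger. -/
lemma re_lt_two_of_root (hm : 2 ≤ m) {z : ℂ} (hz : indicial m z = 0) (h2 : z ≠ 2) : z.re < 2 := by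
  by_contra hcon
  rw [not_lt] at hcon
  have h1 := norm_prod_of_root hz
  rw [factorial_eq_prod (by omega)] at h1
  refine (ne_of_gt (prod_lt_prod (f := fun j : ℕ => (2 : ℝ) + j) (fun j _ => by positivity)
    (fun j _ => ?_) ⟨0, mem_range.mpr (by omega), ?_⟩)) h1
  · refine le_trans ?_ (Complex.re_le_norm _)
    simp; linarith
  · have h3 := norm_add_natCast_sq z 0
    simp only [Nat.cast_zero, add_zero] at h3 ⊢
    have h4 : 4 < ‖z‖ ^ 2 := by
      rw [h3]
      rcases eq_or_ne z.im 0 with him | him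
      · have : z.re ≠ 2 := fun h => h2 (Complex.ext (by simpa using h) (by simpa using him))
        have : 2 < z.re := lt_of_le_of_ne hcon this.symm
        nlinarith [sq_nonneg z.im]
      · have := sq_pos_of_ne_zero him
        nlinarith
    nlinarith [norm_nonneg z]

/-- On a vertical line all the moduli `‖z + j‖` increase strictly with `|z.im|`, so at most one
height is compatible with the modulus `m!`. -/
lemma im_sq_eq_of_re_eq (hm : 2 ≤ m) {z w : ℂ} (hz : indicial m z = 0) (hw : indicial m w = 0)
    (hre : z.re = w.re) (hpos : 0 < z.re) : z.im ^ 2 = w.im ^ 2 := by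
  have key : ∀ z w : ℂ, indicial m z = 0 → indicial m w = 0 → z.re = w.re → 0 < z.re →
      ¬ z.im ^ 2 < w.im ^ 2 := by
    intro z w hz hw hre hpos hlt
    have hj : ∀ j : ℕ, ‖z + (j : ℂ)‖ < ‖w + (j : ℂ)‖ := fun j => by
      refine lt_of_pow_lt_pow_left₀ 2 (norm_nonneg _) ?_
      rw [norm_add_natCast_sq, norm_add_natCast_sq, hre]
      linarith
    refine (prod_lt_prod (s := range (m - 1)) (fun j _ => norm_pos_iff.mpr
      (ne_neg_nat_of_re_pos hpos j)) (fun j _ => (hj j).le)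
      ⟨0, mem_range.mpr (by omega), hj 0⟩).ne ?_
    rw [norm_prod_of_root hz, norm_prod_of_root hw]
  exact le_antisymm (not_lt.mp (key w z hw hz hre.symm (hre ▸ hpos)))
    (not_lt.mp (key z w hz hw hre hpos))

lemma arctan_div_eq_arg {z : ℂ} (hz : 0 < z.re) : Real.arctan (z.im / z.re) = z.arg := by
  refine Real.arctan_eq_of_tan_eq (Complex.tan_arg z) ?_
  have := Complex.abs_arg_lt_pi_div_two_iff.mpr (Or.inl hz)
  exact abs_lt.mp this

/-- The sum of the arguments of `z, z + 1, …, z + (k - 1)` for `z = x + i y` with `x > 0`. -/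
noncomputable def argSum (k : ℕ) (x y : ℝ) : ℝ := ∑ j ∈ range k, Real.arctan (y / (x + j))

lemma prod_eq_norm_mul_exp (k : ℕ) {z : ℂ} (hz : 0 < z.re) :
    ∏ j ∈ range k, (z + (j : ℂ)) =
      ((∏ j ∈ range k, ‖z + (j : ℂ)‖ : ℝ) : ℂ) *
        Complex.exp ((argSum k z.re z.im : ℝ) * Complex.I) := by
  rw [argSum, Complex.ofReal_sum, sum_mul, Complex.exp_sum, Complex.ofReal_prod, ← prod_mul_distrib]
  refine prod_congr rfl fun j _ => ?_
  have h : 0 < (z + (j : ℂ)).re := by simp; positivity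
  have h2 := arctan_div_eq_arg h
  simp only [Complex.add_re, Complex.add_im, Complex.natCast_re, Complex.natCast_im,
    add_zero] at h2
  rw [h2, Complex.norm_mul_exp_arg_mul_I]

/-- The height `11 / 4` on the line `Re z = 1` separates `m = 13` from `m = 14`, with `12` and `13`
factors. The tangent addition formula evaluates the partial sums exactly: two passages beyond `π /
2` contribute `2 π`, and the remaining arctangent is negative after `12` terms and positive after
`13`. -/
lemma argSum_twelve : argSum 12 1 (11 / 4) < 2 * Real.pi ∧ 2 * Real.pi < argSum 13 1 (11 / 4) := by
  have e : argSum 12 1 (11 / 4) = Real.arctan (11 / 4) + Real.arctan (11 / 8)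
      + Real.arctan (11 / 12) + Real.arctan (11 / 16) + Real.arctan (11 / 20)
      + Real.arctan (11 / 24) + Real.arctan (11 / 28) + Real.arctan (11 / 32)
      + Real.arctan (11 / 36) + Real.arctan (11 / 40) + Real.arctan (11 / 44)
      + Real.arctan (11 / 48) := by
    simp only [argSum, sum_range_succ, range_zero, sum_empty]
    norm_num
  have e' : argSum 13 1 (11 / 4) = argSum 12 1 (11 / 4) + Real.arctan (11 / 52) := by
    rw [argSum, sum_range_succ, argSum]
    norm_num
  have a2 := Real.arctan_add_eq_add_pi (x := (11 / 4)) (y := (11 / 8)) (by norm_num) (by norm_num)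
  rw [show ((11 / 4) + (11 / 8) : ℝ) / (1 - (11 / 4) * (11 / 8)) = (-132 / 89) by norm_num] at a2
  have a3 := Real.arctan_add (x := (-132 / 89)) (y := (11 / 12)) (by norm_num)
  rw [show ((-132 / 89) + (11 / 12) : ℝ) / (1 - (-132 / 89) * (11 / 12))
      = (-121 / 504) by norm_num] at a3
  have a4 := Real.arctan_add (x := (-121 / 504)) (y := (11 / 16)) (by norm_num)
  rw [show ((-121 / 504) + (11 / 16) : ℝ) / (1 - (-121 / 504) * (11 / 16))
      = (3608 / 9395) by norm_num] at a4
  have a5 := Real.arctan_add (x := (3608 / 9395)) (y := (11 / 20)) (by norm_num)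
  rw [show ((3608 / 9395) + (11 / 20) : ℝ) / (1 - (3608 / 9395) * (11 / 20))
      = (175505 / 148212) by norm_num] at a5
  have a6 := Real.arctan_add (x := (175505 / 148212)) (y := (11 / 24)) (by norm_num)
  rw [show ((175505 / 148212) + (11 / 24) : ℝ) / (1 - (175505 / 148212) * (11 / 24))
      = (5842452 / 1626533) by norm_num] at a6
  have a7 := Real.arctan_add_eq_add_pi (x := (5842452 / 1626533)) (y := (11 / 28))
    (by norm_num) (by norm_num)
  rw [show ((5842452 / 1626533) + (11 / 28) : ℝ) / (1 - (5842452 / 1626533) * (11 / 28))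
      = (-181480519 / 18724048) by norm_num] at a7
  have a8 := Real.arctan_add (x := (-181480519 / 18724048)) (y := (11 / 32)) (by norm_num)
  rw [show ((-181480519 / 18724048) + (11 / 32) : ℝ) / (1 - (-181480519 / 18724048) * (11 / 32))
      = (-1120282416 / 519091049) by norm_num] at a8
  have a9 := Real.arctan_add (x := (-1120282416 / 519091049)) (y := (11 / 36)) (by norm_num)
  rw [show ((-1120282416 / 519091049) + (11 / 36) : ℝ) / (1 - (-1120282416 / 519091049) * (11 / 36))
      = (-2663089649 / 2385414180) by norm_num] at a9
  have a10 := Real.arctan_add (x := (-2663089649 / 2385414180)) (y := (11 / 40)) (by norm_num)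
  rw [show ((-2663089649 / 2385414180) + (11 / 40) : ℝ) / (1 - (-2663089649 / 2385414180) * (11 / 40))
      = (-80284029980 / 124710553339) by norm_num] at a10
  have a11 := Real.arctan_add (x := (-80284029980 / 124710553339)) (y := (1 / 4)) (by norm_num)
  rw [show ((-80284029980 / 124710553339) + (1 / 4) : ℝ) / (1 - (-80284029980 / 124710553339) * (1 / 4))
      = (-11554445093 / 34066249608) by norm_num] at a11
  have a12 := Real.arctan_add (x := (-11554445093 / 34066249608)) (y := (11 / 48)) (by norm_num)
  rw [show ((-11554445093 / 34066249608) + (11 / 48) : ℝ) / (1 - (-11554445093 / 34066249608) * (11 / 48))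
      = (-179884618776 / 1762278877207) by norm_num] at a12
  have a13 := Real.arctan_add (x := (-179884618776 / 1762278877207)) (y := (11 / 52)) (by norm_num)
  rw [show ((-179884618776 / 1762278877207) + (11 / 52) : ℝ) / (1 - (-179884618776 / 1762278877207) * (11 / 52))
      = (401242698917 / 3744689296852) by norm_num] at a13
  have n12 : Real.arctan (-179884618776 / 1762278877207) < 0 := Real.arctan_lt_zero.mpr (by norm_num)
  have p13 : 0 < Real.arctan (401242698917 / 3744689296852) := Real.arctan_pos.mpr (by norm_num)
  constructor <;> linarith

lemma argSum_mono_right {k : ℕ} {x y y' : ℝ} (hx : 0 < x) (h : y ≤ y') :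
    argSum k x y ≤ argSum k x y' :=
  sum_le_sum fun j _ => Real.arctan_mono (by gcongr)

lemma argSum_anti_left {k : ℕ} {x x' y : ℝ} (hx : 0 < x) (h : x ≤ x') (hy : 0 ≤ y) :
    argSum k x' y ≤ argSum k x y :=
  sum_le_sum fun j _ => Real.arctan_mono (by gcongr)

lemma argSum_mono_nat {k k' : ℕ} {x y : ℝ} (hx : 0 < x) (hy : 0 ≤ y) (h : k ≤ k') :
    argSum k x y ≤ argSum k' x y :=
  sum_le_sum_of_subset_of_nonneg (range_mono h) fun j _ _ =>
    Real.arctan_nonneg.mpr (by positivity)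

/-- A real zero in `(0, 2)` would make the product smaller than `m!`. -/
lemma im_ne_zero_of_root (hm : 2 ≤ m) {z : ℂ} (hz : indicial m z = 0) (h2 : z ≠ 2)
    (hpos : 0 < z.re) : z.im ≠ 0 := by
  intro him
  have h := im_sq_eq_of_re_eq (z := z) (w := z) hm hz hz rfl hpos
  have hlt := re_lt_two_of_root hm hz h2
  have h1 := norm_prod_of_root hz
  rw [factorial_eq_prod (by omega)] at h1
  refine (ne_of_lt (prod_lt_prod (g := fun j : ℕ => (2 : ℝ) + j)
    (fun j _ => norm_pos_iff.mpr (ne_neg_nat_of_re_pos hpos j)) ?_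
    ⟨0, mem_range.mpr (by omega), ?_⟩)) h1
  all_goals
    have hj : ∀ j : ℕ, ‖z + (j : ℂ)‖ = z.re + j := fun j => by
      have : z + (j : ℂ) = ((z.re + j : ℝ) : ℂ) := Complex.ext (by simp) (by simp [him])
      rw [this, Complex.norm_real, Real.norm_of_nonneg (by positivity)]
  · intro j _
    rw [hj]; linarith
  · rw [hj]; linarith

/-- For `m ≤ 13` all zeros of the indicial polynomial other than `2` have real part below `1`. -/
lemma re_lt_one_of_root (hm : 3 ≤ m) (hm' : m ≤ 13) {z : ℂ} (hz : indicial m z = 0) (h2 : z ≠ 2) :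
    z.re < 1 := by
  have key : ∀ z : ℂ, indicial m z = 0 → 1 ≤ z.re → ¬ 0 < z.im := by
    intro z hz h1 him
    have hzpos : 0 < z.re := by linarith
    -- At real part at least `1` and height at least `11 / 4` the modulus of the product exceeds
    -- `m!`, as checked for each `m ≤ 13`.
    have hy : z.im < 11 / 4 := by
      by_contra hcon
      rw [not_lt] at hcon
      have h3 : ∏ j ∈ range (m - 1), (((1 : ℝ) + j) ^ 2 + (11 / 4) ^ 2)
          ≤ (m.factorial : ℝ) ^ 2 := by
        rw [← norm_prod_of_root hz, ← prod_pow]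
        refine prod_le_prod (fun j _ => by positivity) fun j _ => ?_
        rw [norm_add_natCast_sq]
        gcongr
      interval_cases m <;> norm_num [prod_range_succ, Nat.factorial_succ] at h3
    -- The total argument lies strictly between `0` and `2 π`, so the product cannot be the positive
    -- real number `m!`.
    have h4 : argSum (m - 1) z.re z.im < 2 * Real.pi :=
      calc argSum (m - 1) z.re z.im ≤ argSum (m - 1) 1 z.im :=
            argSum_anti_left one_pos h1 him.le
        _ ≤ argSum (m - 1) 1 (11 / 4) := argSum_mono_right one_pos hy.le
        _ ≤ argSum 12 1 (11 / 4) := argSum_mono_nat one_pos (by norm_num) (by omega)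
        _ < 2 * Real.pi := argSum_twelve.1
    have h5 : 0 < argSum (m - 1) z.re z.im :=
      sum_pos (fun j _ => Real.arctan_pos.mpr (by positivity)) ⟨0, mem_range.mpr (by omega)⟩
    have h6 := prod_eq_norm_mul_exp (m - 1) hzpos
    rw [norm_prod_of_root hz, indicial_eq_zero_iff.mp hz] at h6
    have hf : (m.factorial : ℂ) ≠ 0 := by exact_mod_cast m.factorial_ne_zero
    have h7 : Complex.exp ((argSum (m - 1) z.re z.im : ℝ) * Complex.I) = 1 := by
      push_cast at h6
      exact mul_left_cancel₀ hf (by rw [mul_one]; exact h6.symm)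
    obtain ⟨k, hk⟩ := Complex.exp_eq_one_iff.mp h7
    have h8 : argSum (m - 1) z.re z.im = k * (2 * Real.pi) := by
      have := congrArg Complex.im hk
      simpa using this
    rw [h8] at h4 h5
    have hpi := Real.pi_pos
    have hk1 : (0 : ℝ) < k := pos_of_mul_pos_left h5 (by positivity)
    have hk2 : (k : ℝ) < 1 := by
      by_contra hc
      rw [not_lt] at hc
      nlinarith
    have hk1' : 0 < k := by exact_mod_cast hk1
    have hk2' : k < 1 := by exact_mod_cast hk2
    omega
  by_contra hcon
  rw [not_lt] at hcon
  rcases lt_trichotomy z.im 0 with h | h | h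
  · exact key _ (indicial_conj hz) (by simpa using hcon) (by simpa using h)
  · exact im_ne_zero_of_root (by omega) hz h2 (by linarith) h
  · exact key z hz hcon h

/-- Thus for `m ≥ 14` the point of the line `Re z = 1` in the upper half plane where the modulus is
`m!` has height at least `11 / 4`. After the base case, each new factor is at most the square of the
new factor of the factorial. -/
lemma prod_sq_le (hm : 14 ≤ m) :
    ∏ j ∈ range (m - 1), (((1 : ℝ) + j) ^ 2 + (11 / 4) ^ 2) ≤ (m.factorial : ℝ) ^ 2 := by
  induction m, hm using Nat.le_induction with
  | base => norm_num [prod_range_succ, Nat.factorial_succ]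
  | succ m hm ih =>
    obtain ⟨k, rfl⟩ : ∃ k, m = k + 1 := ⟨m - 1, by omega⟩
    simp only [Nat.add_sub_cancel] at ih ⊢
    rw [prod_range_succ, Nat.factorial_succ]
    have hk : (13 : ℝ) ≤ k := by exact_mod_cast (by omega : 13 ≤ k)
    push_cast
    rw [mul_pow, mul_comm]
    refine mul_le_mul ?_ ih (prod_nonneg fun j _ => by positivity) (by positivity)
    nlinarith

/-- For `m ≥ 14` the indicial polynomial has a zero with real part above `1`, other than `2`. -/
lemma exists_root_re_gt_one (hm : 14 ≤ m) : ∃ z : ℂ, indicial m z = 0 ∧ 1 < z.re ∧ 0 < z.im := by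
  set M : ℝ := (m.factorial : ℝ) with hM
  have hM1 : 1 ≤ M := by rw [hM]; exact_mod_cast m.factorial_pos
  set G : ℝ × ℝ → ℝ := fun p => ∏ j ∈ range (m - 1), ((p.1 + j) ^ 2 + p.2 ^ 2) with hG
  have hGc : Continuous G := by fun_prop
  -- `K` is the arc over `1 ≤ Re z ≤ 2` where the modulus equals `m!`. Projection to the real part
  -- is a homeomorphism onto `[1, 2]`, so the argument is continuous along a connected arc. It
  -- exceeds `2 π` over `1` and vanishes at `2`; where it equals `2 π` there is a zero.
  set K : Set (ℝ × ℝ) := (Set.Icc 1 2 ×ˢ Set.Icc 0 M) ∩ G ⁻¹' {M ^ 2} with hK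
  have hKc : IsCompact K :=
    (isCompact_Icc.prod isCompact_Icc).inter_right (isClosed_singleton.preimage hGc)
  have hmono : ∀ x y y' : ℝ, 0 < x → 0 ≤ y → y < y' → G (x, y) < G (x, y') := by
    intro x y y' hx hy hlt
    refine prod_lt_prod (fun j _ => by positivity) (fun j _ => ?_)
      ⟨0, mem_range.mpr (by omega), ?_⟩
    · simp only; gcongr
    · simp only; gcongr
  have hG2 : G (2, 0) = M ^ 2 := by
    rw [hM, factorial_eq_prod (by omega), ← prod_pow]
    simp [hG]
  have hex : ∀ x ∈ Set.Icc (1 : ℝ) 2, ∃ y ∈ Set.Icc 0 M, G (x, y) = M ^ 2 := by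
    intro x hx
    have h0 : G (x, 0) ≤ M ^ 2 := by
      rw [← hG2]
      refine prod_le_prod (fun j _ => by positivity) fun j _ => ?_
      have := hx.1
      have := hx.2
      simp only; gcongr
    have h1 : M ^ 2 ≤ G (x, M) := by
      have h2 : ∏ j ∈ range (m - 1), (if j = 0 then M ^ 2 else 1) ≤ G (x, M) := by
        refine prod_le_prod (fun j _ => by positivity) fun j _ => ?_
        have h3 : (0 : ℝ) ≤ j := j.cast_nonneg
        split_ifs
        · simp only; nlinarith [sq_nonneg (x + j)]
        · have := hx.1
          simp only; nlinarith [sq_nonneg M]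
      rw [prod_ite_eq' (range (m - 1)) 0 fun _ => M ^ 2, if_pos (mem_range.mpr (by omega))] at h2
      exact h2
    have hc : ContinuousOn (fun y => G (x, y)) (Set.Icc 0 M) :=
      (hGc.comp (by fun_prop)).continuousOn
    obtain ⟨y, hy, hy'⟩ := intermediate_value_Icc (by linarith) hc ⟨h0, h1⟩
    exact ⟨y, hy, hy'⟩
  let f : K → Set.Icc (1 : ℝ) 2 := fun p => ⟨p.1.1, p.2.1.1⟩
  have hfb : Function.Bijective f := by
    constructor
    · rintro ⟨⟨x, y⟩, hp⟩ ⟨⟨x', y'⟩, hp'⟩ h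
      have hx : x = x' := congrArg Subtype.val h
      subst hx
      have hxpos : 0 < x := by linarith [hp.1.1.1]
      have e : G (x, y) = G (x, y') := hp.2.trans hp'.2.symm
      rcases lt_trichotomy y y' with h | h | h
      · exact absurd e (hmono x y y' hxpos hp.1.2.1 h).ne
      · subst h; rfl
      · exact absurd e (hmono x y' y hxpos hp'.1.2.1 h).ne'
    · rintro ⟨x, hx⟩
      obtain ⟨y, hy, hy'⟩ := hex x hx
      exact ⟨⟨(x, y), ⟨hx, hy⟩, hy'⟩, rfl⟩
  have hfc : Continuous f := by fun_prop
  have : CompactSpace K := isCompact_iff_compactSpace.mp hKc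
  let h := Continuous.homeoOfEquivCompactToT2 (f := Equiv.ofBijective f hfb) hfc
  let θ : K → ℝ := fun p => argSum (m - 1) p.1.1 p.1.2
  have hθc : Continuous θ := by
    refine continuous_finsetSum _ fun j _ => Real.continuous_arctan.comp ?_
    refine Continuous.div (by fun_prop) (by fun_prop) fun p => ?_
    have := p.2.1.1.1
    positivity
  have : PreconnectedSpace (Set.Icc (1 : ℝ) 2) :=
    Subtype.preconnectedSpace isPreconnected_Icc
  obtain ⟨y₁, hy₁, hGy₁⟩ := hex 1 (by norm_num)
  let p₁ : K := ⟨(1, y₁), ⟨by norm_num, hy₁⟩, hGy₁⟩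
  let p₂ : K := ⟨(2, 0), ⟨by norm_num, by simp [hM]⟩, hG2⟩
  have hy₁' : 11 / 4 ≤ y₁ := by
    by_contra hcon
    have h1 := hmono 1 y₁ (11 / 4) one_pos hy₁.1 (not_le.mp hcon)
    have h2 : G (1, 11 / 4) ≤ M ^ 2 := prod_sq_le hm
    linarith
  have hθ₁ : 2 * Real.pi < θ p₁ :=
    calc 2 * Real.pi < argSum 13 1 (11 / 4) := argSum_twelve.2
      _ ≤ argSum (m - 1) 1 (11 / 4) := argSum_mono_nat one_pos (by norm_num) (by omega)
      _ ≤ θ p₁ := argSum_mono_right one_pos hy₁'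
  have hθ₂ : θ p₂ = 0 := by simp [θ, p₂, argSum]
  obtain ⟨x, hx⟩ := mem_range_of_exists_le_of_exists_ge (c := 2 * Real.pi)
    (hθc.comp h.symm.continuous)
    ⟨h p₂, by simp only [Function.comp_apply, Homeomorph.symm_apply_apply, hθ₂]; positivity⟩
    ⟨h p₁, by simp only [Function.comp_apply, Homeomorph.symm_apply_apply]; exact hθ₁.le⟩
  obtain ⟨⟨⟨u, v⟩, ⟨hu, hv⟩, hGuv⟩, hp⟩ : ∃ p : K, θ p = 2 * Real.pi := ⟨h.symm x, hx⟩
  have hθuv : argSum (m - 1) u v = 2 * Real.pi := hp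
  have hu0 : 0 < u := by linarith [hu.1]
  refine ⟨⟨u, v⟩, ?_, ?_, ?_⟩
  · rw [indicial_eq_zero_iff, prod_eq_norm_mul_exp (m - 1) hu0]
    simp only
    rw [hθuv]
    have h1 : ∏ j ∈ range (m - 1), ‖(⟨u, v⟩ : ℂ) + (j : ℂ)‖ = M := by
      rw [← pow_left_inj₀ (prod_nonneg fun j _ => norm_nonneg _) (by linarith) two_ne_zero,
        ← prod_pow, ← show G (u, v) = M ^ 2 from hGuv]
      exact prod_congr rfl fun j _ => norm_add_natCast_sq _ j
    rw [h1]
    have h2 : Complex.exp (((2 * Real.pi : ℝ) : ℂ) * Complex.I) = 1 := by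
      push_cast; exact Complex.exp_two_pi_mul_I
    rw [h2, mul_one, hM]; simp
  -- Over real part `1` the arc has a single point, and its argument exceeds `2 π`.
  · refine lt_of_le_of_ne hu.1 fun h1 => ?_
    simp only at h1
    subst h1
    have h2 : y₁ = v := by
      have e : G (1, y₁) = G (1, v) := hGy₁.trans hGuv.symm
      rcases lt_trichotomy y₁ v with h | h | h
      · exact absurd e (hmono 1 y₁ v one_pos hy₁.1 h).ne
      · exact h
      · exact absurd e (hmono 1 v y₁ one_pos hv.1 h).ne'
    subst h2
    exact hθ₁.ne' hθuv
  · refine lt_of_le_of_ne hv.1 fun h1 => ?_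
    simp only at h1
    subst h1
    have : argSum (m - 1) u 0 = 0 := by simp [argSum]
    rw [this] at hθuv
    have := Real.pi_pos
    linarith

end Zeros

/-! ### The indicial polynomial, its cofactors and its action on `opT` -/

section IndicialPolynomial

open Polynomial

variable {m : ℕ}

lemma eval_ascPochhammer (k : ℕ) (z : ℂ) :
    (ascPochhammer ℂ k).eval z = ∏ j ∈ range k, (z + (j : ℂ)) := by
  induction k with
  | zero => simp
  | succ k ih => rw [ascPochhammer_succ_eval, prod_range_succ, ih]

lemma prod_eq_factorial_mul_ecoef (k : ℕ) (z : ℂ) :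
    ∏ j ∈ range k, (z + (j : ℂ)) = k.factorial * ecoef z k := by
  rw [ecoef, prod_div_distrib, ← prod_range_add_one_eq_factorial]
  push_cast
  rw [mul_div_cancel₀]
  exact prod_ne_zero_iff.mpr fun j _ => Nat.cast_add_one_ne_zero j

lemma factorial_eq_mul (hm : 1 ≤ m) : (m.factorial : ℂ) = m * (m - 1).factorial := by
  rw [← Nat.mul_factorial_pred (by omega : m ≠ 0)]; push_cast; rfl

/-- The indicial polynomial. -/
noncomputable def charPoly (m : ℕ) : ℂ[X] := ascPochhammer ℂ (m - 1) - C (m.factorial : ℂ)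

lemma eval_charPoly (z : ℂ) : (charPoly m).eval z = indicial m z := by
  simp [charPoly, eval_ascPochhammer, indicial]

lemma indicial_eq (hm : 1 ≤ m) (z : ℂ) :
    indicial m z = (m - 1).factorial * (ecoef z (m - 1) - m) := by
  rw [indicial, prod_eq_factorial_mul_ecoef, factorial_eq_mul hm]; ring

lemma indicial_zero (hm : 2 ≤ m) : indicial m 0 = -m.factorial := by
  obtain ⟨k, rfl⟩ : ∃ k, m = k + 2 := ⟨m - 2, by omega⟩
  simp [indicial, prod_range_succ']

lemma indicial_one (hm : 1 ≤ m) : indicial m 1 = -((m - 1 : ℂ) * (m - 1).factorial) := by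
  rw [indicial_eq hm, ecoef_one]; ring

lemma charPoly_ne_zero (hm : 2 ≤ m) : charPoly m ≠ 0 := by
  intro h
  have := indicial_zero hm
  rw [← eval_charPoly, h, eval_zero, eq_comm, neg_eq_zero] at this
  exact m.factorial_ne_zero (by exact_mod_cast this)

lemma natDegree_charPoly : (charPoly m).natDegree = m - 1 := by
  rw [charPoly, natDegree_sub_C, ascPochhammer_natDegree]

lemma isRoot_charPoly {z : ℂ} : (charPoly m).IsRoot z ↔ indicial m z = 0 := by
  rw [IsRoot.def, eval_charPoly]

lemma finite_roots (hm : 2 ≤ m) : {z : ℂ | indicial m z = 0}.Finite := by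
  refine ((charPoly m).roots.toFinset.finite_toSet).subset fun z hz => ?_
  have : eval z (charPoly m) = 0 := by rw [eval_charPoly]; exact hz
  simp [charPoly_ne_zero hm, this]

/-- There are finitely many zeros, so the real parts below `b` stay away from `b`. -/
lemma exists_re_bound (hm : 2 ≤ m) {l b : ℝ} (h : l < b) :
    ∃ σ, l < σ ∧ σ < b ∧ ∀ w : ℂ, indicial m w = 0 → w.re < b → w.re < σ := by
  have h1 : ∀ᶠ σ in 𝓝[<] b, ∀ w ∈ {z : ℂ | indicial m z = 0}, w.re < b → w.re < σ := by
    rw [eventually_all_finite (finite_roots hm)]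
    intro w _
    by_cases hw : w.re < b
    · filter_upwards [Ioo_mem_nhdsLT hw] with σ hσ _ using hσ.1
    · exact Eventually.of_forall fun σ h => absurd h hw
  obtain ⟨σ, hσ, h2⟩ := ((eventually_mem_set.mpr (Ioo_mem_nhdsLT h)).and h1).exists
  exact ⟨σ, hσ.1, hσ.2, h2⟩

/-- The indicial polynomial divided by a linear factor. -/
noncomputable def cofactor (m : ℕ) (w : ℂ) : ℂ[X] := charPoly m /ₘ (X - C w)

lemma X_sub_C_mul_cofactor {w : ℂ} (hw : indicial m w = 0) :
    (X - C w) * cofactor m w = charPoly m :=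
  mul_divByMonic_eq_iff_isRoot.mpr (isRoot_charPoly.mpr hw)

lemma natDegree_cofactor (w : ℂ) : (cofactor m w).natDegree = m - 2 := by
  rw [cofactor, natDegree_divByMonic _ (monic_X_sub_C w), natDegree_charPoly, natDegree_X_sub_C]
  omega

lemma eval_cofactor_mul {w : ℂ} (hw : indicial m w = 0) (z : ℂ) :
    (z - w) * (cofactor m w).eval z = indicial m z := by
  rw [← eval_charPoly, ← X_sub_C_mul_cofactor hw]; simp

/-- The value is the derivative of `Λ` at its zero, that is, the product `m!` times the logarithmic
derivative of the product. -/
lemma eval_cofactor_self {w : ℂ} (hw : indicial m w = 0) (hpos : 0 < w.re) :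
    (cofactor m w).eval w = m.factorial * ∑ j ∈ range (m - 1), 1 / ((j : ℂ) + w) := by
  have h1 : (cofactor m w).eval w = (derivative (charPoly m)).eval w := by
    rw [← X_sub_C_mul_cofactor hw]; simp [derivative_mul]
  have h2 : charPoly m = ∏ j ∈ range (m - 1), (X + C (j : ℂ)) - C (m.factorial : ℂ) := by
    refine Polynomial.funext fun z => ?_
    rw [eval_charPoly, indicial]; simp [eval_prod]
  rw [h1, h2, derivative_sub, derivative_C, sub_zero, derivative_prod_finset, eval_finsetSum,
    mul_sum]
  refine sum_congr rfl fun j hj => ?_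
  have hj0 : w + (j : ℂ) ≠ 0 := ne_neg_nat_of_re_pos hpos j
  rw [← indicial_eq_zero_iff.mp hw, ← mul_prod_erase _ _ hj]
  simp only [eval_prod, eval_add, eval_X, eval_C, derivative_add, derivative_X,
    derivative_C, add_zero, mul_one]
  rw [add_comm (j : ℂ)]; field_simp

lemma sum_inv_ne_zero (hm : 2 ≤ m) {w : ℂ} (hpos : 0 < w.re) :
    ∑ j ∈ range (m - 1), 1 / ((j : ℂ) + w) ≠ 0 := by
  intro h
  have h1 := congrArg Complex.re h
  rw [Complex.re_sum, Complex.zero_re] at h1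
  refine (sum_pos (fun j _ => ?_) ⟨0, mem_range.mpr (by omega)⟩).ne' h1
  have hz : 0 < ((j : ℂ) + w).re := by simp; positivity
  rw [one_div, Complex.inv_re]
  exact div_pos hz (Complex.normSq_pos.mpr fun h => by simp [h] at hz)

lemma eval_cofactor_ne_zero (hm : 2 ≤ m) {w : ℂ} (hw : indicial m w = 0) (hpos : 0 < w.re) :
    (cofactor m w).eval w ≠ 0 := by
  rw [eval_cofactor_self hw hpos]
  exact mul_ne_zero (by exact_mod_cast m.factorial_ne_zero) (sum_inv_ne_zero hm hpos)

lemma cofactor_ne_zero (hm : 2 ≤ m) {w : ℂ} (hw : indicial m w = 0) : cofactor m w ≠ 0 :=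
  right_ne_zero_of_mul (by rw [X_sub_C_mul_cofactor hw]; exact charPoly_ne_zero hm)

lemma root_of_isRoot_cofactor (hm : 2 ≤ m) {w z : ℂ} (hw : indicial m w = 0) (hpos : 0 < w.re)
    (hz : (cofactor m w).IsRoot z) : indicial m z = 0 ∧ z ≠ w := by
  refine ⟨?_, ?_⟩
  · rw [← eval_cofactor_mul hw, hz.eq_zero, mul_zero]
  · rintro rfl
    exact eval_cofactor_ne_zero hm hw hpos hz

lemma H_sub_one (hm : 1 ≤ m) : H m - 1 = ∑ j ∈ range (m - 1), 1 / ((j : ℝ) + 2) := by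
  obtain ⟨k, rfl⟩ : ∃ k, m = k + 1 := ⟨m - 1, by omega⟩
  rw [Nat.add_sub_cancel, H]
  induction k with
  | zero => simp
  | succ k ih =>
    have := ih (by omega)
    rw [sum_Icc_succ_top (by omega), sum_range_succ, ← this]
    push_cast
    rw [show (k : ℝ) + 1 + 1 = k + 2 by ring]; ring

lemma H_sub_one_pos (hm : 2 ≤ m) : 0 < H m - 1 := by
  rw [H_sub_one (by omega)]
  exact sum_pos (fun j _ => by positivity) ⟨0, mem_range.mpr (by omega)⟩

lemma phi_pos (hm : 2 ≤ m) : 0 < phi m := by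
  have := H_sub_one_pos hm
  rw [phi]; positivity

lemma sum_inv_two (hm : 2 ≤ m) :
    ∑ j ∈ range (m - 1), 1 / ((j : ℂ) + 2) = 1 / (2 * (phi m : ℂ)) := by
  have h := H_sub_one_pos hm
  have h1 : H m - 1 = 1 / (2 * phi m) := by rw [phi]; field_simp
  rw [H_sub_one (by omega)] at h1
  have := congrArg Complex.ofReal h1
  push_cast at this
  exact this

lemma coeffA_two (hm : 2 ≤ m) : coeffA m 2 = phi m := by
  rw [coeffA, sum_inv_two hm]
  have : (phi m : ℂ) ≠ 0 := by exact_mod_cast (phi_pos hm).ne'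
  field_simp; norm_num

lemma eval_cofactor_two (hm : 2 ≤ m) : (cofactor m 2).eval 2 = m.factorial / (2 * (phi m : ℂ)) := by
  rw [eval_cofactor_self (indicial_two (by omega)) (by simp), sum_inv_two hm]; ring

lemma aeval_charPoly_opT (hm : 1 ≤ m) (a : ℕ → ℂ) :
    aeval theta (charPoly m) (opT m a) = (m.factorial : ℂ) • (a - opT m a) := by
  rw [charPoly, map_sub, LinearMap.sub_apply, aeval_ascPochhammer_opT hm, aeval_C,
    Module.algebraMap_end_apply, smul_sub]

/-- At index `0` the power `theta ^ j` reads only the entries up to index `j`. -/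
lemma aeval_theta_apply_zero {d : ℕ → ℂ} {k : ℕ} (hd : ∀ n ≤ k, d n = 0) (R : ℂ[X])
    (hR : R.natDegree ≤ k) : aeval theta R d 0 = 0 := by
  have h : ∀ j n, n + j ≤ k → (theta ^ j) d n = 0 := by
    intro j
    induction j with
    | zero => intro n hn; exact hd n hn
    | succ j ih =>
      intro n hn
      rw [pow_succ', Module.End.mul_apply, theta_apply, ih _ (by omega), ih _ (by omega)]; ring
  rw [aeval_eq_sum_range, LinearMap.sum_apply, Finset.sum_apply]
  refine sum_eq_zero fun j hj => ?_
  rw [LinearMap.smul_apply, Pi.smul_apply, h j 0 (by have := mem_range.mp hj; omega), smul_zero]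

end IndicialPolynomial

/-! ### Expansions of the means -/

section Means

open Polynomial

variable {m : ℕ}

/-- A real sequence as a complex sequence. -/
abbrev toC (a : ℕ → ℝ) : ℕ → ℂ := fun n => (a n : ℂ)

lemma opT_toC (a : ℕ → ℝ) (n : ℕ) :
    opT m (toC a) n = ((expI m n fun I => ∑ i, a (I i) : ℝ) : ℂ) := by
  rw [opT_apply, expI_ofReal]; simp

lemma ecoef_zero_left (n : ℕ) : ecoef (0 : ℂ) n = if n = 0 then 1 else 0 := by
  cases n with
  | zero => simp
  | succ n => simp [ecoef, prod_range_succ']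

lemma opT_meanS (hm : 2 ≤ m) :
    opT m (toC (meanS m)) = toC (meanS m) - ecoef 1 + ecoef 0 := by
  ext n
  simp only [Pi.add_apply, Pi.sub_apply]
  rw [opT_toC, ecoef_one, ecoef_zero_left, toC, meanS_rec hm n]
  split_ifs <;> push_cast <;> ring

/-- Since `meanN` is `opT` of `meanN + meanS`, the argument of `opT` minus its image is `meanS`. -/
lemma aeval_meanN (hm : 2 ≤ m) :
    aeval theta (charPoly m) (toC (meanN m)) = (m.factorial : ℂ) • toC (meanS m) := by
  have h : toC (meanN m) = opT m (toC (meanN m) + toC (meanS m)) := by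
    ext n
    have : toC (meanN m) + toC (meanS m) = toC (meanN m + meanS m) := by ext; simp [toC]
    rw [this, opT_toC, toC, meanN_rec hm n]; rfl
  conv_lhs => rw [h]
  rw [aeval_charPoly_opT (by omega), ← h, add_sub_cancel_left]

lemma eq_zero_of_theta {w : ℂ} {f : ℕ → ℂ} (h : theta f = w • f) (h0 : f 0 = 0) : f = 0 :=
  theta_ext (s := w) (by simpa using h0) (by simp [h])

/-- The expansion of the mean of `S` along a set of zeros of the indicial polynomial. -/
lemma meanS_expansion (hm : 2 ≤ m) {σ : ℝ} (hσ : 0 < σ) (Z : Finset ℂ)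
    (hZ : ∀ w ∈ Z, indicial m w = 0 ∧ 0 < w.re)
    (hroot : ∀ w, indicial m w = 0 → w ∉ Z → w.re < σ) :
    (toC (meanS m) + (1 / ((m : ℂ) - 1)) • ecoef 1 - ∑ w ∈ Z, coeffA m w • ecoef w)
      =O[atTop] (ecoef σ) := by
  have hm1 : (m : ℂ) - 1 ≠ 0 := by
    rw [sub_ne_zero]; exact_mod_cast (by omega : m ≠ 1)
  have hmf : (m.factorial : ℂ) ≠ 0 := by exact_mod_cast m.factorial_ne_zero
  -- A solution of the inhomogeneous equation: the first two coefficients come from dividing by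
  -- `Λ(1)` and `Λ(0)`, and the remaining terms are the homogeneous modes.
  set p : ℕ → ℂ := (-(m / ((m : ℂ) - 1))) • ecoef 1 + ecoef 0 + ∑ w ∈ Z, coeffA m w • ecoef w
    with hp
  have hr : toC (meanS m) + (1 / ((m : ℂ) - 1)) • ecoef 1 - ∑ w ∈ Z, coeffA m w • ecoef w
      = opT m (toC (meanS m)) - p := by
    rw [opT_meanS hm, hp]
    ext n
    simp only [Pi.add_apply, Pi.sub_apply, Pi.smul_apply, smul_eq_mul]
    field_simp; ring
  have hap : ∀ R : ℂ[X], aeval theta R p = (-(m / ((m : ℂ) - 1)) * R.eval 1) • ecoef 1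
      + R.eval 0 • ecoef 0 + ∑ w ∈ Z, (coeffA m w * R.eval w) • ecoef w := by
    intro R
    simp only [hp, map_add, map_smul, map_sum, aeval_theta_ecoef, smul_smul]
  have hLd : aeval theta (charPoly m) (opT m (toC (meanS m)))
      = (m.factorial : ℂ) • (ecoef 1 - ecoef 0) := by
    rw [aeval_charPoly_opT (by omega)]
    congr 1
    rw [opT_meanS hm]; abel
  have hL : aeval theta (charPoly m) (opT m (toC (meanS m)) - p) = 0 := by
    rw [map_sub, hLd, hap, eval_charPoly, eval_charPoly, indicial_zero hm, indicial_one (by omega),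
      sum_eq_zero (fun w hw => by rw [eval_charPoly, (hZ w hw).1, mul_zero, zero_smul]),
      factorial_eq_mul (by omega)]
    ext n
    simp only [Pi.add_apply, Pi.sub_apply, Pi.smul_apply, smul_eq_mul, Pi.zero_apply]
    field_simp; ring
  rw [hr]
  refine isBigO_of_annihilated hσ (charPoly_ne_zero hm) hL fun w hw hσw => ?_
  have hwr := isRoot_charPoly.mp hw
  have hpos : 0 < w.re := by linarith
  have hwZ : w ∈ Z := by
    by_contra h
    linarith [hroot w hwr h]
  -- The mode `w` is absent from the remainder: the cofactor turns the remainder into a multiple of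
  -- `ecoef w`, so its value at index `0` decides. There `opT` of `meanS` contributes nothing, being
  -- zero below `m - 1` while the cofactor has degree `m - 2`, and `coeffA` is the value that makes
  -- the contribution of `p` vanish.
  refine ⟨cofactor m w, eval_cofactor_ne_zero hm hwr hpos, eq_zero_of_theta (w := w) ?_ ?_⟩
  · rw [← sub_eq_zero, ← aeval_X_sub_C_mul, X_sub_C_mul_cofactor hwr, hL]
  · have hw0 : w ≠ 0 := by rintro rfl; simp at hpos
    have hw1 : 1 - w ≠ 0 := by
      rintro h
      rw [← eq_of_sub_eq_zero h, indicial_one (by omega), neg_eq_zero] at hwr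
      exact mul_ne_zero hm1 (by exact_mod_cast (m - 1).factorial_ne_zero) hwr
    have e0 : (cofactor m w).eval 0 = m.factorial / w := by
      have := eval_cofactor_mul hwr 0
      rw [indicial_zero hm] at this
      field_simp; linear_combination -this
    have e1 : (cofactor m w).eval 1 = -((m - 1 : ℂ) * (m - 1).factorial) / (1 - w) := by
      rw [eq_div_iff hw1, mul_comm, eval_cofactor_mul hwr, indicial_one (by omega)]
    have hs := sum_inv_ne_zero hm hpos
    have hs' : w - 1 ≠ 0 := fun h => hw1 (by linear_combination -h)
    rw [map_sub, Pi.sub_apply, aeval_theta_apply_zero (k := m - 2)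
      (fun n hn => opT_of_lt _ (by omega)) _ (natDegree_cofactor w).le, hap, e0, e1]
    simp only [Pi.add_apply, Finset.sum_apply, Pi.smul_apply, smul_eq_mul, ecoef_zero, mul_one]
    rw [sum_eq_single_of_mem w hwZ, eval_cofactor_self hwr hpos, coeffA,
      factorial_eq_mul (m := m) (by omega)]
    · field_simp; ring
    · intro v hv hvw
      have h1 := eval_cofactor_mul hwr v
      rw [(hZ v hv).1] at h1
      rw [(mul_eq_zero.mp h1).resolve_left (sub_ne_zero.mpr hvw), mul_zero]

lemma meanS_sub_isBigO (hm : 2 ≤ m) {σ : ℝ} (hσ : 1 ≤ σ)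
    (hroot : ∀ w, indicial m w = 0 → w ≠ 2 → w.re < σ) :
    (toC (meanS m) - (phi m : ℂ) • ecoef 2) =O[atTop] (ecoef σ) := by
  have h := meanS_expansion hm (by linarith : 0 < σ) {2}
    (by simp [indicial_two (by omega : 1 ≤ m)]) (by simpa using hroot)
  rw [sum_singleton, coeffA_two hm] at h
  have h1 : ((1 / ((m : ℂ) - 1)) • ecoef (1 : ℂ)) =O[atTop] (ecoef σ) := by
    refine IsBigO.trans ?_ (ecoef_isBigO_of_le one_pos hσ)
    refine IsBigO.const_smul_left ?_ _
    refine IsBigO.of_bound 1 (Eventually.of_forall fun n => ?_)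
    simp [ecoef_one]
  refine (h.sub h1).congr_left fun n => ?_
  simp only [Pi.add_apply, Pi.sub_apply]; ring

/-- The leading part `phi * ecoef 2` of the mean of `S` resonates with the zero `2`, with
coefficient `m! φ / Λ'(2) = 2 φ ^ 2`. -/
lemma meanN_expansion (hm : 2 ≤ m) {σ : ℝ} (hσ : 1 ≤ σ) (hσ2 : σ < 2)
    (hroot : ∀ w, indicial m w = 0 → w ≠ 2 → w.re < σ) :
    ∃ c : ℂ, (toC (meanN m) - (2 * phi m ^ 2 : ℂ) • lcoef 2 - c • ecoef 2)
      =O[atTop] (ecoef σ) := by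
  have hσ0 : 0 < σ := by linarith
  have h2 := indicial_two (by omega : 1 ≤ m)
  have hphi : (phi m : ℂ) ≠ 0 := by exact_mod_cast (phi_pos hm).ne'
  refine aeval_expansion (Q := cofactor m 2) hσ0 (by simpa using hσ2) (cofactor_ne_zero hm h2)
    (fun z hz => ?_) ?_
  · obtain ⟨h3, h4⟩ := root_of_isRoot_cofactor hm h2 (by simp) hz
    exact hroot z h3 h4
  · rw [map_sub, map_smul, aeval_mul_X_sub_C 2 _ (lcoef 2),
      theta_lcoef (ne_neg_nat_of_re_pos (by simp)), add_sub_cancel_left, aeval_theta_ecoef,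
      eval_cofactor_two hm, X_sub_C_mul_cofactor h2, aeval_meanN hm]
    refine ((meanS_sub_isBigO hm hσ hroot).const_smul_left (m.factorial : ℂ)).congr_left fun n => ?_
    simp only [Pi.sub_apply, Pi.smul_apply, smul_eq_mul]
    field_simp

end Means

/-! ### Products and logarithms measured against `ecoef` -/

section Gauges

variable {σ τ : ℝ} {f g : ℕ → ℂ}

lemma mul_isLittleO_ecoef (hσ : 0 < σ) (hτ : 0 < τ) (h : 1 < σ + τ)
    (hf : f =O[atTop] (ecoef σ)) (hg : g =o[atTop] (ecoef τ)) :
    (f * g) =o[atTop] (ecoef (σ + τ - 1)) :=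
  (hf.mul_isLittleO hg).trans_isBigO (ecoef_mul_isTheta hσ hτ h).isBigO

lemma isBigO_ecoef_self {s : ℂ} (hs : 0 < s.re) : (ecoef s) =O[atTop] (ecoef s.re) :=
  (norm_ecoef_isTheta hs).isBigO

lemma hsum_isLittleO {s : ℂ} (hs : 0 < s.re) (hτ : 1 < τ) : (hsum s) =o[atTop] (ecoef τ) := by
  have h1 : (fun n : ℕ => ((Real.log n : ℝ) : ℂ)) =o[atTop] (ecoef τ) := by
    have h2 := (isLittleO_log_rpow_atTop (r := τ - 1) (by linarith)).comp_tendsto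
      (tendsto_natCast_atTop_atTop (R := ℝ))
    have h3 := h2.trans_isTheta (ecoef_isTheta_rpow (by linarith : 0 < τ)).symm
    refine IsLittleO.of_norm_left (h3.norm_left.congr_left fun n => ?_)
    rw [Complex.norm_real]; rfl
  have h4 := ((tendsto_hsum_sub_log hs).isBigO_one ℝ).trans_isLittleO
    ((const_isLittleO_ecoef hτ 1).norm_left.congr_left (f₂ := fun _ => (1 : ℝ)) (by simp))
  refine (h4.add h1).congr_left fun n => by simp

end Gauges

/-! ### Estimates uniform over compositions, and deviations -/

section Compositions

variable {m : ℕ}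

/-- Pairs of `n` and a composition of `n + 1 - m` into `m` parts, as `n → ∞`. -/
def compFilter (m : ℕ) : Filter (ℕ × (Fin m → ℕ)) :=
  comap Prod.fst atTop ⊓ 𝓟 {p | ∑ i, p.2 i = p.1 + 1 - m}

lemma eventually_compFilter {P : ℕ × (Fin m → ℕ) → Prop} :
    (∀ᶠ p in compFilter m, P p) ↔
      ∀ᶠ n in atTop, ∀ I : Fin m → ℕ, ∑ i, I i = n + 1 - m → P (n, I) := by
  rw [compFilter, eventually_inf_principal, eventually_comap]
  refine eventually_congr (Eventually.of_forall fun n => ?_)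
  constructor
  · intro h I hI
    exact h (n, I) rfl hI
  · rintro h ⟨k, I⟩ rfl hI
    exact h I hI

lemma tendsto_fst_compFilter : Tendsto Prod.fst (compFilter m) atTop :=
  tendsto_comap.mono_left inf_le_left

lemma part_le {I : Fin m → ℕ} {n : ℕ} (hm : 1 ≤ m) (h : ∑ i, I i = n + 1 - m) (i : Fin m) :
    I i ≤ n := by
  have := single_le_sum (f := I) (fun j _ => Nat.zero_le _) (mem_univ i)
  omega

lemma eventually_part_le (hm : 1 ≤ m) : ∀ᶠ p in compFilter m, ∀ i, p.2 i ≤ p.1 :=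
  eventually_compFilter.mpr (Eventually.of_forall fun _ _ hI i => part_le hm hI i)

/-- The mean over the subtree sizes. -/
noncomputable def expC (m : ℕ) (F : ℕ × (Fin m → ℕ) → ℂ) (n : ℕ) : ℂ := expI m n fun I => F (n, I)

lemma expC_add (F G : ℕ × (Fin m → ℕ) → ℂ) : expC m (F + G) = expC m F + expC m G := by
  ext n; exact expI_add

lemma expC_smul (c : ℂ) (F : ℕ × (Fin m → ℕ) → ℂ) : expC m (c • F) = c • expC m F := by
  ext n; exact expI_const_mul c

lemma expC_mul_fst (F : ℕ × (Fin m → ℕ) → ℂ) (a : ℕ → ℂ) :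
    expC m (F * fun p => a p.1) = expC m F * a := by
  ext n; exact expI_mul_const (a n)

lemma expC_congr {F G : ℕ × (Fin m → ℕ) → ℂ} (h : F =ᶠ[compFilter m] G) :
    expC m F =ᶠ[atTop] expC m G :=
  (eventually_compFilter.mp h).mono fun _ hn => expI_congr hn

lemma expC_isBigO (hm : 1 ≤ m) {F : ℕ × (Fin m → ℕ) → ℂ} {g : ℕ → ℝ}
    (h : F =O[compFilter m] (fun p => g p.1)) : expC m F =O[atTop] g := by
  obtain ⟨C, hC, hb⟩ := h.exists_nonneg
  refine IsBigO.of_bound C ((eventually_compFilter.mp hb.bound).mono fun n hn => ?_)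
  exact norm_expI_le_of_le hm (by positivity) hn

lemma expC_isLittleO (hm : 1 ≤ m) {F : ℕ × (Fin m → ℕ) → ℂ} {g : ℕ → ℝ}
    (h : F =o[compFilter m] (fun p => g p.1)) : expC m F =o[atTop] g := by
  refine IsLittleO.of_bound fun c hc => ?_
  refine (eventually_compFilter.mp (h.bound hc)).mono fun n hn => ?_
  exact norm_expI_le_of_le hm (by positivity) hn

lemma exists_bound_ecoef {σ : ℝ} (hσ : 0 < σ) {a : ℕ → ℂ} (h : a =O[atTop] (ecoef σ)) :
    ∃ C, 0 < C ∧ ∀ n, ‖a n‖ ≤ C * ecoef σ n := by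
  obtain ⟨C, hC, hb⟩ := bound_of_isBigO_nat_atTop h
  refine ⟨C, hC, fun n => ?_⟩
  have := hb (ecoef_pos hσ n).ne'
  rwa [Real.norm_of_nonneg (ecoef_pos hσ n).le] at this

lemma exists_bound_ecoef_add {σ : ℝ} (hσ : 0 < σ) {a : ℕ → ℂ} (h : a =o[atTop] (ecoef σ)) {ε : ℝ}
    (hε : 0 < ε) : ∃ B, 0 ≤ B ∧ ∀ n, ‖a n‖ ≤ ε * ecoef σ n + B := by
  obtain ⟨N, hN⟩ := eventually_atTop.mp (h.bound hε)
  refine ⟨∑ n ∈ range N, ‖a n‖, sum_nonneg fun _ _ => norm_nonneg _, fun n => ?_⟩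
  have h0 := (ecoef_pos hσ n).le
  have h1 : 0 ≤ ∑ n ∈ range N, ‖a n‖ := sum_nonneg fun _ _ => norm_nonneg _
  rcases lt_or_ge n N with hn | hn
  · have := single_le_sum (f := fun n => ‖a n‖) (fun _ _ => norm_nonneg _) (mem_range.mpr hn)
    have : 0 ≤ ε * ecoef σ n := by positivity
    linarith
  · have := hN n hn
    rw [Real.norm_of_nonneg h0] at this
    linarith

/-- For `σ ≥ 1` the gauge is monotone, so a bound at the size of a part is also a bound at `n`,
uniformly over compositions. -/
lemma part_isBigO (hm : 1 ≤ m) {σ : ℝ} (hσ : 1 ≤ σ) {a : ℕ → ℂ} (h : a =O[atTop] (ecoef σ))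
    (i : Fin m) :
    (fun p : ℕ × (Fin m → ℕ) => a (p.2 i)) =O[compFilter m] (fun p => ecoef σ p.1) := by
  have hσ0 : 0 < σ := by linarith
  obtain ⟨C, hC, hb⟩ := exists_bound_ecoef hσ0 h
  refine IsBigO.of_bound C ((eventually_part_le hm).mono fun p hp => ?_)
  rw [Real.norm_of_nonneg (ecoef_pos hσ0 _).le]
  exact (hb _).trans (mul_le_mul_of_nonneg_left (ecoef_mono hσ (hp i)) hC.le)

lemma part_isLittleO (hm : 1 ≤ m) {σ : ℝ} (hσ : 1 < σ) {a : ℕ → ℂ} (h : a =o[atTop] (ecoef σ))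
    (i : Fin m) :
    (fun p : ℕ × (Fin m → ℕ) => a (p.2 i)) =o[compFilter m] (fun p => ecoef σ p.1) := by
  have hσ0 : 0 < σ := by linarith
  refine IsLittleO.of_bound fun c hc => ?_
  obtain ⟨B, hB, hb⟩ := exists_bound_ecoef_add hσ0 h (half_pos hc)
  have h2 := tendsto_fst_compFilter (m := m) |>.eventually
    ((const_isLittleO_ecoef hσ (B : ℂ)).bound (half_pos hc))
  filter_upwards [eventually_part_le hm, h2] with p hp h2
  rw [Complex.norm_real, Real.norm_of_nonneg hB, Real.norm_of_nonneg (ecoef_pos hσ0 _).le] at h2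
  rw [Real.norm_of_nonneg (ecoef_pos hσ0 _).le]
  have := mul_le_mul_of_nonneg_left (ecoef_mono hσ.le (hp i)) (half_pos hc).le
  linarith [hb (p.2 i)]

/-- The deviation `∑ a (I i) - a n` of an additive functional. -/
noncomputable def dev (m : ℕ) : (ℕ → ℂ) →ₗ[ℂ] (ℕ × (Fin m → ℕ) → ℂ) where
  toFun a p := ∑ i, a (p.2 i) - a p.1
  map_add' a b := by ext p; simp [sum_add_distrib]; ring
  map_smul' c a := by ext p; simp [← mul_sum, mul_sub]

lemma dev_apply (a : ℕ → ℂ) (p : ℕ × (Fin m → ℕ)) : dev m a p = ∑ i, a (p.2 i) - a p.1 := rfl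

lemma dev_isBigO (hm : 1 ≤ m) {σ : ℝ} (hσ : 1 ≤ σ) {a : ℕ → ℂ} (h : a =O[atTop] (ecoef σ)) :
    dev m a =O[compFilter m] (fun p => ecoef σ p.1) :=
  (IsBigO.fun_sum fun i _ => part_isBigO hm hσ h i).sub (h.comp_tendsto tendsto_fst_compFilter)

lemma dev_isLittleO (hm : 1 ≤ m) {σ : ℝ} (hσ : 1 < σ) {a : ℕ → ℂ} (h : a =o[atTop] (ecoef σ)) :
    dev m a =o[compFilter m] (fun p => ecoef σ p.1) :=
  (IsLittleO.fun_sum fun i _ => part_isLittleO hm hσ h i).sub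
    (h.comp_tendsto tendsto_fst_compFilter)

/-- The numbers `I i + 1` add up to `n + 1`. Hence the multiples of `ecoef 2` in the means,
including unknown ones, do not affect deviations. -/
lemma dev_ecoef_two : dev m (ecoef 2) =ᶠ[compFilter m] 0 := by
  refine eventually_compFilter.mpr ((eventually_ge_atTop m).mono fun n hn I hI => ?_)
  have : ((∑ i, I i : ℕ) : ℂ) + m = n + 1 := by
    rw [hI, ← Nat.cast_add, show n + 1 - m + m = n + 1 by omega]; push_cast; rfl
  push_cast at this
  simp [dev_apply, ecoef_two, sum_add_distrib, this]

lemma expI_one (hm : 1 ≤ m) {n : ℕ} (hn : m - 1 ≤ n) (c : ℂ) : expI m n (fun _ => c) = c := by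
  have := expI_const_mul (m := m) (n := n) (F := fun _ => (1 : ℂ)) c
  rw [card_compositions hm hn] at this
  simpa using this

lemma expC_dev (hm : 1 ≤ m) (a : ℕ → ℂ) : expC m (dev m a) =ᶠ[atTop] opT m a - a := by
  filter_upwards [eventually_ge_atTop m] with n hn
  simp only [expC, dev_apply, Pi.sub_apply]
  rw [expI_sub, expI_one hm (by omega), opT_apply]

lemma expC_dev_mul_dev (hm : 1 ≤ m) (a b : ℕ → ℂ) :
    expC m (dev m a * dev m b) =ᶠ[atTop]
      (fun n => expI m n fun I => (∑ i, a (I i)) * ∑ i, b (I i)) - opT m a * b - a * opT m b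
        + a * b := by
  filter_upwards [eventually_ge_atTop m] with n hn
  have e : (fun I : Fin m → ℕ => (dev m a * dev m b) (n, I)) = fun I =>
      ((((∑ i, a (I i)) * ∑ i, b (I i)) - (∑ i, a (I i)) * b n) - a n * ∑ i, b (I i))
        + a n * b n := by
    ext I; simp only [Pi.mul_apply, dev_apply]; ring
  rw [expC, e]
  simp only [Pi.add_apply, Pi.sub_apply, Pi.mul_apply]
  rw [expI_add, expI_sub, expI_sub, expI_one hm (by omega), expI_mul_const, expI_const_mul,
    opT_apply, opT_apply]

/-- For `σ < 1` the gauge decreases and small parts spoil uniform bounds. On average the estimate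
survives, because `opT` acts on `ecoef σ` as a scalar. -/
lemma expI_sum_norm_isBigO (hm : 1 ≤ m) {σ : ℝ} (hσ : 0 < σ) {a : ℕ → ℂ}
    (h : a =O[atTop] (ecoef σ)) :
    (fun n => expI m n fun I => ∑ i, ‖a (I i)‖) =O[atTop] (ecoef σ) := by
  obtain ⟨C, hC, hb⟩ := exists_bound_ecoef hσ h
  refine IsBigO.of_bound (C * (m / ecoef σ (m - 1))) ?_
  filter_upwards [eventually_ge_atTop m] with n hn
  have h1 : expI m n (fun I => ∑ i, ecoef σ (I i)) = m / ecoef σ (m - 1) * ecoef σ n := by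
    have := opT_ecoef (m := m) (s := (σ : ℂ)) hm (ne_neg_nat_of_re_pos (by simpa)) (n := n)
      (by omega)
    have e : ecoef (σ : ℂ) = toC (ecoef σ) := by ext n; exact ecoef_ofReal σ n
    rw [e, opT_toC, toC] at this
    exact_mod_cast this
  rw [Real.norm_of_nonneg (ecoef_pos hσ n).le, mul_assoc, ← h1, ← expI_const_mul,
    Real.norm_of_nonneg]
  · exact expI_mono fun I _ => by rw [mul_sum]; exact sum_le_sum fun i _ => hb _
  · exact div_nonneg (sum_nonneg fun I _ => sum_nonneg fun i _ => norm_nonneg _) (by positivity)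

lemma opT_isBigO (hm : 1 ≤ m) {σ : ℝ} (hσ : 0 < σ) {a : ℕ → ℂ} (h : a =O[atTop] (ecoef σ)) :
    opT m a =O[atTop] (ecoef σ) := by
  refine IsBigO.trans (IsBigO.of_bound 1 (Eventually.of_forall fun n => ?_))
    (expI_sum_norm_isBigO hm hσ h)
  rw [one_mul, opT_apply]
  refine (norm_expI_le _).trans ((expI_mono fun I _ => norm_sum_le _ _).trans (le_abs_self _))

lemma opT_isLittleO (hm : 1 ≤ m) {σ : ℝ} (hσ : 1 < σ) {a : ℕ → ℂ} (h : a =o[atTop] (ecoef σ)) :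
    opT m a =o[atTop] (ecoef σ) :=
  expC_isLittleO hm (IsLittleO.fun_sum fun i _ => part_isLittleO hm hσ h i)

end Compositions

/-! ### Transfer of asymptotics from the toll to the solution -/

section Transfer

open Polynomial

variable {m : ℕ} {σ : ℝ} {a b : ℕ → ℂ}

lemma aeval_charPoly_of_eq (hm : 1 ≤ m) (h : a = b + opT m a) :
    aeval theta (charPoly m) (opT m a) = (m.factorial : ℂ) • b := by
  rw [aeval_charPoly_opT hm]
  congr 1
  exact sub_eq_of_eq_add h

lemma re_le_two_of_root (hm : 2 ≤ m) {z : ℂ} (hz : indicial m z = 0) : z.re ≤ 2 := by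
  rcases eq_or_ne z 2 with rfl | h
  · simp
  · exact (re_lt_two_of_root hm hz h).le

/-- As `Λ(theta)` sends `opT m a` to `m! b` and `σ` exceeds the real parts of all zeros, no mode
outgrows the toll. -/
lemma transfer_isBigO (hm : 2 ≤ m) (h : a = b + opT m a) (hσ : 2 < σ)
    (hb : b =O[atTop] (ecoef σ)) : a =O[atTop] (ecoef σ) := by
  rw [h]
  refine hb.add (aeval_isBigO (by linarith) (charPoly_ne_zero hm)
    (fun w hw => (re_le_two_of_root hm (isRoot_charPoly.mp hw)).trans_lt hσ) ?_)
  rw [aeval_charPoly_of_eq (by omega) h]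
  exact hb.const_smul_left _

lemma transfer_isLittleO (hm : 2 ≤ m) (h : a = b + opT m a) (hσ : 2 < σ)
    (hb : b =o[atTop] (ecoef σ)) : a =o[atTop] (ecoef σ) := by
  rw [h]
  refine hb.add (aeval_isLittleO (by linarith) (charPoly_ne_zero hm)
    (fun w hw => (re_le_two_of_root hm (isRoot_charPoly.mp hw)).trans_lt hσ) ?_)
  rw [aeval_charPoly_of_eq (by omega) h]
  exact hb.const_smul_left _

/-- Only the zero `2` lies to the right of `σ`, so one mode survives. -/
lemma transfer_expansion (hm : 2 ≤ m) (h : a = b + opT m a) (hσ : 0 < σ) (hσ2 : σ < 2)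
    (hroot : ∀ w, indicial m w = 0 → w ≠ 2 → w.re < σ) (hb : b =O[atTop] (ecoef σ)) :
    ∃ c : ℂ, (a - c • ecoef 2) =O[atTop] (ecoef σ) := by
  have h2 := indicial_two (by omega : 1 ≤ m)
  obtain ⟨c, hc⟩ := aeval_expansion (f := opT m a) (Q := cofactor m 2) (w := 2) hσ
    (by simpa using hσ2) (cofactor_ne_zero hm h2) (fun z hz => by
      obtain ⟨h3, h4⟩ := root_of_isRoot_cofactor hm h2 (by simp) hz
      exact hroot z h3 h4)
    (by
      rw [X_sub_C_mul_cofactor h2, aeval_charPoly_of_eq (by omega) h]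
      exact hb.const_smul_left _)
  refine ⟨c, (hb.add hc).congr_left fun n => ?_⟩
  have := congrFun h n
  simp only [Pi.add_apply, Pi.sub_apply] at this ⊢
  rw [this]; ring

lemma two_ecoef_isLittleO_mul_log :
    (ecoef (2 : ℝ)) =o[atTop] (fun n : ℕ => (n : ℝ) * Real.log n) := by
  have h1 : (fun n : ℕ => (n : ℝ)) =o[atTop] (fun n : ℕ => (n : ℝ) * Real.log n) := by
    have hlog : Tendsto (fun n : ℕ => Real.log n) atTop atTop :=
      Real.tendsto_log_atTop.comp tendsto_natCast_atTop_atTop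
    have h3 : (fun _ : ℕ => (1 : ℝ)) =o[atTop] (fun n : ℕ => Real.log n) :=
      isLittleO_const_left.mpr (Or.inr (tendsto_norm_atTop_atTop.comp hlog))
    simpa using (isBigO_refl (fun n : ℕ => (n : ℝ)) atTop).mul_isLittleO h3
  refine IsBigO.trans_isLittleO ?_ h1
  refine (ecoef_isTheta_rpow two_pos).isBigO.trans (IsBigO.of_bound 1 ?_)
  refine Eventually.of_forall fun n => ?_
  norm_num

lemma transfer_resonance (hm : 2 ≤ m) (h : a = b + opT m a) {K : ℂ}
    (hb : (b - K • ecoef 2) =o[atTop] (ecoef (2 : ℝ))) :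
    (a - (2 * phi m * K) • lcoef 2) =o[atTop] (fun n : ℕ => (n : ℝ) * Real.log n) := by
  have h2 := indicial_two (by omega : 1 ≤ m)
  have hphi : (phi m : ℂ) ≠ 0 := by exact_mod_cast (phi_pos hm).ne'
  have hmf : (m.factorial : ℂ) ≠ 0 := by exact_mod_cast m.factorial_ne_zero
  have h3 := aeval_resonance (f := opT m a) (Q := cofactor m 2) (K := m.factorial * K)
    (fun z hz => by
      obtain ⟨h3, h4⟩ := root_of_isRoot_cofactor hm h2 (by simp) hz
      exact re_lt_two_of_root hm h3 h4)
    (by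
      rw [X_sub_C_mul_cofactor h2, aeval_charPoly_of_eq (by omega) h, mul_smul, ← smul_sub]
      exact hb.const_smul_left _)
  have h4 : b =o[atTop] (fun n : ℕ => (n : ℝ) * Real.log n) := by
    have h5 : b =O[atTop] (ecoef (2 : ℝ)) := by
      have h6 : (K • ecoef (2 : ℂ)) =O[atTop] (ecoef (2 : ℝ)) :=
        (isBigO_ecoef_self (s := 2) (by simp)).const_smul_left K
      simpa using hb.isBigO.add h6
    exact h5.trans_isLittleO two_ecoef_isLittleO_mul_log
  have e : (m.factorial * K) / (cofactor m 2).eval 2 = 2 * phi m * K := by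
    rw [eval_cofactor_two hm]; field_simp
  rw [e] at h3
  refine (h4.add h3).congr_left fun n => ?_
  have := congrFun h n
  simp only [Pi.add_apply, Pi.sub_apply] at this ⊢
  rw [this]; ring

/-- Subtracting a particular solution from a recurrence with inhomogeneity `K • ecoef w`. -/
lemma transfer_particular (hm : 1 ≤ m) (h : a = b + opT m a) {w K : ℂ} (hw : 0 < w.re)
    (hk : 1 - m / ecoef w (m - 1) ≠ 0) :
    ∃ b', b' =ᶠ[atTop] b - K • ecoef w ∧
      a - (K / (1 - m / ecoef w (m - 1))) • ecoef w
        = b' + opT m (a - (K / (1 - m / ecoef w (m - 1))) • ecoef w) := by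
  set c := K / (1 - m / ecoef w (m - 1)) with hc
  have hcK : c * (1 - m / ecoef w (m - 1)) = K := div_mul_cancel₀ _ hk
  -- The scalar action of `opT` on `ecoef w` starts at `n = m - 1`, so the new toll has the expected
  -- form only eventually.
  refine ⟨b - c • ecoef w + c • opT m (ecoef w), ?_, ?_⟩
  · filter_upwards [eventually_ge_atTop m] with n hn
    simp only [Pi.add_apply, Pi.sub_apply, Pi.smul_apply, smul_eq_mul]
    rw [opT_ecoef hm (ne_neg_nat_of_re_pos hw) (by omega), ← hcK]
    ring
  · rw [map_sub, map_smul]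
    nth_rw 1 [h]
    abel

end Transfer

/-! ### Deviations of the conditional means -/

section Deviations

variable {m : ℕ}

/-- The deviation of the conditional mean of `S`, as a complex function. -/
noncomputable def cdevS (m : ℕ) (p : ℕ × (Fin m → ℕ)) : ℂ := (devS m p.1 p.2 : ℂ)

/-- The deviation of the conditional mean of `N`, as a complex function. -/
noncomputable def cdevN (m : ℕ) (p : ℕ × (Fin m → ℕ)) : ℂ := (devN m p.1 p.2 : ℂ)

lemma covSS_eq_add_opT (hm : 2 ≤ m) :
    toC (covSS m) = expC m (cdevS m * cdevS m) + opT m (toC (covSS m)) := by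
  ext n
  simp only [Pi.add_apply]
  rw [opT_toC, toC, covSS_rec hm n, Complex.ofReal_add, expI_ofReal (fun I => devS m n I ^ 2),
    add_comm, expC]
  congr 2
  ext I; simp [cdevS, sq]

lemma covSN_eq_add_opT (hm : 2 ≤ m) :
    toC (covSN m) = (opT m (toC (covSS m)) + expC m (cdevS m * cdevN m))
      + opT m (toC (covSN m)) := by
  ext n
  simp only [Pi.add_apply]
  rw [opT_toC, opT_toC, toC, covSN_rec hm n, Complex.ofReal_add,
    expI_ofReal (fun I => devS m n I * devN m n I), expC]
  simp only [sum_add_distrib, expI_add, cdevS, cdevN, Pi.mul_apply]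
  push_cast; ring

lemma covNN_eq_add_opT (hm : 2 ≤ m) :
    toC (covNN m) = (opT m ((2 : ℂ) • toC (covSN m) + toC (covSS m)) + expC m (cdevN m * cdevN m))
      + opT m (toC (covNN m)) := by
  ext n
  simp only [Pi.add_apply, map_add, map_smul, Pi.smul_apply]
  rw [opT_toC, opT_toC, opT_toC, toC, covNN_rec hm n, Complex.ofReal_add,
    expI_ofReal (fun I => devN m n I ^ 2), expC]
  simp only [sum_add_distrib, expI_add, ← mul_sum, expI_const_mul, cdevN, Pi.mul_apply, ← sq,
    smul_eq_mul]
  push_cast; ring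

/-- The deviation of the constant sequence `1` is `m - 1`, so the multiple `1 / (m - 1)` accounts
for the root node. -/
lemma cdevS_eq (hm : 2 ≤ m) :
    cdevS m = dev m (toC (meanS m) + (1 / ((m : ℂ) - 1)) • ecoef 1) := by
  have hm1 : (m : ℂ) - 1 ≠ 0 := by
    rw [sub_ne_zero]; exact_mod_cast (by omega : m ≠ 1)
  ext p
  rw [map_add, map_smul]
  simp only [Pi.add_apply, Pi.smul_apply, dev_apply, ecoef_one, cdevS, devS, toC, smul_eq_mul,
    sum_const, card_univ, Fintype.card_fin, nsmul_eq_mul]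
  push_cast; field_simp; ring

lemma cdevN_eq :
    cdevN m = dev m (toC (meanN m)) + dev m (toC (meanS m)) + fun p => toC (meanS m) p.1 := by
  ext p
  simp only [Pi.add_apply, dev_apply, cdevN, devN, toC]
  push_cast
  rw [sum_add_distrib]; ring

/-- Additivity of `n + 1` turns the deviation into `-∑ (I i + 1) (hsum 2 n - hsum 2 (I i))`. Each
summand is at most `n`, because the terms of `hsum 2` beyond `I i` are below `1 / (I i + 1)`: the
logarithm cancels. -/
lemma dev_lcoef_two_isBigO (hm : 1 ≤ m) :
    dev m (lcoef 2) =O[compFilter m] (fun p => ecoef (2 : ℝ) p.1) := by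
  have hstep : ∀ i k : ℕ, ((i : ℝ) + 1) * (hsum 2 (i + k) - hsum 2 i) ≤ k := by
    intro i k
    rw [hsum_add, add_sub_cancel_left, hsum, mul_sum]
    calc ∑ j ∈ range k, ((i : ℝ) + 1) * (1 / (2 + i + j)) ≤ ∑ j ∈ range k, (1 : ℝ) :=
          sum_le_sum fun j _ => by
            rw [mul_one_div, div_le_one (by positivity)]
            have : (0 : ℝ) ≤ j := j.cast_nonneg
            linarith
      _ = k := by simp
  have hnn : ∀ i k : ℕ, 0 ≤ ((i : ℝ) + 1) * (hsum 2 (i + k) - hsum 2 i) := by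
    intro i k
    rw [hsum_add, add_sub_cancel_left]
    exact mul_nonneg (by positivity) (sum_nonneg fun j _ => by positivity)
  refine IsBigO.of_bound m (eventually_compFilter.mpr ((eventually_ge_atTop m).mono
    fun n hn I hI => ?_))
  have hI1 : ∑ i, ((I i : ℝ) + 1) = n + 1 := by
    have : ((∑ i, I i : ℕ) : ℝ) + m = n + 1 := by
      rw [hI, ← Nat.cast_add, show n + 1 - m + m = n + 1 by omega]; push_cast; rfl
    push_cast at this
    simp [sum_add_distrib, this]
  have e : dev m (lcoef 2) (n, I)
      = ((-∑ i, ((I i : ℝ) + 1) * (hsum 2 n - hsum 2 (I i)) : ℝ) : ℂ) := by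
    have h2 : ∀ k, lcoef (2 : ℂ) k = (((k : ℝ) + 1) * hsum 2 k : ℝ) := fun k => by
      have h := lcoef_ofReal 2 k
      rw [show lcoef (2 : ℝ) k = ((k : ℝ) + 1) * hsum 2 k by rw [lcoef, ecoef_two]] at h
      rw [← h]; norm_num
    rw [dev_apply]
    simp only [h2]
    rw [← Complex.ofReal_sum, ← Complex.ofReal_sub]
    congr 1
    simp only [mul_sub, sum_sub_distrib]
    rw [← sum_mul, hI1]; ring
  rw [e, Complex.norm_real, norm_neg, Real.norm_of_nonneg, Real.norm_of_nonneg
    (ecoef_pos two_pos n).le, ecoef_two]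
  · calc ∑ i, ((I i : ℝ) + 1) * (hsum 2 n - hsum 2 (I i))
        ≤ ∑ _i : Fin m, ((n : ℝ) + 1) := sum_le_sum fun i _ => by
          obtain ⟨k, hk⟩ := Nat.exists_eq_add_of_le (part_le hm hI i)
          have h1 := hstep (I i) k
          rw [← hk] at h1
          have h2 : (k : ℝ) ≤ n := by exact_mod_cast (by omega : k ≤ n)
          linarith
      _ = m * ((n : ℝ) + 1) := by simp; ring
  · refine sum_nonneg fun i _ => ?_
    obtain ⟨k, hk⟩ := Nat.exists_eq_add_of_le (part_le hm hI i)
    have := hnn (I i) k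
    rwa [← hk] at this

lemma exists_re_bound_two (hm : 2 ≤ m) {l : ℝ} (hl : l < 2) :
    ∃ σ, l < σ ∧ σ < 2 ∧ ∀ w : ℂ, indicial m w = 0 → w ≠ 2 → w.re < σ := by
  obtain ⟨σ, h1, h2, h3⟩ := exists_re_bound hm hl
  exact ⟨σ, h1, h2, fun w hw hw2 => h3 w hw (re_lt_two_of_root hm hw hw2)⟩

lemma dev_sub_smul_two (a : ℕ → ℂ) (c : ℂ) :
    dev m (a - c • ecoef 2) =ᶠ[compFilter m] dev m a := by
  filter_upwards [dev_ecoef_two (m := m)] with p hp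
  rw [map_sub, map_smul]
  simp [hp]

/-- The unknown linear term of the mean of `N` has negligible deviation. The last term arises
because the subtrees also contribute their node counts, with total mean close to `phi * ecoef 2 n`.
-/
lemma cdevN_expansion (hm : 2 ≤ m) :
    (cdevN m - (2 * phi m ^ 2 : ℂ) • dev m (lcoef 2) - fun p => phi m * ecoef (2 : ℂ) p.1)
      =o[compFilter m] (fun p => ecoef (2 : ℝ) p.1) := by
  obtain ⟨σ, h1, h2, h3⟩ := exists_re_bound_two hm (l := 1) (by norm_num)
  have hσ0 : 0 < σ := by linarith
  obtain ⟨c, hN⟩ := meanN_expansion hm h1.le h2 h3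
  have hS := meanS_sub_isBigO hm h1.le h3
  have hσ := ecoef_isLittleO hσ0 h2
  have hN' := dev_isLittleO (m := m) (by omega) (by norm_num) (hN.trans_isLittleO hσ)
  have hS' := dev_isLittleO (m := m) (by omega) (by norm_num) (hS.trans_isLittleO hσ)
  have hS'' := (hS.trans_isLittleO hσ).comp_tendsto (tendsto_fst_compFilter (m := m))
  refine ((hN'.add hS').add hS'').congr' ?_ EventuallyEq.rfl
  filter_upwards [dev_ecoef_two (m := m)] with p hp
  rw [cdevN_eq]
  simp only [map_sub, map_smul, Pi.add_apply, Pi.sub_apply, Pi.smul_apply, smul_eq_mul,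
    Function.comp_apply, hp, Pi.zero_apply]
  ring

lemma cdevN_isBigO (hm : 2 ≤ m) :
    cdevN m =O[compFilter m] (fun p => ecoef (2 : ℝ) p.1) := by
  have h1 := (cdevN_expansion hm).isBigO
  have h2 := (dev_lcoef_two_isBigO (m := m) (by omega)).const_smul_left (2 * phi m ^ 2 : ℂ)
  have h3 := ((isBigO_ecoef_self (s := 2) (by simp)).const_mul_left (phi m : ℂ)).comp_tendsto
    (tendsto_fst_compFilter (m := m))
  refine ((h1.add h3).add h2).congr_left fun p => ?_
  simp only [Pi.sub_apply, Pi.smul_apply, Function.comp_apply]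
  ring

end Deviations

/-! ### Covariances for `m ≤ 13` -/

section SmallArity

variable {m : ℕ}

/-- For `σ < 1` only one factor can be bounded uniformly; the other is averaged. The gain over a
uniform bound makes the toll of the variance of `S` smaller than constant order. -/
lemma expC_mul_dev_isBigO (hm : 1 ≤ m) {σ τ : ℝ} (hσ : 0 < σ) (hτ : 0 < τ) (hστ : 1 < σ + τ)
    {a : ℕ → ℂ} (ha : a =O[atTop] (ecoef σ)) {F : ℕ × (Fin m → ℕ) → ℂ}
    (hF : F =O[compFilter m] (fun p => ecoef τ p.1)) :
    expC m (F * dev m a) =O[atTop] (ecoef (σ + τ - 1)) := by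
  obtain ⟨C, hC, hb⟩ := hF.exists_nonneg
  have h1 : (fun n => ((expI m n fun I => ∑ i, ‖a (I i)‖) + ‖a n‖)) =O[atTop] (ecoef σ) :=
    (expI_sum_norm_isBigO hm hσ ha).add ha.norm_left
  refine IsBigO.trans ?_ ((h1.mul (isBigO_refl (ecoef τ) atTop)).trans
    (ecoef_mul_isTheta hσ hτ hστ).isBigO)
  refine IsBigO.of_bound C ?_
  filter_upwards [eventually_compFilter.mp hb.bound, eventually_ge_atTop m] with n hn hmn
  have hE := (ecoef_pos hτ n).le
  have h2 : 0 ≤ expI m n fun I => ∑ i, ‖a (I i)‖ :=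
    div_nonneg (sum_nonneg fun I _ => sum_nonneg fun i _ => norm_nonneg _) (by positivity)
  rw [Real.norm_of_nonneg (by positivity), expC]
  refine (norm_expI_le _).trans ?_
  have h3 : expI m n (fun I => C * ecoef τ n * (∑ i, ‖a (I i)‖ + ‖a n‖))
      = C * (((expI m n fun I => ∑ i, ‖a (I i)‖) + ‖a n‖) * ecoef τ n) := by
    have h4 : expI m n (fun _ : Fin m → ℕ => ‖a n‖) = ‖a n‖ := by
      have := expI_const_mul (m := m) (n := n) (F := fun _ => (1 : ℝ)) ‖a n‖
      rw [card_compositions hm (by omega)] at this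
      simpa using this
    rw [expI_const_mul, expI_add, h4]; ring
  rw [← h3]
  refine expI_mono fun I hI => ?_
  have h5 := hn I hI
  rw [Real.norm_of_nonneg hE] at h5
  rw [Pi.mul_apply, norm_mul]
  refine mul_le_mul h5 ?_ (norm_nonneg _) (by positivity)
  exact (norm_sub_le _ _).trans (add_le_add (norm_sum_le _ _) le_rfl)

lemma ecoef_two_pred (hm : 1 ≤ m) : ecoef (2 : ℂ) (m - 1) = m := by
  rw [ecoef_two]
  obtain ⟨k, rfl⟩ : ∃ k, m = k + 1 := ⟨m - 1, by omega⟩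
  simp

lemma opT_ecoef_two (hm : 1 ≤ m) : opT m (ecoef 2) =ᶠ[atTop] ecoef 2 := by
  filter_upwards [eventually_ge_atTop m] with n hn
  have : (m : ℂ) ≠ 0 := by exact_mod_cast (by omega : m ≠ 0)
  rw [opT_ecoef hm (ne_neg_nat_of_re_pos (by simp)) (by omega), ecoef_two_pred hm, div_self this,
    one_mul]

lemma re_isBigO_self (f : ℕ → ℂ) : (fun n => (f n).re) =O[atTop] f :=
  IsBigO.of_bound 1 (Eventually.of_forall fun n => by
    rw [one_mul]; exact Complex.abs_re_le_norm _)

lemma covSS_nonneg (n : ℕ) : 0 ≤ covSS m n := by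
  rw [covSS, covariance_self (Measurable.of_discrete).aemeasurable]
  exact variance_nonneg _ _

lemma le_covSS (hm : 2 ≤ m) (n : ℕ) :
    (expI m n fun I => ∑ i, covSS m (I i)) ≤ covSS m n := by
  rw [covSS_rec hm n]
  exact le_add_of_nonneg_right
    (div_nonneg (sum_nonneg fun I _ => sq_nonneg _) (by positivity))

lemma expI_pos {n : ℕ} (hn : m - 1 ≤ n) {F : (Fin m → ℕ) → ℝ} (h : ∀ I, 0 ≤ F I)
    {I : Fin m → ℕ} (hI : ∑ i, I i = n + 1 - m) (hpos : 0 < F I) : 0 < expI m n F := by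
  refine div_pos (sum_pos' (fun I _ => h I) ⟨I, by simpa using hI, hpos⟩) ?_
  exact_mod_cast Nat.choose_pos hn

/-- With `m + 1` keys two remain after the root. They share a subtree or go to different ones,
giving `2` or `3` nodes, and the mean cannot equal both. -/
lemma covSS_succ_pos (hm : 3 ≤ m) : 0 < covSS m (m + 1) := by
  obtain ⟨k, rfl⟩ : ∃ k, m = k + 2 := ⟨m - 2, by omega⟩
  set m := k + 2 with hmk
  set I : Fin m → ℕ := Fin.cons 2 (Fin.cons 0 0) with hI
  set J : Fin m → ℕ := Fin.cons 1 (Fin.cons 1 0) with hJ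
  have hIs : ∑ i, I i = m + 1 + 1 - m := by
    rw [hI, Fin.sum_univ_succ, Fin.sum_univ_succ]; simp; omega
  have hJs : ∑ i, J i = m + 1 + 1 - m := by
    rw [hJ, Fin.sum_univ_succ, Fin.sum_univ_succ]; simp; omega
  have h0 : meanS m 0 = 0 := by rw [meanS_of_small (by omega), if_pos rfl]
  have h1 : meanS m 1 = 1 := by rw [meanS_of_small (by omega), if_neg (by omega)]
  have h2 : meanS m 2 = 1 := by rw [meanS_of_small (by omega), if_neg (by omega)]
  have e1 : devS m (m + 1) I = 2 - meanS m (m + 1) := by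
    rw [devS, hI, Fin.sum_univ_succ, Fin.sum_univ_succ]
    simp only [Fin.cons_zero, Fin.cons_succ, Pi.zero_apply, h0, h2, sum_const_zero]; norm_num
  have e2 : devS m (m + 1) J = 3 - meanS m (m + 1) := by
    rw [devS, hJ, Fin.sum_univ_succ, Fin.sum_univ_succ]
    simp only [Fin.cons_zero, Fin.cons_succ, Pi.zero_apply, h0, h1, sum_const_zero]; norm_num
  rw [covSS_rec (by omega)]
  refine add_pos_of_nonneg_of_pos
    (div_nonneg (sum_nonneg fun I _ => sum_nonneg fun i _ => covSS_nonneg _) (by positivity)) ?_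
  by_cases h : devS m (m + 1) I = 0
  · refine expI_pos (by omega) (fun _ => sq_nonneg _) hJs (pow_pos ?_ 2)
    rw [e2]; rw [e1] at h; linarith
  · exact expI_pos (by omega) (fun _ => sq_nonneg _) hIs (by positivity)

/-- One admissible composition has a part equal to `m + 1`, and the variance is at least the mean of
the summed variances of the subtrees. -/
lemma covSS_pos (hm : 3 ≤ m) {n : ℕ} (hn : 2 * m ≤ n) : 0 < covSS m n := by
  obtain ⟨k, rfl⟩ : ∃ k, m = k + 2 := ⟨m - 2, by omega⟩
  set m := k + 2 with hmk
  refine lt_of_lt_of_le ?_ (le_covSS (by omega) n)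
  refine expI_pos (I := Fin.cons (m + 1) (Fin.cons (n - 2 * m) 0)) (by omega)
    (fun I => sum_nonneg fun i _ => covSS_nonneg _) ?_ ?_
  · rw [Fin.sum_univ_succ, Fin.sum_univ_succ]; simp; omega
  · refine sum_pos' (fun i _ => covSS_nonneg _) ⟨0, mem_univ _, ?_⟩
    simpa using covSS_succ_pos hm

/-- Beyond `2 m ^ 2 + 2 m` every composition has a part of size at least `2 m`, so the minimum over
the initial range propagates by induction. -/
lemma exists_le_covSS (hm : 3 ≤ m) : ∃ δ, 0 < δ ∧ ∀ n, 2 * m ≤ n → δ ≤ covSS m n := by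
  set N := 2 * m * m + 2 * m with hN
  obtain ⟨k, hk, hmin⟩ := exists_min_image (Finset.Icc (2 * m) N) (covSS m)
    ⟨2 * m, by simp [hN]⟩
  refine ⟨covSS m k, covSS_pos hm (mem_Icc.mp hk).1, fun n => ?_⟩
  induction n using Nat.strong_induction_on with
  | _ n ih =>
    intro hn
    by_cases hnN : n ≤ N
    · exact hmin n (mem_Icc.mpr ⟨hn, hnN⟩)
    · refine le_trans ?_ (le_covSS (by omega) n)
      have h1 : expI m n (fun _ => covSS m k) = covSS m k := by
        have := expI_const_mul (m := m) (n := n) (F := fun _ => (1 : ℝ)) (covSS m k)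
        rw [card_compositions (by omega) (by omega)] at this
        simpa using this
      rw [← h1]
      refine expI_mono fun I hI => ?_
      obtain ⟨i, hi⟩ : ∃ i, 2 * m ≤ I i := by
        by_contra hcon
        push Not at hcon
        have : ∑ i, I i ≤ ∑ _i : Fin m, 2 * m := sum_le_sum fun i _ => (hcon i).le
        simp only [sum_const, card_univ, Fintype.card_fin, smul_eq_mul] at this
        have e : m * (2 * m) = 2 * m * m := by ring
        omega
      refine (ih (I i) ?_ hi).trans
        (single_le_sum (f := fun i => covSS m (I i)) (fun i _ => covSS_nonneg _) (mem_univ i))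
      have := single_le_sum (f := I) (fun j _ => Nat.zero_le _) (mem_univ i)
      omega

lemma cdevS_eventuallyEq (hm : 2 ≤ m) :
    cdevS m =ᶠ[compFilter m]
      dev m (toC (meanS m) + (1 / ((m : ℂ) - 1)) • ecoef 1 - (phi m : ℂ) • ecoef 2) := by
  rw [cdevS_eq hm]
  exact (dev_sub_smul_two _ _).symm

lemma lcoef_two_ofReal (n : ℕ) : lcoef (2 : ℂ) n = (lcoef (2 : ℝ) n : ℝ) := by
  rw [← lcoef_ofReal]; norm_num

lemma lcoef_two_equiv :
    (lcoef (2 : ℝ)) ~[atTop] (fun n : ℕ => (n : ℝ) * Real.log n) := by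
  have h1 : (fun n => (lcoef (2 : ℂ) n - ecoef 2 n * (Real.log n : ℝ))) =O[atTop]
      (ecoef (2 : ℝ)) := by
    have h2 := (tendsto_hsum_sub_log (s := 2) (by simp)).isBigO_one ℝ
    refine ((isBigO_ecoef_self (s := 2) (by simp)).mul h2).congr (fun n => ?_) fun n => ?_
    · rw [lcoef]; ring
    · simp
  have h3 : (fun n : ℕ => Real.log n) =o[atTop] (fun n : ℕ => (n : ℝ) * Real.log n) := by
    have h4 : (fun n : ℕ => (1 : ℝ)) =o[atTop] (fun n : ℕ => (n : ℝ)) :=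
      isLittleO_const_left.mpr (Or.inr
        (tendsto_norm_atTop_atTop.comp tendsto_natCast_atTop_atTop))
    simpa using h4.mul_isBigO (isBigO_refl (fun n : ℕ => Real.log n) atTop)
  have h5 := (re_isBigO_self _).trans_isLittleO (h1.trans_isLittleO two_ecoef_isLittleO_mul_log)
  refine (h5.add h3).congr_left fun n => ?_
  have e : lcoef (2 : ℂ) n - ecoef 2 n * (Real.log n : ℝ)
      = ((lcoef (2 : ℝ) n - (n + 1) * Real.log n : ℝ) : ℂ) := by
    rw [lcoef_two_ofReal, ecoef_two]; push_cast; rfl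
  rw [e, Complex.ofReal_re, Pi.sub_apply]; ring

/-- The covariances for `m ≤ 13`. -/
theorem cov_small_arity (hm : 3 ≤ m) (hm' : m ≤ 13) : ∃ CS : ℝ, 0 < CS ∧
    (covSS m) ~[atTop] (fun n : ℕ => CS * (n : ℝ)) ∧
    (covSN m) ~[atTop] (fun n : ℕ => 2 * phi m * CS * (n : ℝ) * Real.log (n : ℝ)) := by
  have h2 := indicial_two (by omega : 1 ≤ m)
  obtain ⟨σ, hσ, hσ1, hroot'⟩ := exists_re_bound (m := m) (by omega) zero_lt_one
  have hroot : ∀ w, indicial m w = 0 → w ≠ 2 → w.re < σ := fun w hw hw2 =>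
    hroot' w hw (re_lt_one_of_root hm hm' hw hw2)
  have hσ12 := ecoef_isLittleO hσ hσ1
  set r := toC (meanS m) + (1 / ((m : ℂ) - 1)) • ecoef 1 - (phi m : ℂ) • ecoef 2 with hr
  have hrO : r =O[atTop] (ecoef σ) := by
    have := meanS_expansion (m := m) (by omega) hσ {2} (by simp [h2]) (by simpa using hroot)
    rwa [sum_singleton, coeffA_two (by omega)] at this
  have hdev := cdevS_eventuallyEq (m := m) (by omega)
  rw [← hr] at hdev
  have hdr := dev_isBigO (m := m) (by omega) le_rfl (hrO.trans hσ12.isBigO)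
  have hSS : expC m (cdevS m * cdevS m) =O[atTop] (ecoef σ) := by
    have h3 := expC_mul_dev_isBigO (by omega) hσ one_pos (by linarith) hrO hdr
    rw [add_sub_cancel_right] at h3
    exact h3.congr' (expC_congr (hdev.mul hdev)).symm EventuallyEq.rfl
  have hSN : expC m (cdevS m * cdevN m) =o[atTop] (ecoef (2 : ℝ)) := by
    have h3 := expC_mul_dev_isBigO (by omega) hσ two_pos (by linarith) hrO
      (cdevN_isBigO (m := m) (by omega))
    refine (h3.trans_isLittleO (ecoef_isLittleO (by linarith) (by linarith))).congr' ?_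
      EventuallyEq.rfl
    rw [mul_comm (cdevS m)]
    exact (expC_congr (EventuallyEq.rfl.mul hdev)).symm
  obtain ⟨c, hc⟩ := transfer_expansion (by omega) (covSS_eq_add_opT (by omega)) hσ (by linarith)
    hroot hSS
  -- The error tends to zero because `σ < 1`.
  have hlim : Tendsto (fun n : ℕ => covSS m n - c.re * (n + 1)) atTop (𝓝 0) := by
    have h3 := (re_isBigO_self _).trans_isLittleO (hc.trans_isLittleO hσ12)
    rw [show (ecoef (1 : ℝ)) = fun _ => (1 : ℝ) from funext ecoef_one, isLittleO_one_iff] at h3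
    refine h3.congr fun n => ?_
    simp [toC, ecoef_two]
  have hratio : Tendsto (fun n : ℕ => covSS m n / ((n : ℝ) + 1)) atTop (𝓝 c.re) := by
    have h3 := (hlim.mul tendsto_one_div_add_atTop_nhds_zero_nat).add_const c.re
    rw [mul_zero, zero_add] at h3
    refine h3.congr fun n => ?_
    field_simp; ring
  have hc0 : 0 ≤ c.re := ge_of_tendsto' hratio fun n => div_nonneg (covSS_nonneg n) (by positivity)
  -- A vanishing slope would force the variance to zero, against its positive lower bound.
  have hcpos : 0 < c.re := by
    refine lt_of_le_of_ne hc0 fun h => ?_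
    rw [← h] at hlim
    simp only [zero_mul, sub_zero] at hlim
    obtain ⟨δ, hδ, hle⟩ := exists_le_covSS hm
    have := ge_of_tendsto hlim ((eventually_ge_atTop (2 * m)).mono hle)
    linarith
  have hone : (fun _ : ℕ => (1 : ℝ)) =o[atTop] (fun n : ℕ => c.re * (n : ℝ)) :=
    isLittleO_const_left.mpr (Or.inr (tendsto_norm_atTop_atTop.comp
      (tendsto_natCast_atTop_atTop.const_mul_atTop hcpos)))
  refine ⟨c.re, hcpos, ?_, ?_⟩
  · have h3 := ((hlim.add_const c.re).isBigO_one ℝ).trans_isLittleO hone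
    refine h3.congr_left fun n => ?_
    simp only [Pi.sub_apply]; ring
  -- The toll is led by `opT` of the variance, which is `c • ecoef 2` up to smaller order, so it
  -- resonates.
  · have h3 := transfer_resonance (K := c) (by omega) (covSN_eq_add_opT (m := m) (by omega)) (by
      have h4 : (opT m (toC (covSS m)) - c • ecoef 2) =o[atTop] (ecoef (2 : ℝ)) := by
        refine ((opT_isBigO (m := m) (by omega) hσ hc).trans_isLittleO
          (ecoef_isLittleO hσ (by linarith))).congr' ?_ EventuallyEq.rfl
        filter_upwards [opT_ecoef_two (m := m) (by omega)] with n hn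
        rw [map_sub, map_smul]
        simp [hn]
      refine (h4.add hSN).congr_left fun n => ?_
      simp only [Pi.add_apply, Pi.sub_apply]; ring)
    have h4 := (re_isBigO_self _).trans_isLittleO h3
    have hphi := phi_pos (m := m) (by omega)
    have h5 : (covSN m) ~[atTop] (fun n => 2 * phi m * c.re * lcoef (2 : ℝ) n) := by
      have h6 : (fun n : ℕ => (n : ℝ) * Real.log n) =O[atTop]
          (fun n => 2 * phi m * c.re * lcoef (2 : ℝ) n) :=
        lcoef_two_equiv.symm.isBigO.trans (isBigO_self_const_mul (by positivity) _ _)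
      refine (h4.trans_isBigO h6).congr_left fun n => ?_
      simp [lcoef_two_ofReal, toC]
    refine (h5.trans ((IsEquivalent.refl (u := fun _ : ℕ => 2 * phi m * c.re)).mul
      lcoef_two_equiv)).congr_right (Eventually.of_forall fun n => ?_)
    simp only [Pi.mul_apply]; ring

end SmallArity

/-! ### The oscillating covariance for `m ≥ 14` -/

section LargeArity

variable {m : ℕ}

lemma exists_isSecondZero (hm : 14 ≤ m) : ∃ lam : ℂ, IsSecondZero m lam := by
  obtain ⟨z, hz, hz1, hzi⟩ := exists_root_re_gt_one hm
  have hz2 : z ≠ 2 := by rintro rfl; simp at hzi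
  have hfin : {z | indicial m z = 0 ∧ z ≠ 2}.Finite :=
    (finite_roots (m := m) (by omega)).subset fun z hz => hz.1
  obtain ⟨w, ⟨hw, hw2⟩, hmax⟩ := hfin.exists_maximalFor (fun z : ℂ => z.re) _ ⟨z, hz, hz2⟩
  have hle : ∀ v : ℂ, indicial m v = 0 → v ≠ 2 → v.re ≤ w.re := fun v hv hv2 => by
    by_contra hcon
    exact hcon (hmax ⟨hv, hv2⟩ (not_le.mp hcon).le)
  have hlt := re_lt_two_of_root (by omega) hw hw2
  have hpos : 0 < w.re := by linarith [hle z hz hz2]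
  have him := im_ne_zero_of_root (by omega) hw hw2 hpos
  rcases lt_or_gt_of_ne him with h | h
  · exact ⟨(starRingEnd ℂ) w, indicial_conj hw, by simpa using hlt, by simpa using h,
      by simpa using hle⟩
  · exact ⟨w, hw, hlt, h, hle⟩

namespace IsSecondZero

variable {lam : ℂ}

lemma one_lt_re (hm : 14 ≤ m) (h : IsSecondZero m lam) : 1 < lam.re := by
  obtain ⟨z, hz, hz1, hzi⟩ := exists_root_re_gt_one hm
  have hz2 : z ≠ 2 := by rintro rfl; simp at hzi
  exact hz1.trans_le (h.le_re z hz hz2)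

/-- Equal real parts force equal absolute imaginary parts, which leaves only `lam` and its conjugate
on the critical line. -/
lemma re_lt_of_root (hm : 2 ≤ m) (hpos : 0 < lam.re) (h : IsSecondZero m lam) {w : ℂ}
    (hw : indicial m w = 0) (h2 : w ≠ 2) (h3 : w ≠ lam) (h4 : w ≠ (starRingEnd ℂ) lam) :
    w.re < lam.re := by
  refine lt_of_le_of_ne (h.le_re w hw h2) fun e => ?_
  have h5 := im_sq_eq_of_re_eq hm hw h.zero e (by rwa [e])
  rcases sq_eq_sq_iff_eq_or_eq_neg.mp h5 with h6 | h6
  · exact h3 (Complex.ext e h6)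
  · exact h4 (Complex.ext (by simpa using e) (by simpa using h6))

lemma coeffA_conj (m : ℕ) (lam : ℂ) :
    coeffA m ((starRingEnd ℂ) lam) = (starRingEnd ℂ) (coeffA m lam) := by
  simp [coeffA, map_sum]

/-- The expansion of the deviation of `S` in the oscillating case. -/
lemma cdevS_expansion (hm : 14 ≤ m) (h : IsSecondZero m lam) :
    ∃ r : ℕ → ℂ, r =o[atTop] (ecoef lam.re) ∧
      cdevS m =ᶠ[compFilter m] coeffA m lam • dev m (ecoef lam)
        + coeffA m ((starRingEnd ℂ) lam) • dev m (ecoef ((starRingEnd ℂ) lam)) + dev m r := by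
  have h1 := h.one_lt_re hm
  obtain ⟨σ, hσ1, hσ2, hσ⟩ := exists_re_bound (m := m) (by omega) h1
  have hl2 : (2 : ℂ) ≠ lam := by
    rintro e
    have := h.im_pos
    rw [← e] at this; simp at this
  have hc2 : (2 : ℂ) ≠ (starRingEnd ℂ) lam := by
    rintro e
    have := congrArg Complex.im e
    simp at this
    exact h.im_pos.ne' this
  have hlc : lam ≠ (starRingEnd ℂ) lam := by
    rintro e
    have h2 := congrArg Complex.im e
    have := h.im_pos
    simp only [Complex.conj_im] at h2
    linarith
  have hexp := meanS_expansion (m := m) (by omega) (σ := σ) (by linarith)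
    {2, lam, (starRingEnd ℂ) lam} (by
      intro w hw
      simp only [mem_insert, mem_singleton] at hw
      rcases hw with rfl | rfl | rfl
      · exact ⟨indicial_two (by omega), by simp⟩
      · exact ⟨h.zero, by linarith⟩
      · exact ⟨indicial_conj h.zero, by rw [Complex.conj_re]; linarith⟩) (by
      intro w hw hwZ
      simp only [mem_insert, mem_singleton, not_or] at hwZ
      exact hσ w hw (h.re_lt_of_root (by omega) (by linarith) hw hwZ.1 hwZ.2.1 hwZ.2.2))
  rw [sum_insert (by simp [hl2, hc2]), sum_insert (by simp [hlc]), sum_singleton] at hexp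
  refine ⟨_, hexp.trans_isLittleO (ecoef_isLittleO (by linarith) hσ2), ?_⟩
  rw [cdevS_eq (by omega)]
  filter_upwards [dev_ecoef_two (m := m)] with p hp
  simp only [map_sub, map_add, map_smul, Pi.add_apply, Pi.sub_apply, Pi.smul_apply, hp,
    Pi.zero_apply, smul_zero]
  ring

end IsSecondZero

/-- The constant in the mixed moment of the two deviations. -/
noncomputable def mixedConst (m : ℕ) (w : ℂ) : ℂ :=
  1 / (2 * (phi m : ℂ)) - Complex.digamma (w + (m : ℂ)) +
    (w * Complex.digamma (w + 1) + ((m : ℂ) - 1) * (1 - (Real.eulerMascheroniConstant : ℂ))) /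
      (w + (m : ℂ) - 1)

lemma digamma_two : Complex.digamma 2 = 1 - Real.eulerMascheroniConstant := by
  have := Complex.digamma_apply_add_one 1 fun k hk => by
    have := congrArg Complex.re hk
    simp at this
    linarith [(k.cast_nonneg : (0 : ℝ) ≤ k)]
  rw [show (2 : ℂ) = 1 + 1 by norm_num, this, Complex.digamma_one]; simp; ring

lemma digamma_add_nat {s : ℂ} (hs : 0 < s.re) (k : ℕ) :
    Complex.digamma (s + k) = Complex.digamma s + hsum s k := by
  induction k with
  | zero => simp
  | succ k ih =>
    rw [Nat.cast_succ, ← add_assoc, Complex.digamma_apply_add_one, ih, hsum_succ, one_div,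
      add_assoc]
    intro j hj
    have := ne_neg_nat_of_re_pos hs (k + j)
    refine this ?_
    push_cast
    rw [← add_assoc, hj]; ring

lemma div_ecoef_add_one (hm : 1 ≤ m) {w : ℂ} (hw : 0 < w.re) (hroot : ecoef w (m - 1) = m) :
    m / ecoef (w + 1) (m - 1) = w / (w + m - 1) := by
  have hmm : (m : ℂ) ≠ 0 := by exact_mod_cast (by omega : m ≠ 0)
  have h1 := mul_ecoef_add_one w (m - 1)
  rw [hroot, Nat.cast_sub hm] at h1
  have hw0 : w ≠ 0 := by rintro rfl; simp at hw
  have h2 : w + m - 1 ≠ 0 := by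
    have := ne_neg_nat_of_re_pos hw (m - 1)
    rw [Nat.cast_sub hm] at this
    intro h; apply this; push_cast; linear_combination h
  have h3 : ecoef (w + 1) (m - 1) ≠ 0 :=
    ecoef_ne_zero (ne_neg_nat_of_re_pos (by simp; linarith)) _
  rw [div_eq_div_iff h3 h2]
  push_cast at h1
  linear_combination -h1

lemma ecoef_pred_of_root (hm : 1 ≤ m) {w : ℂ} (hw : indicial m w = 0) : ecoef w (m - 1) = m := by
  rw [indicial_eq hm] at hw
  have : ((m - 1).factorial : ℂ) ≠ 0 := by exact_mod_cast (m - 1).factorial_ne_zero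
  exact sub_eq_zero.mp ((mul_eq_zero.mp hw).resolve_left this)

lemma hsum_two_pred (hm : 2 ≤ m) : hsum (2 : ℂ) (m - 1) = 1 / (2 * (phi m : ℂ)) := by
  rw [← sum_inv_two hm, hsum]
  simp only [add_comm]

lemma mixedConst_eq (hm : 2 ≤ m) {w : ℂ} (hw : 0 < w.re) (hroot : indicial m w = 0) :
    mixedConst m w = 1 / (2 * (phi m : ℂ)) - hsum (w + 1) (m - 1)
      + (m / ecoef (w + 1) (m - 1) - 1)
        * (Complex.digamma (w + 1) + Real.eulerMascheroniConstant - 1) := by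
  have h2 : w + m - 1 ≠ 0 := by
    have := ne_neg_nat_of_re_pos hw (m - 1)
    rw [Nat.cast_sub (by omega)] at this
    intro h; apply this; push_cast; linear_combination h
  have h3 : Complex.digamma (w + m) = Complex.digamma (w + 1) + hsum (w + 1) (m - 1) := by
    rw [← digamma_add_nat (by simp; linarith), Nat.cast_sub (by omega)]
    congr 1; push_cast; ring
  rw [div_ecoef_add_one (by omega) hw (ecoef_pred_of_root (by omega) hroot), mixedConst, h3]
  field_simp; ring

/-- The product of the two extremal sequences. -/
lemma ecoef_mul_lcoef_two {w : ℂ} (hw : 0 < w.re) :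
    (ecoef w * lcoef 2 - w • (lcoef (w + 1)
      + (Complex.digamma (w + 1) + Real.eulerMascheroniConstant - 1) • ecoef (w + 1)))
      =o[atTop] (ecoef (w.re + 1)) := by
  have hw1 : (w + 1).re = w.re + 1 := by simp
  set δ := Complex.digamma (w + 1) + Real.eulerMascheroniConstant - 1 with hδ
  -- The logarithms cancel and the limit is `ψ(w + 1) - ψ(2)`, where `ψ(2) = 1 - γ`.
  have h1 : (fun n => hsum 2 n - hsum (w + 1) n - δ) =o[atTop] (ecoef (1 : ℝ)) := by
    have h2 := (tendsto_hsum_sub_log (s := 2) (by simp)).sub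
      (tendsto_hsum_sub_log (s := w + 1) (by simp; linarith))
    rw [digamma_two, show -(1 - (Real.eulerMascheroniConstant : ℂ)) - -Complex.digamma (w + 1) = δ
      by rw [hδ]; ring] at h2
    rw [show (ecoef (1 : ℝ)) = fun _ => (1 : ℝ) from funext ecoef_one, isLittleO_one_iff]
    have h3 := h2.sub_const δ
    rw [sub_self] at h3
    refine h3.congr fun n => by ring
  have h2 := mul_isLittleO_ecoef (by linarith) one_pos (by linarith)
    (hw1 ▸ isBigO_ecoef_self (s := w + 1) (by simp; linarith)) h1
  have h3 := mul_isLittleO_ecoef hw two_pos (by linarith) (isBigO_ecoef_self hw)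
    (hsum_isLittleO (s := 2) (by simp) one_lt_two)
  rw [show w.re + 1 + 1 - 1 = w.re + 1 by ring] at h2
  rw [show w.re + 2 - 1 = w.re + 1 by ring] at h3
  refine ((h2.const_smul_left w).add (h3.const_smul_left (1 - w))).congr_left fun n => ?_
  have h4 := mul_ecoef_add_one w n
  simp only [Pi.sub_apply, Pi.add_apply, Pi.mul_apply, Pi.smul_apply, smul_eq_mul, lcoef, ecoef_two]
  linear_combination (hsum 2 n) * h4

/-- The mixed moment of the deviations belonging to a zero `w` and to the double pole at `2`. -/
lemma expC_dev_ecoef_mul_dev_lcoef (hm : 2 ≤ m) {w : ℂ} (hw : 1 < w.re)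
    (hroot : indicial m w = 0) :
    (expC m (dev m (ecoef w) * dev m (lcoef 2)) - (w * mixedConst m w) • ecoef (w + 1))
      =o[atTop] (ecoef (w.re + 1)) := by
  have hw0 : 0 < w.re := by linarith
  have hk := ne_neg_nat_of_re_pos hw0
  have hk1 : ∀ k : ℕ, w + 1 + k ≠ 0 := ne_neg_nat_of_re_pos (by simp; linarith)
  have hk2 : ∀ k : ℕ, (2 : ℂ) + k ≠ 0 := ne_neg_nat_of_re_pos (by simp)
  set ρ := ecoef w * lcoef 2 - w • (lcoef (w + 1)
      + (Complex.digamma (w + 1) + Real.eulerMascheroniConstant - 1) • ecoef (w + 1)) with hρ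
  have hρo := ecoef_mul_lcoef_two hw0
  rw [← hρ] at hρo
  have hTρ := opT_isLittleO (m := m) (by omega) (by linarith) hρo
  have he : ((1 - w) • ecoef w) =o[atTop] (ecoef (w.re + 1)) :=
    ((isBigO_ecoef_self hw0).trans_isLittleO (ecoef_isLittleO hw0 (by linarith))).const_smul_left _
  refine ((hTρ.sub hρo).add (he.const_smul_left (1 / (2 * (phi m : ℂ))))).congr' ?_ EventuallyEq.rfl
  filter_upwards [expC_dev_mul_dev (m := m) (by omega) (ecoef w) (lcoef 2), eventually_ge_atTop m]
    with n hn hmn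
  have hmm : (m : ℂ) ≠ 0 := by exact_mod_cast (by omega : m ≠ 0)
  have hrm := ecoef_pred_of_root (by omega) hroot
  have hT1 : opT m (ecoef w) n = ecoef w n := by
    rw [opT_ecoef (by omega) hk (by omega), hrm, div_self hmm, one_mul]
  have hT2 : opT m (lcoef 2) n = ecoef 2 n * (hsum 2 n - 1 / (2 * (phi m : ℂ))) := by
    rw [opT_lcoef (by omega) hk2 (by omega), ecoef_two_pred (by omega), div_self hmm, one_mul,
      hsum_two_pred hm]
  have hprod : ecoef w * lcoef 2 = w • (lcoef (w + 1)
      + (Complex.digamma (w + 1) + Real.eulerMascheroniConstant - 1) • ecoef (w + 1)) + ρ := by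
    rw [hρ]; abel
  have hT3 : opT m (ecoef w * lcoef 2) n = w * (m / ecoef (w + 1) (m - 1) *
      (ecoef (w + 1) n * (hsum (w + 1) n - hsum (w + 1) (m - 1)))
      + (Complex.digamma (w + 1) + Real.eulerMascheroniConstant - 1) *
        (m / ecoef (w + 1) (m - 1) * ecoef (w + 1) n)) + opT m ρ n := by
    rw [hprod]
    simp only [map_add, map_smul, Pi.add_apply, Pi.smul_apply, smul_eq_mul]
    rw [opT_lcoef (by omega) hk1 (by omega), opT_ecoef (by omega) hk1 (by omega)]
  have hP := congrFun hprod n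
  have h5 := mul_ecoef_add_one w n
  -- This identity cancels the logarithmic terms: equal indices contribute the weight `w`, distinct
  -- ones `m - 1`.
  have hκ : m / ecoef (w + 1) (m - 1) * (w + m - 1) = w := by
    rw [div_ecoef_add_one (by omega) hw0 hrm]
    refine div_mul_cancel₀ _ fun h => ?_
    have := ne_neg_nat_of_re_pos hw0 (m - 1)
    rw [Nat.cast_sub (by omega)] at this
    apply this; push_cast; linear_combination h
  simp only [Pi.add_apply, Pi.sub_apply, Pi.mul_apply, Pi.smul_apply, smul_eq_mul] at hn hP ⊢
  rw [hn, expI_ecoef_mul_lcoef hm hk (by omega),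
    show (fun n => ecoef w n * lcoef 2 n) = ecoef w * lcoef 2 from rfl, hT3, hT1, hT2,
    mixedConst_eq hm hw0 hroot,
    show (m : ℂ) * (m - 1) / ecoef (w + 1) (m - 1) = (m - 1) * (m / ecoef (w + 1) (m - 1)) by ring]
  simp only [lcoef, ecoef_two] at hP ⊢
  linear_combination hP - ecoef (w + 1) n * (hsum (w + 1) n - hsum (w + 1) (m - 1)) * hκ
    + 1 / (2 * (phi m : ℂ)) * h5

lemma particular_coefficient (hm : 2 ≤ m) {w : ℂ} (hw : 0 < w.re) (hroot : indicial m w = 0) :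
    1 - m / ecoef (w + 1) (m - 1) = ((m : ℂ) - 1) / (w + m - 1) ∧
      ((m : ℂ) - 1) / (w + m - 1) ≠ 0 := by
  have h2 : w + m - 1 ≠ 0 := by
    have := ne_neg_nat_of_re_pos hw (m - 1)
    rw [Nat.cast_sub (by omega)] at this
    intro h; apply this; push_cast; linear_combination h
  have hm1 : (m : ℂ) - 1 ≠ 0 := by
    rw [sub_ne_zero]; exact_mod_cast (by omega : m ≠ 1)
  rw [div_ecoef_add_one (by omega) hw (ecoef_pred_of_root (by omega) hroot)]
  exact ⟨by field_simp; ring, div_ne_zero hm1 h2⟩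

/-- At a zero `opT` eventually fixes `ecoef w`, so its deviation has mean zero and the part of the
deviation of `N` depending only on `n` drops out. -/
lemma expC_dev_ecoef_mul_cdevN (hm : 2 ≤ m) {w : ℂ} (hw : 1 < w.re) (hroot : indicial m w = 0) :
    (expC m (dev m (ecoef w) * cdevN m)
        - (2 * phi m ^ 2 * (w * mixedConst m w)) • ecoef (w + 1))
      =o[atTop] (ecoef (w.re + 1)) := by
  have hw0 : 0 < w.re := by linarith
  set V := cdevN m - (2 * phi m ^ 2 : ℂ) • dev m (lcoef 2) - fun p => phi m * ecoef (2 : ℂ) p.1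
    with hV
  have hVo := cdevN_expansion (m := m) hm
  rw [← hV] at hVo
  have hX := dev_isBigO (m := m) (by omega) hw.le (isBigO_ecoef_self hw0)
  have hE := (ecoef_mul_isTheta hw0 two_pos (by linarith)).isBigO.comp_tendsto
    (tendsto_fst_compFilter (m := m))
  have h1 := expC_isLittleO (m := m) (g := ecoef (w.re + 2 - 1)) (by omega)
    ((hX.mul_isLittleO hVo).trans_isBigO hE)
  rw [show w.re + 2 - 1 = w.re + 1 by ring] at h1
  have h2 := (expC_dev_ecoef_mul_dev_lcoef hm hw hroot).const_smul_left (2 * phi m ^ 2 : ℂ)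
  refine (h1.add h2).congr' ?_ EventuallyEq.rfl
  have hsplit : dev m (ecoef w) * cdevN m = (fun p => dev m (ecoef w) p * V p)
      + (2 * phi m ^ 2 : ℂ) • (dev m (ecoef w) * dev m (lcoef 2))
      + dev m (ecoef w) * fun p => phi m * ecoef (2 : ℂ) p.1 := by
    ext p
    simp only [hV, Pi.add_apply, Pi.sub_apply, Pi.mul_apply, Pi.smul_apply, smul_eq_mul]; ring
  filter_upwards [expC_dev (m := m) (by omega) (ecoef w), eventually_ge_atTop m] with n hn hmn
  have hmm : (m : ℂ) ≠ 0 := by exact_mod_cast (by omega : m ≠ 0)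
  have hT1 : opT m (ecoef w) n = ecoef w n := by
    rw [opT_ecoef (by omega) (ne_neg_nat_of_re_pos hw0) (by omega),
      ecoef_pred_of_root (by omega) hroot, div_self hmm, one_mul]
  rw [Pi.sub_apply, hT1, sub_self] at hn
  rw [hsplit, expC_add, expC_add, expC_smul,
    expC_mul_fst (dev m (ecoef w)) (fun n => phi m * ecoef (2 : ℂ) n)]
  simp only [Pi.add_apply, Pi.sub_apply, Pi.mul_apply, Pi.smul_apply, smul_eq_mul, hn]
  ring

lemma expC_conj (F : ℕ × (Fin m → ℕ) → ℂ) (n : ℕ) :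
    (starRingEnd ℂ) (expC m F n) = expC m (fun p => (starRingEnd ℂ) (F p)) n := by
  simp [expC, expI, map_sum]

lemma dev_ecoef_conj (w : ℂ) (p : ℕ × (Fin m → ℕ)) :
    (starRingEnd ℂ) (dev m (ecoef w) p) = dev m (ecoef ((starRingEnd ℂ) w)) p := by
  simp [dev_apply, map_sum, conj_ecoef]

variable {lam : ℂ}

lemma IsSecondZero.cdevS_isBigO (hm : 14 ≤ m) (h : IsSecondZero m lam) :
    cdevS m =O[compFilter m] (fun p => ecoef lam.re p.1) := by
  obtain ⟨r, hr, hS⟩ := h.cdevS_expansion hm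
  have h1 := h.one_lt_re hm
  have hX := dev_isBigO (m := m) (by omega) h1.le
    (isBigO_ecoef_self (s := lam) (by linarith))
  have hX' := dev_isBigO (m := m) (by omega) h1.le
    (by simpa using isBigO_ecoef_self (s := (starRingEnd ℂ) lam) (by simp; linarith))
  have hr' := dev_isBigO (m := m) (by omega) h1.le hr.isBigO
  exact (((hX.const_smul_left _).add (hX'.const_smul_left _)).add hr').congr' hS.symm
    EventuallyEq.rfl

/-- The toll is of the order of `ecoef (2 α - 1)`, where `α = lam.re`. Since `1 < α < 2`, both `2 α
- 1` and the exponent `2` needed for the transfer lie below `α + 1`. -/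
lemma IsSecondZero.covSS_isLittleO (hm : 14 ≤ m) (h : IsSecondZero m lam) :
    toC (covSS m) =o[atTop] (ecoef (lam.re + 1)) := by
  have h1 := h.one_lt_re hm
  have h2 := h.re_lt
  obtain ⟨τ, hτ1, hτ2⟩ := exists_between (show max 2 (lam.re + lam.re - 1) < lam.re + 1 from
    max_lt (by linarith) (by linarith))
  have hτ3 := (le_max_left _ _).trans_lt hτ1
  have hτ4 := (le_max_right _ _).trans_lt hτ1
  have hS := h.cdevS_isBigO hm
  have hE := (ecoef_mul_isTheta (s := lam.re) (t := lam.re) (by linarith) (by linarith)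
    (by linarith)).isBigO.comp_tendsto (tendsto_fst_compFilter (m := m))
  have h3 := expC_isBigO (m := m) (g := ecoef (lam.re + lam.re - 1)) (by omega)
    ((hS.mul hS).trans hE)
  have h4 := transfer_isBigO (by omega) (covSS_eq_add_opT (m := m) (by omega)) hτ3
    (h3.trans (ecoef_isBigO_of_le (by linarith) hτ4.le))
  exact h4.trans_isLittleO (ecoef_isLittleO (by linarith) hτ2)

/-- The amplitude of the oscillation of the covariance. -/
noncomputable def amplitude (m : ℕ) (lam : ℂ) : ℂ :=
  coeffA m lam * (2 * phi m ^ 2 * (lam * mixedConst m lam))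

lemma IsSecondZero.toll_expansion (hm : 14 ≤ m) (h : IsSecondZero m lam) :
    (expC m (cdevS m * cdevN m) - amplitude m lam • ecoef (lam + 1)
      - (starRingEnd ℂ) (amplitude m lam) • ecoef ((starRingEnd ℂ) lam + 1))
      =o[atTop] (ecoef (lam.re + 1)) := by
  have h1 := h.one_lt_re hm
  obtain ⟨r, hr, hS⟩ := h.cdevS_expansion hm
  have hr' := dev_isLittleO (m := m) (by omega) h1 hr
  have hE := (ecoef_mul_isTheta (s := lam.re) (t := 2) (by linarith) two_pos
    (by linarith)).isBigO.comp_tendsto (tendsto_fst_compFilter (m := m))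
  have h3 := expC_isLittleO (m := m) (g := ecoef (lam.re + 2 - 1)) (by omega)
    ((hr'.mul_isBigO (cdevN_isBigO (m := m) (by omega))).trans_isBigO hE)
  rw [show lam.re + 2 - 1 = lam.re + 1 by ring] at h3
  have h4 := (expC_dev_ecoef_mul_cdevN (m := m) (by omega) h1 h.zero).const_smul_left
    (coeffA m lam)
  have h5 : (fun n => (starRingEnd ℂ) ((coeffA m lam • (expC m (dev m (ecoef lam) * cdevN m)
      - (2 * phi m ^ 2 * (lam * mixedConst m lam)) • ecoef (lam + 1))) n))
      =o[atTop] (ecoef (lam.re + 1)) :=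
    IsLittleO.of_norm_left (h4.norm_left.congr_left fun n => (Complex.norm_conj _).symm)
  refine ((h3.add h4).add h5).congr' ?_ EventuallyEq.rfl
  filter_upwards [expC_congr (hS.mul (EventuallyEq.refl _ (cdevN m)))] with n hn
  have hsplit : (coeffA m lam • dev m (ecoef lam)
        + coeffA m ((starRingEnd ℂ) lam) • dev m (ecoef ((starRingEnd ℂ) lam)) + dev m r)
        * cdevN m
      = coeffA m lam • (dev m (ecoef lam) * cdevN m)
        + coeffA m ((starRingEnd ℂ) lam) • (dev m (ecoef ((starRingEnd ℂ) lam)) * cdevN m)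
        + fun p => dev m r p * cdevN m p := by
    ext p
    simp only [Pi.add_apply, Pi.mul_apply, Pi.smul_apply, smul_eq_mul]; ring
  have hconj : (starRingEnd ℂ) (expC m (dev m (ecoef lam) * cdevN m) n)
      = expC m (dev m (ecoef ((starRingEnd ℂ) lam)) * cdevN m) n := by
    rw [expC_conj]
    congr 1
    ext p
    rw [Pi.mul_apply, map_mul, dev_ecoef_conj, cdevN, Complex.conj_ofReal]; rfl
  have hn' := hn
  rw [hsplit, expC_add, expC_add, expC_smul, expC_smul, IsSecondZero.coeffA_conj] at hn'
  simp only [Pi.add_apply, Pi.sub_apply, Pi.smul_apply, smul_eq_mul] at hn' ⊢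
  rw [hn']
  simp only [map_mul, map_sub, hconj, conj_ecoef, amplitude, map_add, map_one]
  ring

/-- The covariance for `m ≥ 14`. -/
theorem IsSecondZero.covSN_asymptotics (hm : 14 ≤ m) (h : IsSecondZero m lam) :
    (fun n : ℕ => covSN m n - phi m * F2 m lam (lam.im * Real.log (n : ℝ)) * (n : ℝ) ^ lam.re)
      =o[atTop] (fun n : ℕ => (n : ℝ) ^ lam.re) := by
  have h1 := h.one_lt_re hm
  have hlam0 : 0 < lam.re := by linarith
  obtain ⟨hk, hk0⟩ := particular_coefficient (m := m) (by omega) hlam0 h.zero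
  obtain ⟨hk', hk0'⟩ := particular_coefficient (m := m) (w := (starRingEnd ℂ) lam) (by omega)
    (by simpa using hlam0) (indicial_conj h.zero)
  -- The two conjugate modes, with parameters shifted by one, are removed in turn; each is divided
  -- by `(m - 1) / (w + m - 1)` for its own zero `w`.
  obtain ⟨b₁, hb₁, ha₁⟩ := transfer_particular (K := amplitude m lam) (w := lam + 1) (by omega)
    (covSN_eq_add_opT (m := m) (by omega)) (by simp; linarith) (by rwa [hk])
  obtain ⟨b₂, hb₂, ha₂⟩ := transfer_particular (K := (starRingEnd ℂ) (amplitude m lam))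
    (w := (starRingEnd ℂ) lam + 1) (by omega) ha₁ (by simp; linarith) (by rwa [hk'])
  have hb : b₂ =o[atTop] (ecoef (lam.re + 1)) := by
    have h2 := opT_isLittleO (m := m) (by omega) (by linarith) (h.covSS_isLittleO hm)
    refine (h2.add (h.toll_expansion hm)).congr' ?_ EventuallyEq.rfl
    filter_upwards [hb₁, hb₂] with n hn hn'
    rw [hn']
    simp only [Pi.add_apply, Pi.sub_apply, hn]; ring
  have h3 := transfer_isLittleO (by omega) ha₂ (by linarith) hb
  rw [hk, hk'] at h3
  set c := amplitude m lam / (((m : ℂ) - 1) / (lam + m - 1)) with hc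
  have hcc : (starRingEnd ℂ) (amplitude m lam)
      / (((m : ℂ) - 1) / ((starRingEnd ℂ) lam + m - 1)) = (starRingEnd ℂ) c := by
    simp [hc]
  rw [hcc] at h3
  have hth : (ecoef (lam.re + 1)) =O[atTop] (fun n : ℕ => (n : ℝ) ^ lam.re) := by
    have := (ecoef_isTheta_rpow (s := lam.re + 1) (by linarith)).isBigO
    rwa [add_sub_cancel_right] at this
  have h4 := (re_isBigO_self _).trans_isLittleO (h3.trans_isBigO hth)
  have hG := Complex.Gamma_ne_zero_of_re_pos hlam0
  have hl0 : lam ≠ 0 := by rintro rfl; simp at hlam0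
  have h5 : (fun n : ℕ => ecoef (lam + 1) n - (n : ℂ) ^ lam / (lam * Complex.Gamma lam))
      =o[atTop] (fun n : ℕ => (n : ℂ) ^ lam) := by
    have h6 := tendsto_ecoef_div_cpow (s := lam + 1) (ne_neg_nat_of_re_pos (by simp; linarith))
    rw [add_sub_cancel_right, Complex.Gamma_add_one _ hl0] at h6
    have h7 := h6.sub_const (1 / (lam * Complex.Gamma lam))
    rw [sub_self] at h7
    refine (isLittleO_iff_tendsto' ?_).mpr (h7.congr' ?_)
    · filter_upwards [eventually_ge_atTop 1] with n hn h0
      rw [Complex.cpow_eq_zero_iff] at h0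
      exact absurd h0.1 (by exact_mod_cast (by omega : n ≠ 0))
    · filter_upwards [eventually_ge_atTop 1] with n hn
      have : (n : ℂ) ^ lam ≠ 0 := by
        rw [Ne, Complex.cpow_eq_zero_iff, not_and_or]
        exact Or.inl (by exact_mod_cast (by omega : n ≠ 0))
      field_simp
  have h6 : (fun n : ℕ => ecoef (lam + 1) n - (n : ℂ) ^ lam / (lam * Complex.Gamma lam))
      =o[atTop] (fun n : ℕ => (n : ℝ) ^ lam.re) := by
    refine h5.trans_isBigO (IsBigO.of_bound 1 ?_)
    filter_upwards [eventually_ge_atTop 1] with n hn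
    rw [Complex.norm_natCast_cpow_of_pos hn, one_mul]
    exact le_abs_self _
  have h7 := (re_isBigO_self _).trans_isLittleO (h6.const_mul_left (2 * c))
  refine (h4.add h7).congr' ?_ EventuallyEq.rfl
  filter_upwards [eventually_ge_atTop 1] with n hn
  have hn0 : (0 : ℝ) < n := by exact_mod_cast hn
  have hpow : (n : ℂ) ^ lam
      = ((n : ℝ) ^ lam.re : ℝ) * Complex.exp (Complex.I * ((lam.im * Real.log n : ℝ) : ℂ)) := by
    rw [Complex.cpow_def_of_ne_zero (by exact_mod_cast (by omega : n ≠ 0)),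
      Real.rpow_def_of_pos hn0, Complex.ofReal_exp, ← Complex.exp_add]
    congr 1
    rw [← Complex.natCast_log]
    conv_lhs => rw [← Complex.re_add_im lam]
    push_cast; ring
  -- The two conjugate modes add up to twice a real part, and the factor `lam` of the amplitude
  -- cancels against `Γ(lam + 1) = lam Γ(lam)`.
  have hF : phi m * F2 m lam (lam.im * Real.log n) * (n : ℝ) ^ lam.re
      = (2 * c * ((n : ℂ) ^ lam / (lam * Complex.Gamma lam))).re := by
    have e : 2 * c * ((n : ℂ) ^ lam / (lam * Complex.Gamma lam))
        = ((phi m * (4 * phi m) * (n : ℝ) ^ lam.re : ℝ) : ℂ) *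
          ((lam + (m : ℂ) - 1) * coeffA m lam
            * Complex.exp (Complex.I * ((lam.im * Real.log n : ℝ) : ℂ)) /
            (((m : ℂ) - 1) * Complex.Gamma lam) * mixedConst m lam) := by
      rw [hpow, hc, amplitude]
      push_cast
      field_simp
      ring
    rw [e, Complex.re_ofReal_mul, F2]
    unfold mixedConst
    ring
  have hcr : ((starRingEnd ℂ) c * ecoef ((starRingEnd ℂ) lam + 1) n).re
      = (c * ecoef (lam + 1) n).re := by
    rw [← Complex.conj_re (c * ecoef (lam + 1) n), map_mul, conj_ecoef, map_add, map_one]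
  have htwo : ∀ x : ℂ, (2 * c * x).re = 2 * (c * x).re := fun x => by
    rw [mul_assoc, ← Complex.ofReal_ofNat, Complex.re_ofReal_mul]
  rw [hF]
  simp only [Pi.sub_apply, Pi.smul_apply, smul_eq_mul, Complex.sub_re, hcr, toC,
    Complex.ofReal_re, htwo, mul_sub]
  ring

end LargeArity

/-! ### Positivity of the constant `CK` -/

section Constants

variable {m : ℕ}

lemma H2_succ (n : ℕ) : H2 (n + 1) = H2 n + 1 / ((n : ℝ) + 1) ^ 2 := by
  rw [H2, sum_Icc_succ_top (by omega), H2]; push_cast; rfl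

lemma tendsto_H2 : Tendsto H2 atTop (𝓝 (Real.pi ^ 2 / 6)) := by
  have h := hasSum_zeta_two.tendsto_sum_nat.comp (tendsto_add_atTop_nat 1)
  refine h.congr fun n => ?_
  induction n with
  | zero => simp [H2]
  | succ n ih =>
    rw [H2_succ, ← ih, Function.comp_apply, sum_range_succ]; simp

lemma hsumSq_three (n : ℕ) : hsumSq (3 : ℝ) n = H2 (n + 2) - 5 / 4 := by
  induction n with
  | zero => rw [H2_succ, H2_succ]; norm_num [H2]
  | succ n ih =>
    rw [hsumSq_succ, ih, show n + 1 + 2 = (n + 2) + 1 by ring, H2_succ (n + 2)]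
    push_cast
    rw [show (3 : ℝ) + n = n + 2 + 1 by ring]; ring

/-- The sequence `H2 n + 1 / n` decreases to `π ^ 2 / 6`. -/
lemma zeta_two_le (hm : 1 ≤ m) : Real.pi ^ 2 / 6 ≤ H2 m + 1 / m := by
  have h : ∀ n, m ≤ n → H2 n + 1 / (n : ℝ) ≤ H2 m + 1 / m := by
    intro n hn
    induction n, hn using Nat.le_induction with
    | base => exact le_rfl
    | succ n hn ih =>
      refine le_trans ?_ ih
      have hn0 : (0 : ℝ) < n := by exact_mod_cast (by omega : 0 < n)
      rw [H2_succ]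
      have e : H2 n + 1 / (n : ℝ) - (H2 n + 1 / ((n : ℝ) + 1) ^ 2 + 1 / ((n + 1 : ℕ) : ℝ))
          = 1 / (n * ((n : ℝ) + 1) ^ 2) := by
        push_cast; field_simp; ring
      have : 0 < 1 / (n * ((n : ℝ) + 1) ^ 2) := by positivity
      linarith
  refine le_of_tendsto tendsto_H2 ((eventually_ge_atTop m).mono fun n hn => ?_)
  have : (0 : ℝ) ≤ 1 / n := by positivity
  linarith [h n hn]

/-- The bound `π ^ 2 / 6 ≤ H2 m + 1 / m` reduces the claim to `2 * H2 m - 3 + 1 / m > 0`. This holds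
at `m = 3`, and the left side does not decrease. -/
lemma CK_pos (hm : 3 ≤ m) : 0 < CK m := by
  have h1 : 0 < 2 * H2 m - 3 + 1 / m := by
    induction m, hm using Nat.le_induction with
    | base => rw [H2_succ, H2_succ, H2_succ]; norm_num [H2]
    | succ n hn ih =>
      have hn0 : (3 : ℝ) ≤ n := by exact_mod_cast hn
      have e : 2 * H2 (n + 1) - 3 + 1 / ((n + 1 : ℕ) : ℝ) - (2 * H2 n - 3 + 1 / n)
          = ((n : ℝ) - 1) / (n * ((n : ℝ) + 1) ^ 2) := by
        rw [H2_succ]; push_cast; field_simp; ring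
      have : 0 ≤ ((n : ℝ) - 1) / (n * ((n : ℝ) + 1) ^ 2) :=
        div_nonneg (by linarith) (by positivity)
      linarith
  have h2 := zeta_two_le (m := m) (by omega)
  have hm0 : (3 : ℝ) ≤ m := by exact_mod_cast hm
  have hphi := phi_pos (m := m) (by omega)
  rw [CK]
  refine mul_pos (by positivity) (sub_pos.mpr ?_)
  rw [lt_div_iff₀ (by linarith)]
  calc Real.pi ^ 2 / 6 * ((m : ℝ) - 1) ≤ (H2 m + 1 / m) * (m - 1) := by
        gcongr; linarith
    _ < ((m : ℝ) + 1) * H2 m - 2 := by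
        have : (H2 m + 1 / m) * ((m : ℝ) - 1) = (m - 1) * H2 m + 1 - 1 / m := by
          field_simp; ring
        rw [this]; linarith

end Constants

/-! ### The variance of the node path length -/

section PathLength

variable {m : ℕ}

lemma hsum_two_eq (n : ℕ) : hsum (2 : ℂ) n = hsum 3 n + 1 / 2 - 1 / ((n : ℂ) + 2) := by
  have h1 := hsum_succ (2 : ℂ) n
  have h2 : hsum (2 : ℂ) (n + 1) = 1 / 2 + hsum 3 n := by
    rw [add_comm n 1, hsum_add]; norm_num [hsum]
  rw [add_comm (n : ℂ)]
  linear_combination h2 - h1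

lemma hsumSq_three_complex (n : ℕ) : hsumSq (3 : ℂ) n = ((H2 (n + 2) - 5 / 4 : ℝ) : ℂ) := by
  rw [← hsumSq_three]; simp [hsumSq]

lemma hsumSq_three_sub_isLittleO :
    (fun n => hsumSq (3 : ℂ) n - ((Real.pi ^ 2 / 6 - 5 / 4 : ℝ) : ℂ)) =o[atTop]
      (ecoef (1 : ℝ)) := by
  rw [show (ecoef (1 : ℝ)) = fun _ => (1 : ℝ) from funext ecoef_one, isLittleO_one_iff]
  have h := (tendsto_H2.comp (tendsto_add_atTop_nat 2)).sub_const (Real.pi ^ 2 / 6)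
  rw [sub_self] at h
  have h2 := (Complex.continuous_ofReal.tendsto 0).comp h
  rw [Complex.ofReal_zero] at h2
  refine h2.congr fun n => ?_
  simp only [Function.comp_apply]
  rw [hsumSq_three_complex]; push_cast; ring

lemma ecoef_two_mul_isLittleO {g : ℕ → ℂ} (hg : g =o[atTop] (ecoef (2 : ℝ))) :
    (ecoef 2 * g) =o[atTop] (ecoef (3 : ℝ)) := by
  have := mul_isLittleO_ecoef two_pos two_pos (by norm_num)
    (isBigO_ecoef_self (s := 2) (by simp)) hg
  norm_num at this
  exact this

lemma sq_isLittleO_two {g : ℕ → ℂ} (hg : g =o[atTop] (ecoef (3 / 2 : ℝ))) :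
    (g * g) =o[atTop] (ecoef (2 : ℝ)) := by
  have := mul_isLittleO_ecoef (by norm_num) (by norm_num) (by norm_num) hg.isBigO hg
  norm_num at this
  exact this

lemma hsum_sub_isLittleO {s : ℂ} (hs : 0 < s.re) (c : ℂ) {τ : ℝ} (hτ : 1 < τ) :
    (fun n => hsum s n - c) =o[atTop] (ecoef τ) :=
  (hsum_isLittleO hs hτ).sub (const_isLittleO_ecoef hτ c)

/-- Up to smaller order, `(n + 1) ^ 2` is `2 * ecoef 3` and `hsum 2` is `hsum 3 + 1 / 2`. The
constant is the limit `π ^ 2 / 6 - 5 / 4` of `hsumSq 3` plus the `1 / 4` from the square. -/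
lemma lcoef_two_sq :
    (lcoef (2 : ℂ) * lcoef 2 - (2 : ℂ) • (qcoef 3 + lcoef 3
      + ((Real.pi ^ 2 / 6 - 1 : ℝ) : ℂ) • ecoef 3)) =o[atTop] (ecoef (3 : ℝ)) := by
  have h1 := ecoef_two_mul_isLittleO (sq_isLittleO_two
    (hsum_isLittleO (s := 2) (τ := 3 / 2) (by simp) (by norm_num)))
  have h2 := ecoef_two_mul_isLittleO ((hsum_sub_isLittleO (s := 2) (by simp) (-(1 / 2))
    one_lt_two).add (hsum_isLittleO (s := 3) (by simp) one_lt_two))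
  have h3 := mul_isLittleO_ecoef (by norm_num) one_pos (by norm_num)
    (isBigO_ecoef_self (s := 3) (by simp)) hsumSq_three_sub_isLittleO
  norm_num at h3
  refine (((h3.const_smul_left (2 : ℂ)).sub h1).sub h2).congr_left fun n => ?_
  have hn : (n : ℂ) + 2 ≠ 0 := by
    have := ne_neg_nat_of_re_pos (s := 2) (by simp) n
    rwa [add_comm]
  simp only [Pi.add_apply, Pi.sub_apply, Pi.mul_apply, Pi.smul_apply, smul_eq_mul, lcoef, qcoef,
    ecoef_two, ecoef_three, hsum_two_eq]
  push_cast
  field_simp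
  ring

lemma ecoef_three_pred (hm : 1 ≤ m) : m / ecoef (3 : ℂ) (m - 1) = 2 / (m + 1) := by
  obtain ⟨k, rfl⟩ : ∃ k, m = k + 1 := ⟨m - 1, by omega⟩
  have h1 : (k : ℂ) + 1 ≠ 0 := Nat.cast_add_one_ne_zero k
  have h2 : (k : ℂ) + 2 ≠ 0 := by
    have := Nat.cast_add_one_ne_zero (R := ℂ) (k + 1)
    push_cast at this
    rwa [add_assoc, one_add_one_eq_two] at this
  have h3 : (k : ℂ) + 1 + 1 ≠ 0 := by rwa [add_assoc, one_add_one_eq_two]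
  rw [ecoef_three, Nat.add_sub_cancel]; push_cast; field_simp; ring

/-- The constant in the variance of the conditional mean of the path length. -/
noncomputable def pathConst (m : ℕ) : ℝ :=
  2 * ((m : ℝ) - 1) / (m + 1) * ((((m : ℝ) + 1) * H2 m - 2) / ((m : ℝ) - 1) - Real.pi ^ 2 / 6)

/-- This is the variance of the sum of `lcoef 2` over the subtree sizes. The terms with `hsum` and
its square cancel to leading order, which leaves a constant multiple of `ecoef 3`. -/
lemma expI_lcoef_sq_sub (hm : 2 ≤ m) :
    ((fun n => expI m n fun I => (∑ i, lcoef (2 : ℂ) (I i)) * ∑ i, lcoef 2 (I i))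
      - opT m (lcoef 2) * opT m (lcoef 2) - (pathConst m : ℂ) • ecoef 3)
      =o[atTop] (ecoef (3 : ℝ)) := by
  have hk2 : ∀ k : ℕ, (2 : ℂ) + k ≠ 0 := ne_neg_nat_of_re_pos (by simp)
  have hk3 : ∀ k : ℕ, (3 : ℂ) + k ≠ 0 := ne_neg_nat_of_re_pos (by simp)
  set ρ := lcoef (2 : ℂ) * lcoef 2 - (2 : ℂ) • (qcoef 3 + lcoef 3
      + ((Real.pi ^ 2 / 6 - 1 : ℝ) : ℂ) • ecoef 3) with hρ
  have hρo := lcoef_two_sq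
  rw [← hρ] at hρo
  have hTρ := opT_isLittleO (m := m) (by omega) (by norm_num) hρo
  set c := hsum (2 : ℂ) (m - 1) with hc
  have h1 := ecoef_two_mul_isLittleO (sq_isLittleO_two
    (hsum_sub_isLittleO (s := 2) (τ := 3 / 2) (by simp) c (by norm_num)))
  have h2 := ecoef_two_mul_isLittleO ((hsum_sub_isLittleO (s := 2) (by simp) c
    one_lt_two).add (hsum_sub_isLittleO (s := 3) (by simp) (c - 1 / 2) one_lt_two))
  have h3 := mul_isLittleO_ecoef (by norm_num) one_pos (by norm_num)
    (isBigO_ecoef_self (s := 3) (by simp)) hsumSq_three_sub_isLittleO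
  norm_num at h3
  refine (((hTρ.add h1).add h2).sub (h3.const_smul_left (2 : ℂ))).congr' ?_ EventuallyEq.rfl
  filter_upwards [eventually_ge_atTop m] with n hmn
  have hmm : (m : ℂ) ≠ 0 := by exact_mod_cast (by omega : m ≠ 0)
  have hm1 : (m : ℂ) + 1 ≠ 0 := Nat.cast_add_one_ne_zero m
  have hm1' : (m : ℂ) - 1 ≠ 0 := by
    rw [sub_ne_zero]; exact_mod_cast (by omega : m ≠ 1)
  have hn : (n : ℂ) + 2 ≠ 0 := by
    have := ne_neg_nat_of_re_pos (s := 2) (by simp) n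
    rwa [add_comm]
  have hT2 : opT m (lcoef 2) n = ecoef 2 n * (hsum 2 n - c) := by
    rw [opT_lcoef (by omega) hk2 (by omega), ecoef_two_pred (by omega), div_self hmm, one_mul]
  have hprod : lcoef (2 : ℂ) * lcoef 2 = (2 : ℂ) • (qcoef 3 + lcoef 3
      + ((Real.pi ^ 2 / 6 - 1 : ℝ) : ℂ) • ecoef 3) + ρ := by
    rw [hρ]; abel
  have hη : hsum (3 : ℂ) (m - 1) = c - 1 / 2 + 1 / (m + 1) := by
    rw [hc, hsum_two_eq, Nat.cast_sub (by omega)]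
    push_cast
    rw [show (m : ℂ) - 1 + 2 = m + 1 by ring]; ring
  have hη2 : hsumSq (3 : ℂ) (m - 1) = (H2 m : ℂ) + 1 / (m + 1) ^ 2 - 5 / 4 := by
    rw [hsumSq_three_complex, show m - 1 + 2 = m + 1 by omega, H2_succ]; push_cast; ring
  have hT3 := congrFun (congrArg (opT m) hprod) n
  simp only [map_add, map_smul, Pi.add_apply, Pi.smul_apply, smul_eq_mul] at hT3
  rw [opT_lcoef (by omega) hk3 (by omega), opT_ecoef (by omega) hk3 (by omega),
    opT_qcoef (by omega) hk3 (by omega), ecoef_three_pred (by omega), hη, hη2] at hT3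
  simp only [Pi.sub_apply, Pi.mul_apply, Pi.smul_apply, smul_eq_mul]
  rw [expI_lcoef_mul_lcoef hm (by omega),
    show (fun n => lcoef (2 : ℂ) n * lcoef 2 n) = lcoef (2 : ℂ) * lcoef 2 from rfl, hT3, hT2, hη,
    hη2,
    show (m : ℂ) * (m - 1) / ecoef 3 (m - 1) = (m - 1) * (m / ecoef 3 (m - 1)) by ring,
    ecoef_three_pred (by omega), pathConst]
  simp only [ecoef_two, ecoef_three, hsum_two_eq]
  push_cast
  field_simp
  ring

lemma pathConst_eq : 4 * phi m ^ 2 * pathConst m = 2 * (m - 1) / (m + 1) * CK m := by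
  rw [pathConst, CK]; ring

/-- The deviation of `lcoef 2` has mean `-ecoef 2 / (2 φ)`, so adding `phi * ecoef 2` centres `2 φ ^
2` times this deviation and the second moment becomes a variance. -/
lemma expC_cdevN_sq (hm : 2 ≤ m) :
    (expC m (cdevN m * cdevN m) - (4 * phi m ^ 4 * pathConst m : ℂ) • ecoef 3)
      =o[atTop] (ecoef (3 : ℝ)) := by
  have hphi : (phi m : ℂ) ≠ 0 := by exact_mod_cast (phi_pos hm).ne'
  have hk2 : ∀ k : ℕ, (2 : ℂ) + k ≠ 0 := ne_neg_nat_of_re_pos (by simp)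
  set W : ℕ × (Fin m → ℕ) → ℂ := (2 * phi m ^ 2 : ℂ) • dev m (lcoef 2)
    + fun p => phi m * ecoef (2 : ℂ) p.1 with hW
  set V := cdevN m - W with hV
  have hVo : V =o[compFilter m] (fun p => ecoef (2 : ℝ) p.1) := by
    refine (cdevN_expansion (m := m) hm).congr_left fun p => ?_
    simp only [hV, hW, Pi.sub_apply, Pi.add_apply]; ring
  have hN := cdevN_isBigO (m := m) hm
  have hWO : W =O[compFilter m] (fun p => ecoef (2 : ℝ) p.1) := by
    refine (hN.sub hVo.isBigO).congr_left fun p => ?_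
    simp only [hV, Pi.sub_apply]; ring
  have hE := (ecoef_mul_isTheta (s := 2) (t := 2) two_pos two_pos
    (by norm_num)).isBigO.comp_tendsto (tendsto_fst_compFilter (m := m))
  have h1 := expC_isLittleO (m := m) (g := ecoef (2 + 2 - 1)) (by omega)
    ((hVo.mul_isBigO (hN.add hWO)).trans_isBigO hE)
  rw [show (2 : ℝ) + 2 - 1 = 3 by norm_num] at h1
  have h2 := (expI_lcoef_sq_sub hm).const_smul_left (4 * phi m ^ 4 : ℂ)
  refine (h1.add h2).congr' ?_ EventuallyEq.rfl
  have hsplit : cdevN m * cdevN m = (fun p => V p * (cdevN m p + W p))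
      + ((4 * phi m ^ 4 : ℂ) • (dev m (lcoef 2) * dev m (lcoef 2))
        + dev m (lcoef 2) * (fun p => 4 * phi m ^ 3 * ecoef (2 : ℂ) p.1)
        + (fun _ => 1) * fun p => phi m ^ 2 * ecoef (2 : ℂ) p.1 ^ 2) := by
    ext p
    simp only [hV, hW, Pi.add_apply, Pi.sub_apply, Pi.mul_apply, Pi.smul_apply, smul_eq_mul]; ring
  filter_upwards [expC_dev (m := m) (by omega) (lcoef 2),
    expC_dev_mul_dev (m := m) (by omega) (lcoef 2) (lcoef 2), eventually_ge_atTop m]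
    with n hn hn2 hmn
  have hmm : (m : ℂ) ≠ 0 := by exact_mod_cast (by omega : m ≠ 0)
  have hT2 : opT m (lcoef 2) n = lcoef 2 n - ecoef 2 n * (1 / (2 * (phi m : ℂ))) := by
    rw [opT_lcoef (by omega) hk2 (by omega), ecoef_two_pred (by omega), div_self hmm, one_mul,
      hsum_two_pred hm, lcoef]; ring
  have hone : expC m (fun _ => 1) n = 1 := expI_one (by omega) (by omega) 1
  rw [hsplit, expC_add, expC_add, expC_add, expC_smul,
    expC_mul_fst (dev m (lcoef 2)) (fun n => 4 * phi m ^ 3 * ecoef (2 : ℂ) n),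
    expC_mul_fst (fun _ => 1) (fun n => phi m ^ 2 * ecoef (2 : ℂ) n ^ 2)]
  simp only [Pi.add_apply, Pi.sub_apply, Pi.mul_apply, Pi.smul_apply, smul_eq_mul] at hn hn2 ⊢
  rw [hn, hn2, hone, hT2]
  field_simp
  ring

/-- Crude orders suffice: if `σ < 2` bounds the real parts of the other zeros, both covariances are
`O(ecoef (σ + 1))`. Taking `σ > 3 / 2` puts the exponent `2 σ - 1` of the first toll above `2`, as
the transfer requires. -/
lemma covSS_covSN_isLittleO (hm : 2 ≤ m) :
    toC (covSS m) =o[atTop] (ecoef (3 : ℝ)) ∧ toC (covSN m) =o[atTop] (ecoef (3 : ℝ)) := by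
  obtain ⟨σ, h1, h2, h3⟩ := exists_re_bound_two hm (l := 3 / 2) (by norm_num)
  have hσ0 : 0 < σ := by linarith
  have hS : cdevS m =O[compFilter m] (fun p => ecoef σ p.1) := by
    refine IsBigO.congr' ?_ (cdevS_eventuallyEq hm).symm EventuallyEq.rfl
    refine dev_isBigO (by omega) (by linarith) ?_
    have h4 : ((1 / ((m : ℂ) - 1)) • ecoef (1 : ℂ)) =O[atTop] (ecoef σ) :=
      ((isBigO_ecoef_self (s := 1) (by simp)).trans
        (ecoef_isBigO_of_le (by simp) (by simp; linarith))).const_smul_left _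
    refine ((meanS_sub_isBigO hm (by linarith) h3).add h4).congr_left fun n => ?_
    simp only [Pi.add_apply, Pi.sub_apply]; ring
  have hE := (ecoef_mul_isTheta (s := σ) (t := σ) hσ0 hσ0
    (by linarith)).isBigO.comp_tendsto (tendsto_fst_compFilter (m := m))
  have hE' := (ecoef_mul_isTheta (s := σ) (t := 2) hσ0 two_pos
    (by linarith)).isBigO.comp_tendsto (tendsto_fst_compFilter (m := m))
  have hSS := expC_isBigO (m := m) (g := ecoef (σ + σ - 1)) (by omega) ((hS.mul hS).trans hE)
  have hSN := expC_isBigO (m := m) (g := ecoef (σ + 2 - 1)) (by omega)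
    ((hS.mul (cdevN_isBigO hm)).trans hE')
  have hcSS := (transfer_isBigO hm (covSS_eq_add_opT hm) (by linarith) hSS).trans
    (ecoef_isBigO_of_le (t := σ + 2 - 1) (by linarith) (by linarith))
  have hcSN := transfer_isBigO hm (covSN_eq_add_opT hm) (by linarith)
    ((opT_isBigO (m := m) (by omega) (by linarith) hcSS).add hSN)
  have h5 := ecoef_isLittleO (s := σ + 2 - 1) (t := 3) (by linarith) (by linarith)
  exact ⟨hcSS.trans_isLittleO h5, hcSN.trans_isLittleO h5⟩

/-- The variance of the node path length. -/
theorem covNN_asymptotics (hm : 3 ≤ m) :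
    (covNN m) ~[atTop] (fun n : ℕ => phi m ^ 2 * CK m * (n : ℝ) ^ 2) := by
  have hm0 : (3 : ℝ) ≤ m := by exact_mod_cast hm
  have hmc : (m : ℂ) + 1 ≠ 0 := Nat.cast_add_one_ne_zero m
  have hm1 : (m : ℂ) - 1 ≠ 0 := by
    rw [sub_ne_zero]; exact_mod_cast (by omega : m ≠ 1)
  obtain ⟨hSS, hSN⟩ := covSS_covSN_isLittleO (m := m) (by omega)
  have hk : 1 - m / ecoef (3 : ℂ) (m - 1) = (m - 1) / (m + 1) := by
    rw [ecoef_three_pred (by omega)]; field_simp; ring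
  -- The parameter `3` exceeds all zeros, so the toll is passed on, multiplied by `(m + 1) / (m -
  -- 1)`; this cancels the factor that separates `pathConst` from `CK`.
  obtain ⟨b, hb, ha⟩ := transfer_particular (K := 4 * phi m ^ 4 * pathConst m) (w := 3)
    (by omega) (covNN_eq_add_opT (m := m) (by omega)) (by simp)
    (by rw [hk]; exact div_ne_zero hm1 hmc)
  have hbo : b =o[atTop] (ecoef (3 : ℝ)) := by
    have h1 := opT_isLittleO (m := m) (a := (2 : ℂ) • toC (covSN m) + toC (covSS m)) (by omega)
      (by norm_num) ((hSN.const_smul_left (2 : ℂ)).add hSS)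
    refine (h1.add (expC_cdevN_sq (m := m) (by omega))).congr' ?_ EventuallyEq.rfl
    filter_upwards [hb] with n hn
    rw [hn]
    simp only [Pi.add_apply, Pi.sub_apply]; ring
  have h1 := transfer_isLittleO (by omega) ha (by norm_num) hbo
  have hK : (4 * phi m ^ 4 * pathConst m : ℂ) / ((m - 1) / (m + 1)) = 2 * phi m ^ 2 * CK m := by
    have h2 := congrArg Complex.ofReal (pathConst_eq (m := m))
    push_cast at h2
    rw [div_eq_iff (div_ne_zero hm1 hmc)]
    field_simp at h2 ⊢
    linear_combination (phi m : ℂ) ^ 2 * h2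
  rw [hk, hK] at h1
  have hth : (ecoef (3 : ℝ)) =O[atTop] (fun n : ℕ => (n : ℝ) ^ 2) := by
    refine (ecoef_isTheta_rpow (s := 3) (by norm_num)).isBigO.congr_right fun n => ?_
    norm_num
  have h2 := (re_isBigO_self _).trans_isLittleO (h1.trans_isBigO hth)
  have h3 : (fun n : ℕ => phi m ^ 2 * CK m * (3 * (n : ℝ) + 2)) =o[atTop]
      (fun n : ℕ => (n : ℝ) ^ 2) := by
    have h4 : (fun n : ℕ => (3 * (n : ℝ) + 2)) =O[atTop] (ecoef (2 : ℝ)) := by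
      refine IsBigO.of_bound 3 (Eventually.of_forall fun n => ?_)
      rw [Real.norm_of_nonneg (by positivity), Real.norm_of_nonneg (ecoef_pos two_pos n).le,
        ecoef_two]
      linarith
    exact ((h4.trans_isLittleO (ecoef_isLittleO two_pos (by norm_num))).trans_isBigO
      hth).const_mul_left _
  have hpos : 0 < phi m ^ 2 * CK m :=
    mul_pos (pow_pos (phi_pos (by omega)) 2) (CK_pos hm)
  refine ((h2.add h3).trans_isBigO (isBigO_self_const_mul hpos.ne' _ _)).congr_left fun n => ?_
  have e : (toC (covNN m) - (2 * phi m ^ 2 * CK m : ℂ) • ecoef (3 : ℂ)) n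
      = ((covNN m n - phi m ^ 2 * CK m * ((n + 1) * (n + 2)) : ℝ) : ℂ) := by
    simp only [Pi.sub_apply, Pi.smul_apply, smul_eq_mul, ecoef_three]
    push_cast; ring
  rw [e, Complex.ofReal_re, Pi.sub_apply]; ring

end PathLength

end MarySearchTree
theorem theorem2p3 (m : ℕ) (hm : 3 ≤ m) :
    (m ≤ 13 → ∃ CS : ℝ, 0 < CS ∧
      (fun n : ℕ => Var[MarySearchTree.S m n; MarySearchTree.permLaw n])
        ~[atTop] (fun n : ℕ => CS * (n : ℝ)) ∧
      (fun n : ℕ => cov[MarySearchTree.S m n, MarySearchTree.N m n; MarySearchTree.permLaw n])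
        ~[atTop] (fun n : ℕ => 2 * MarySearchTree.phi m * CS * (n : ℝ) * Real.log (n : ℝ))) ∧
    (14 ≤ m → (∃ lam : ℂ, MarySearchTree.IsSecondZero m lam) ∧
      ∀ lam : ℂ, MarySearchTree.IsSecondZero m lam →
        (fun n : ℕ =>
            cov[MarySearchTree.S m n, MarySearchTree.N m n; MarySearchTree.permLaw n] -
              MarySearchTree.phi m * MarySearchTree.F2 m lam (lam.im * Real.log (n : ℝ)) *
                (n : ℝ) ^ lam.re)
          =o[atTop] (fun n : ℕ => (n : ℝ) ^ lam.re)) ∧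
    (fun n : ℕ => Var[MarySearchTree.N m n; MarySearchTree.permLaw n])
      ~[atTop] (fun n : ℕ => MarySearchTree.phi m ^ 2 * MarySearchTree.CK m * (n : ℝ) ^ 2) := by
  have hvar : ∀ (n : ℕ) (f : Equiv.Perm (Fin n) → ℝ),
      Var[f; MarySearchTree.permLaw n] = cov[f, f; MarySearchTree.permLaw n] := fun n f =>
    (covariance_self Measurable.of_discrete.aemeasurable).symm
  simp only [hvar]
  exact ⟨MarySearchTree.cov_small_arity hm,
    fun h => ⟨MarySearchTree.exists_isSecondZero h, fun _ hl => hl.covSN_asymptotics h⟩,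
    MarySearchTree.covNN_asymptotics hm⟩
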